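/- Let $n\ge 2$ and $p\in\mathbb N_0$. Let $\mathcal P^n$ be the set of nonempty convex polytopes in $\mathbb R^n$, $\Sigma^n=\mathbb R^n\times\mathbb S^{n-1}$ with Borel $\sigma$-algebra $\mathcal B(\Sigma^n)$, and let $\mathbb T^p$ be the space of symmetric tensors of rank $p$ on $\mathbb R^n$, i.e. symmetric $p$-linear functionals on $\mathbb R^n$ (with $\mathbb T^0=\mathbb R$; vectors are identified with linear functionals via the scalar product). Products and powers of tensors are symmetric tensor products, $Q\in\mathbb T^2$ is the metric tensor $Q(a,b)=\langle a,b\rangle$, and for a linear subspace $L$, $Q_L(a,b)=\langle\pi_La,\pi_Lb\rangle$ with the orthogonal projection $\pi_L$ to $L$. For $P\in\mathcal P^n$, let $\mathcal F_k(P)$ be the set of its $k$-dimensional faces, $L(F)$ the direction space of the face $F$, $\nu(P,F)\subset\mathbb S^{n-1}$ the set of outer unit normal vectors of $P$ at $F$, and $\mathrm{Nor}\,P$ the set of pairs $(x,u)\in\Sigma^n$ with $x$ a boundary point of $P$ and $u$ an outer unit normal vector of $P$ at $x$. Let $\mathcal H^d$ denote the $d$-dimensional Hausdorff measure and $\omega_m=2\pi^{m/2}/\Gamma(m/2)$.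 Let $\widetilde T_p(\mathcal P^n)$ be the real vector space of all mappings $\Gamma:\mathcal P^n\times\mathcal B(\Sigma^n)\to\mathbb T^p$ with the following properties. (a) For each $P\in\mathcal P^n$, $\Gamma(P,\cdot)$ is a ($\sigma$-additive) $\mathbb T^p$-valued measure. (b) $\Gamma$ is translation covariant, i.e. there are $q\in\{0,\dots,p\}$ and mappings $\Gamma_{p-j}:\mathcal P^n\times\mathcal B(\Sigma^n)\to\mathbb T^{p-j}$, $j=0,\dots,q$, with $\Gamma_p=\Gamma$ and $\Gamma(P+t,\eta+t)=\sum_{j=0}^q\Gamma_{p-j}(P,\eta)\,t^j/j!$ for all $P$, $\eta$ and $t\in\mathbb R^n$, where $\eta+t=\{(x+t,u):(x,u)\in\eta\}$; and $\Gamma$ is $\mathrm{SO}(n)$ covariant, i.e. $\Gamma(\vartheta P,\vartheta\eta)=\vartheta\Gamma(P,\eta)$ for all $P$, $\eta$ and $\vartheta\in\mathrm{SO}(n)$, where $\vartheta\eta=\{(\vartheta x,\vartheta u):(x,u)\in\eta\}$ and $(\vartheta T)(x_1,\dots,x_p)=T(\vartheta^{-1}x_1,\dots,\vartheta^{-1}x_p)$.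 (c) $\Gamma$ is locally defined, i.e. $\eta\cap\mathrm{Nor}\,P=\eta'\cap\mathrm{Nor}\,P'$ implies $\Gamma(P,\eta)=\Gamma(P',\eta')$. For $k\in\{0,\dots,n-1\}$ and $r,s,j\in\mathbb N_0$, with $j=0$ if $k=0$, let $$\phi_k^{r,s,j}(P,\eta)=\frac1{r!\,s!\,\omega_{n-k+s}}\sum_{F\in\mathcal F_k(P)}Q_{L(F)}^j\int_F\int_{\nu(P,F)}\mathbf 1_\eta(x,u)\,x^ru^s\,\mathcal H^{n-k-1}(\mathrm du)\,\mathcal H^k(\mathrm dx).$$ If $n=3$, with the standard orientation of $\mathbb R^3$ and a unit vector $v_F\in L(F)$ chosen for each edge $F$ (the choice does not matter), let $$\widetilde\phi^{r,s,j}(P,\eta)=\sum_{F\in\mathcal F_1(P)}Q_{L(F)}^jv_F\int_F\int_{\nu(P,F)}\mathbf 1_\eta(x,u)\,x^r(v_F\times u)u^s\,\mathcal H^1(\mathrm du)\,\mathcal H^1(\mathrm dx).$$ If $n=2$, let, for $k\in\{0,1\}$, $$\widetilde\phi_k^{r,s}(P,\eta)=\sum_{F\in\mathcal F_k(P)}\int_F\int_{\nu(P,F)}\mathbf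 1_\eta(x,u)\,x^r\,\overline u\,u^s\,\mathcal H^{1-k}(\mathrm du)\,\mathcal H^k(\mathrm dx),$$ where $\overline u$ is the unit vector such that $(u,\overline u)$ is a positively oriented orthonormal basis of $\mathbb R^2$ (with its standard orientation). Then a basis of $\widetilde T_p(\mathcal P^n)$ is given by the mappings $Q^m\phi_k^{r,s,j}$, where $m,r,s,j\in\mathbb N_0$ satisfy $2m+2j+r+s=p$, where $k\in\{0,\dots,n-1\}$, and where $j=0$ if $k\in\{0,n-1\}$, together with - if $n\ge4$, no more mappings, - if $n=3$, the mappings $Q^m\widetilde\phi^{r,s,j}$, where $m,r,s,j\in\mathbb N_0$ satisfy $2m+2j+r+s+2=p$, - if $n=2$, the mappings $Q^m\widetilde\phi_k^{r,s}$, where $m,r,s\in\mathbb N_0$ satisfy $2m+r+s+1=p$ and where $k\in\{0,1\}$. -/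

import Mathlib

open MeasureTheory

namespace LocalTensor

/-! ### Euclidean space and symmetric tensors -/

/-- Euclidean space `ℝⁿ`. -/
abbrev E (n : ℕ) : Type := EuclideanSpace ℝ (Fin n)

/-- The real vector space of symmetric `p`-linear functionals on `ℝⁿ`, as a subspace of all
(automatically continuous) `p`-linear functionals. -/
def symTensor (n p : ℕ) : Submodule ℝ (ContinuousMultilinearMap ℝ (fun _ : Fin p => E n) ℝ) where
  carrier := {T | ∀ (σ : Equiv.Perm (Fin p)) (x : Fin p → E n), T (fun i => x (σ i)) = T x}
  add_mem' := by
    intro S T hS hT σ x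
    simp [hS σ x, hT σ x]
  zero_mem' := by
    intro σ x
    simp
  smul_mem' := by
    intro c T hT σ x
    simp [hT σ x]

/-- `𝕋ᵖ`, the space of symmetric tensors of rank `p` on `ℝⁿ`. -/
abbrev Tensor (n p : ℕ) : Type := symTensor n p

/-- The space of symmetric tensors is complete (so Bochner integrals with values in it are the
genuine ones). -/
instance instCompleteSpaceTensor (n p : ℕ) : CompleteSpace (Tensor n p) := by
  have h : IsClosed ((symTensor n p : Submodule ℝ
      (ContinuousMultilinearMap ℝ (fun _ : Fin p => E n) ℝ)) :
      Set (ContinuousMultilinearMap ℝ (fun _ : Fin p => E n) ℝ)) := by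
    have : ((symTensor n p : Submodule ℝ
        (ContinuousMultilinearMap ℝ (fun _ : Fin p => E n) ℝ)) :
        Set (ContinuousMultilinearMap ℝ (fun _ : Fin p => E n) ℝ)) =
        ⋂ (σ : Equiv.Perm (Fin p)), ⋂ (x : Fin p → E n),
          {T : ContinuousMultilinearMap ℝ (fun _ : Fin p => E n) ℝ |
            T (fun i => x (σ i)) = T x} := by
      ext T
      simp [symTensor]
    rw [this]
    refine isClosed_iInter fun σ => isClosed_iInter fun x => isClosed_eq ?_ ?_
    · exact (continuous_eval_const _)
    · exact (continuous_eval_const _)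
  exact h.completeSpace_coe

/-! Shortcuts that fix the paths along which the standard structures on `𝕋ᵖ` are found. -/

noncomputable instance instAddCommMonoidTensor (n p : ℕ) : AddCommMonoid (Tensor n p) :=
  AddCommGroup.toAddCommMonoid

noncomputable instance instNormedAddCommGroupTensor (n p : ℕ) : NormedAddCommGroup (Tensor n p) :=
  inferInstance

noncomputable instance instAddCommGroupTensor (n p : ℕ) : AddCommGroup (Tensor n p) :=
  NormedAddCommGroup.toAddCommGroup

/-- Transport along an equality of ranks. -/
def castRank {n a b : ℕ} (h : a = b) (T : Tensor n a) : Tensor n b := h ▸ T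

/-- One summand of the symmetric tensor product:
`x ↦ S (x (σ 0), …, x (σ (a-1))) * T (x (σ a), …, x (σ (a+b-1)))`. -/
noncomputable def mulSummand {n a b : ℕ} (S : Tensor n a) (T : Tensor n b)
    (σ : Equiv.Perm (Fin (a + b))) : MultilinearMap ℝ (fun _ : Fin (a + b) => E n) ℝ :=
  ((LinearMap.mul' ℝ ℝ).compMultilinearMap
    (S.1.toMultilinearMap.domCoprod T.1.toMultilinearMap)).domDomCongr (finSumFinEquiv.trans σ)

theorem mulSummand_apply {n a b : ℕ} (S : Tensor n a) (T : Tensor n b)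
    (σ : Equiv.Perm (Fin (a + b))) (x : Fin (a + b) → E n) :
    mulSummand S T σ x =
      S.1 (fun i => x (σ (Fin.castAdd b i))) * T.1 (fun i => x (σ (Fin.natAdd a i))) := by
  simp [mulSummand]

/-- The symmetric tensor product `S ⊙ T`, i.e. the average of
`S (x (σ 0), …, x (σ (a-1))) * T (x (σ a), …, x (σ (a+b-1)))` over all permutations `σ`. -/
noncomputable def symMul {n a b : ℕ} (S : Tensor n a) (T : Tensor n b) : Tensor n (a + b) :=
  ⟨{ toMultilinearMap :=
      (((a + b).factorial : ℝ)⁻¹) • ∑ σ : Equiv.Perm (Fin (a + b)), mulSummand S T σ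
     cont := by
      have h : ∀ x : Fin (a + b) → E n,
          ((((a + b).factorial : ℝ)⁻¹) •
            ∑ σ : Equiv.Perm (Fin (a + b)), mulSummand S T σ).toFun x =
          ((a + b).factorial : ℝ)⁻¹ * ∑ σ : Equiv.Perm (Fin (a + b)),
            (S.1 (fun i => x (σ (Fin.castAdd b i))) *
              T.1 (fun i => x (σ (Fin.natAdd a i)))) := by
        intro x
        simp [mulSummand_apply]
      have hS := S.1.cont
      have hT := T.1.cont
      refine Continuous.congr ?_ (fun x => (h x).symm)
      refine continuous_const.mul (continuous_finsetSum _ fun σ _ => Continuous.mul ?_ ?_)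
      · exact S.1.cont.comp (continuous_pi fun i => continuous_apply _)
      · exact T.1.cont.comp (continuous_pi fun i => continuous_apply _) },
    by
      intro τ x
      change ((((a + b).factorial : ℝ)⁻¹) •
            ∑ σ : Equiv.Perm (Fin (a + b)), mulSummand S T σ) (fun i => x (τ i)) =
          ((((a + b).factorial : ℝ)⁻¹) •
            ∑ σ : Equiv.Perm (Fin (a + b)), mulSummand S T σ) x
      simp only [smul_apply, sum_apply, mulSummand_apply]
      congr 1
      exact Fintype.sum_equiv (Equiv.mulLeft τ) _ _ (fun σ => by simp)⟩

theorem symMul_apply {n a b : ℕ} (S : Tensor n a) (T : Tensor n b) (x : Fin (a + b) → E n) :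
    (symMul S T).1 x = ((a + b).factorial : ℝ)⁻¹ * ∑ σ : Equiv.Perm (Fin (a + b)),
      S.1 (fun i => x (σ (Fin.castAdd b i))) * T.1 (fun i => x (σ (Fin.natAdd a i))) := by
  change ((((a + b).factorial : ℝ)⁻¹) •
            ∑ σ : Equiv.Perm (Fin (a + b)), mulSummand S T σ) x = _
  simp [mulSummand_apply]

theorem symMul_add_left {n a b : ℕ} (S S' : Tensor n a) (T : Tensor n b) :
    symMul (S + S') T = symMul S T + symMul S' T := by
  apply Subtype.ext
  ext x
  simp [symMul_apply, add_mul, Finset.sum_add_distrib, mul_add]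

theorem symMul_smul_left {n a b : ℕ} (c : ℝ) (S : Tensor n a) (T : Tensor n b) :
    symMul (c • S) T = c • symMul S T := by
  apply Subtype.ext
  ext x
  simp [symMul_apply, mul_assoc, ← Finset.mul_sum, mul_left_comm]

theorem symMul_zero_left {n a b : ℕ} (T : Tensor n b) :
    symMul (0 : Tensor n a) T = 0 := by
  apply Subtype.ext
  ext x
  simp [symMul_apply]

theorem castRank_add {n a b : ℕ} (h : a = b) (S T : Tensor n a) :
    castRank h (S + T) = castRank h S + castRank h T := by
  subst h; rfl

theorem castRank_smul {n a b : ℕ} (h : a = b) (c : ℝ) (T : Tensor n a) :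
    castRank h (c • T) = c • castRank h T := by
  subst h; rfl

theorem castRank_zero {n a b : ℕ} (h : a = b) :
    castRank h (0 : Tensor n a) = 0 := by
  subst h; rfl

/-- The `r`-fold symmetric tensor product `xʳ` of a vector `x`:
`xʳ (y₁, …, y_r) = ⟨x, y₁⟩ ⋯ ⟨x, y_r⟩`. For `r = 1` it is the vector `x` itself, considered as
a linear functional. -/
noncomputable def vecPow {n : ℕ} (x : E n) (r : ℕ) : Tensor n r :=
  ⟨(ContinuousMultilinearMap.mkPiAlgebra ℝ (Fin r) ℝ).compContinuousLinearMap
      (fun _ => innerSL ℝ x),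
    by
      intro σ y
      simpa using Equiv.prod_comp σ (fun i => inner ℝ x (y i))⟩

theorem vecPow_apply {n : ℕ} (x : E n) (r : ℕ) (y : Fin r → E n) :
    (vecPow x r).1 y = ∏ i, inner ℝ x (y i) := by
  simp [vecPow]

/-- The unit `1 ∈ 𝕋⁰ = ℝ`. -/
noncomputable def oneTensor (n : ℕ) : Tensor n 0 := vecPow 0 0

/-- Symmetric powers `T^m` of a symmetric tensor. -/
noncomputable def symPow {n a : ℕ} (T : Tensor n a) : (m : ℕ) → Tensor n (a * m)
  | 0 => oneTensor n
  | m + 1 => symMul (symPow T m) T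

/-- The tensor `Q_L`, with `Q_L (a, b) = ⟨π_L a, π_L b⟩`, where `π_L` is the orthogonal projection
to the linear subspace `L`. -/
noncomputable def projTensor {n : ℕ} (L : Submodule ℝ (E n)) : Tensor n 2 :=
  ⟨{ toFun := fun x => inner ℝ (L.starProjection (x 0)) (L.starProjection (x 1))
     map_update_add' := by
      intro _ m i x y
      fin_cases i <;> simp [Function.update, inner_add_left, inner_add_right]
     map_update_smul' := by
      intro _ m i c x
      fin_cases i <;> simp [Function.update, inner_smul_left, inner_smul_right]
     cont := by fun_prop },
    by
      intro σ x
      change inner ℝ (L.starProjection (x (σ 0))) (L.starProjection (x (σ 1))) =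
        inner ℝ (L.starProjection (x 0)) (L.starProjection (x 1))
      have h01 : σ 0 ≠ σ 1 := fun h => by simpa using σ.injective h
      rcases Fin.exists_fin_two.mp ⟨σ 0, rfl⟩ with h0 | h0 <;>
        rcases Fin.exists_fin_two.mp ⟨σ 1, rfl⟩ with h1 | h1 <;>
        simp_all [real_inner_comm]⟩

/-- The metric tensor `Q`, with `Q (a, b) = ⟨a, b⟩`. -/
noncomputable def metricTensor (n : ℕ) : Tensor n 2 := projTensor ⊤

theorem metricTensor_apply (n : ℕ) (x : Fin 2 → E n) :
    (metricTensor n).1 x = inner ℝ (x 0) (x 1) := by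
  change inner ℝ ((⊤ : Submodule ℝ (E n)).starProjection (x 0))
    ((⊤ : Submodule ℝ (E n)).starProjection (x 1)) = _
  rw [Submodule.starProjection_eq_self_iff.2 Submodule.mem_top,
    Submodule.starProjection_eq_self_iff.2 Submodule.mem_top]

/-- The operation of linear isometries on symmetric tensors,
`(ϑT)(x₁, …, x_p) = T(ϑ⁻¹x₁, …, ϑ⁻¹x_p)`. -/
noncomputable def rotTensor {n p : ℕ} (ϑ : E n ≃ₗᵢ[ℝ] E n) (T : Tensor n p) : Tensor n p :=
  ⟨T.1.compContinuousLinearMap (fun _ => (ϑ.symm.toContinuousLinearEquiv : E n →L[ℝ] E n)),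
    by
      intro σ x
      exact T.2 σ (fun i => ϑ.symm (x i))⟩

theorem rotTensor_apply {n p : ℕ} (ϑ : E n ≃ₗᵢ[ℝ] E n) (T : Tensor n p) (x : Fin p → E n) :
    (rotTensor ϑ T).1 x = T.1 (fun i => ϑ.symm (x i)) := rfl

/-! ### Polytopes, faces, normal vectors -/

/-- A (convex, nonempty) polytope: the convex hull of a nonempty finite set. -/
def IsPolytope {n : ℕ} (P : Set (E n)) : Prop :=
  ∃ s : Set (E n), s.Finite ∧ s.Nonempty ∧ P = convexHull ℝ s

/-- `𝒫ⁿ`, the set of polytopes in `ℝⁿ`. -/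
abbrev Polytope (n : ℕ) : Type := {P : Set (E n) // IsPolytope P}

theorem IsPolytope.image {n : ℕ} {P : Set (E n)} (hP : IsPolytope P) (f : E n →ᵃ[ℝ] E n) :
    IsPolytope (f '' P) := by
  obtain ⟨s, hs, hne, rfl⟩ := hP
  exact ⟨f '' s, hs.image f, hne.image f, f.image_convexHull s⟩

/-- The translate `P + t`. -/
noncomputable def Polytope.translate {n : ℕ} (P : Polytope n) (t : E n) : Polytope n :=
  ⟨(fun x => x + t) '' P.1, by
    simpa using P.2.image ((AffineEquiv.vaddConst ℝ t : E n ≃ᵃ[ℝ] E n) : E n →ᵃ[ℝ] E n)⟩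

/-- The image `ϑP` under a linear isometry. -/
noncomputable def Polytope.rotate {n : ℕ} (ϑ : E n ≃ₗᵢ[ℝ] E n) (P : Polytope n) : Polytope n :=
  ⟨ϑ '' P.1, P.2.image (ϑ.toLinearEquiv : E n →ₗ[ℝ] E n).toAffineMap⟩

/-- The direction space `L(F)`: the linear subspace parallel to the affine hull of `F`. -/
noncomputable def dirSpace {n : ℕ} (F : Set (E n)) : Submodule ℝ (E n) := (affineSpan ℝ F).direction

/-- `𝓕_k(P)`, the set of `k`-dimensional faces of `P`. A face is a nonempty set of the form
`{x ∈ P | ∀ y ∈ P, l y ≤ l x}` with a linear functional `l`; in particular (`l = 0`)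
`P` is a face of itself. -/
def faces {n : ℕ} (P : Polytope n) (k : ℕ) : Set (Set (E n)) :=
  {F | F.Nonempty ∧ IsExposed ℝ P.1 F ∧ Module.finrank ℝ (dirSpace F) = k}

theorem finite_faces {n : ℕ} (P : Polytope n) (k : ℕ) : (faces P k).Finite := by
  obtain ⟨P, s, hs, -, rfl⟩ := P
  refine Set.Finite.of_finite_image (f := fun F => F.extremePoints ℝ)
    (hs.finite_subsets.subset ?_) ?_
  · rintro _ ⟨F, hF, rfl⟩
    exact (hF.2.1.isExtreme.extremePoints_subset_extremePoints).trans
      extremePoints_convexHull_subset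
  · intro F hF G hG hFG
    have hc : IsCompact (convexHull ℝ s) := hs.isCompact_convexHull ℝ
    have hv : Convex ℝ (convexHull ℝ s) := convex_convexHull ℝ s
    rw [← closure_convexHull_extremePoints (hF.2.1.isCompact hc) (hF.2.1.convex hv),
      ← closure_convexHull_extremePoints (hG.2.1.isCompact hc) (hG.2.1.convex hv)]
    exact congrArg (fun A => closure (convexHull ℝ A)) hFG

/-- The unit sphere `𝕊ⁿ⁻¹`. -/
abbrev Sph (n : ℕ) : Type := Metric.sphere (0 : E n) 1

/-- `Σⁿ = ℝⁿ × 𝕊ⁿ⁻¹`. -/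
abbrev Sig (n : ℕ) : Type := E n × Sph n

/-- `ℬ(Σⁿ)`, the Borel subsets of `Σⁿ`. -/
abbrev BorelSig (n : ℕ) : Type := {η : Set (Sig n) // MeasurableSet η}

/-- `ν(P,F)`, the set of outer unit normal vectors of `P` at its face `F`. -/
def normals {n : ℕ} (P : Polytope n) (F : Set (E n)) : Set (Sph n) :=
  {u | ∀ x ∈ F, ∀ y ∈ P.1, inner ℝ y (u : E n) ≤ inner ℝ x (u : E n)}

/-- `Nor P`, the generalized normal bundle of `P`. -/
def Nor {n : ℕ} (P : Polytope n) : Set (Sig n) :=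
  {z | z.1 ∈ frontier P.1 ∧ ∀ y ∈ P.1, inner ℝ y (z.2 : E n) ≤ inner ℝ z.1 (z.2 : E n)}

/-- The map `(x, u) ↦ (x + t, u)` of `Σⁿ`. -/
noncomputable def translateSig {n : ℕ} (t : E n) : Sig n ≃ₜ Sig n :=
  (Homeomorph.addRight t).prodCongr (Homeomorph.refl _)

/-- The map `(x, u) ↦ (ϑx, ϑu)` of `Σⁿ`. -/
noncomputable def rotateSig {n : ℕ} (ϑ : E n ≃ₗᵢ[ℝ] E n) : Sig n ≃ₜ Sig n :=
  ϑ.toHomeomorph.prodCongr (ϑ.toHomeomorph.subtype (fun x => by simp))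

/-- `η + t`. -/
noncomputable def BorelSig.translate {n : ℕ} (η : BorelSig n) (t : E n) : BorelSig n :=
  ⟨translateSig t '' η.1, (translateSig t).toMeasurableEquiv.measurableSet_image.2 η.2⟩

/-- `ϑη`. -/
noncomputable def BorelSig.rotate {n : ℕ} (ϑ : E n ≃ₗᵢ[ℝ] E n) (η : BorelSig n) : BorelSig n :=
  ⟨rotateSig ϑ '' η.1, (rotateSig ϑ).toMeasurableEquiv.measurableSet_image.2 η.2⟩

/-! ### The properties of the mappings `Γ : 𝒫ⁿ × ℬ(Σⁿ) → 𝕋ᵖ` -/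

/-- Mappings `𝒫ⁿ × ℬ(Σⁿ) → 𝕋ᵖ`. -/
abbrev TMap (n p : ℕ) : Type := Polytope n → BorelSig n → Tensor n p

/-- `Γ(P, ·)` is a (countably additive) `𝕋ᵖ`-valued measure, for each `P`. -/
def IsMeasureValued {n p : ℕ} (Γ : TMap n p) : Prop :=
  ∀ P : Polytope n, ∃ μ : VectorMeasure (Sig n) (Tensor n p), ∀ η : BorelSig n, μ η.1 = Γ P η

/-- The right side `∑_{j=0}^q Γ_{p-j}(P,η) t^j / j!` of the covariance relation; here `Γ' j`
stands for `Γ_{p-j}`. -/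
noncomputable def translationSum {n p q : ℕ} (hq : q ≤ p) (Γ' : (j : ℕ) → TMap n (p - j))
    (P : Polytope n) (η : BorelSig n) (t : E n) : Tensor n p :=
  ∑ j : Fin (q + 1), ((j : ℕ).factorial : ℝ)⁻¹ •
    castRank (Nat.sub_add_cancel ((Nat.lt_succ_iff.1 j.2).trans hq))
      (symMul (Γ' j P η) (vecPow t j))

/-- `Γ` is translation covariant of degree `q ≤ p`. -/
def IsTranslationCovariantOfDegree {n p : ℕ} (Γ : TMap n p) (q : ℕ) : Prop :=
  ∃ (hq : q ≤ p) (Γ' : (j : ℕ) → TMap n (p - j)), Γ' 0 = Γ ∧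
    ∀ (P : Polytope n) (η : BorelSig n) (t : E n),
      Γ (P.translate t) (η.translate t) = translationSum hq Γ' P η t

/-- `Γ` is translation covariant (of some degree `q ≤ p`). -/
def IsTranslationCovariant {n p : ℕ} (Γ : TMap n p) : Prop :=
  ∃ q : ℕ, IsTranslationCovariantOfDegree Γ q

/-- `Γ` is `SO(n)` covariant: `Γ(ϑP, ϑη) = ϑ Γ(P, η)` for all linear isometries `ϑ` with
determinant `1`. -/
def IsSOCovariant {n p : ℕ} (Γ : TMap n p) : Prop :=
  ∀ ϑ : E n ≃ₗᵢ[ℝ] E n, LinearMap.det (ϑ.toLinearEquiv : E n →ₗ[ℝ] E n) = 1 →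
    ∀ (P : Polytope n) (η : BorelSig n),
      Γ (P.rotate ϑ) (η.rotate ϑ) = rotTensor ϑ (Γ P η)

/-- `Γ` is locally defined. -/
def IsLocallyDefined {n p : ℕ} (Γ : TMap n p) : Prop :=
  ∀ (P P' : Polytope n) (η η' : BorelSig n),
    η.1 ∩ Nor P = η'.1 ∩ Nor P' → Γ P η = Γ P' η'

theorem IsTranslationCovariantOfDegree.mono {n p q q' : ℕ} {Γ : TMap n p}
    (h : IsTranslationCovariantOfDegree Γ q) (hqq' : q ≤ q') (hq' : q' ≤ p) :
    IsTranslationCovariantOfDegree Γ q' := by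
  induction q', hqq' using Nat.le_induction with
  | base => exact h
  | succ m hm ih =>
    obtain ⟨hmp, Γ', h0, hΓ⟩ := ih (Nat.le_of_succ_le hq')
    refine ⟨hq', fun j => if j ≤ m then Γ' j else 0, by simp [h0], fun P η t => ?_⟩
    rw [hΓ P η t, translationSum, translationSum, Fin.sum_univ_castSucc (n := m + 1)]
    have hlast : ((Fin.last (m + 1) : Fin (m + 1 + 1)) : ℕ) = m + 1 := rfl
    have hz : (if ((Fin.last (m + 1) : Fin (m + 1 + 1)) : ℕ) ≤ m
        then Γ' ((Fin.last (m + 1) : Fin (m + 1 + 1)) : ℕ) else 0) P η = 0 := by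
      rw [if_neg (by rw [hlast]; omega)]; rfl
    rw [hz, symMul_zero_left, castRank_zero, smul_zero, add_zero]
    refine Finset.sum_congr rfl fun j _ => ?_
    have hj : (if ((j.castSucc : Fin (m + 1 + 1)) : ℕ) ≤ m
        then Γ' ((j.castSucc : Fin (m + 1 + 1)) : ℕ) else 0) = Γ' (j : ℕ) := by
      rw [if_pos (by simpa using Nat.lt_succ_iff.1 j.2)]; rfl
    rw [hj]
    rfl

/-- The real vector space of all mappings `Γ : 𝒫ⁿ × ℬ(Σⁿ) → 𝕋ᵖ` such that `Γ(P, ·)` is a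
`𝕋ᵖ`-valued measure for each `P`, and `Γ` is translation covariant, `SO(n)` covariant and locally
defined. -/
def localTensorSpace (n p : ℕ) : Submodule ℝ (TMap n p) where
  carrier := {Γ | IsMeasureValued Γ ∧ (IsTranslationCovariant Γ ∧ IsSOCovariant Γ) ∧
    IsLocallyDefined Γ}
  add_mem' := by
    rintro Γ Δ ⟨hm, ⟨⟨q, ht⟩, hr⟩, hl⟩ ⟨hm', ⟨⟨q', ht'⟩, hr'⟩, hl'⟩
    refine ⟨fun P => ?_, ⟨?_, fun ϑ hϑ P η => ?_⟩, fun P P' η η' h => ?_⟩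
    · obtain ⟨μ, hμ⟩ := hm P
      obtain ⟨μ', hμ'⟩ := hm' P
      exact ⟨μ + μ', fun η => by simp [hμ, hμ']⟩
    · have h1 := ht.mono (le_max_left q q') (max_le ht.1 ht'.1)
      have h2 := ht'.mono (le_max_right q q') (max_le ht.1 ht'.1)
      obtain ⟨hq, Γ', hΓ0, hΓ⟩ := h1
      obtain ⟨_, Δ', hΔ0, hΔ⟩ := h2
      refine ⟨max q q', hq, fun j => Γ' j + Δ' j, ?_, fun P η t => ?_⟩
      · change Γ' 0 + Δ' 0 = Γ + Δ
        rw [hΓ0, hΔ0]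
      · simp only [translationSum, Pi.add_apply] at hΓ hΔ ⊢
        rw [hΓ, hΔ, ← Finset.sum_add_distrib]
        refine Finset.sum_congr rfl fun j _ => ?_
        rw [symMul_add_left, castRank_add, smul_add]
    · have h1 := hr ϑ hϑ P η
      have h2 := hr' ϑ hϑ P η
      simp only [Pi.add_apply, h1, h2]
      rfl
    · simp only [Pi.add_apply, hl P P' η η' h, hl' P P' η η' h]
  zero_mem' := by
    refine ⟨fun P => ⟨0, fun η => by simp⟩, ⟨⟨0, Nat.zero_le p, fun _ => 0, rfl, fun P η t => ?_⟩,
      fun ϑ _ P η => rfl⟩, fun P P' η η' _ => rfl⟩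
    simp only [translationSum, Pi.zero_apply]
    refine (Finset.sum_eq_zero fun j _ => ?_).symm
    rw [symMul_zero_left, castRank_zero, smul_zero]
  smul_mem' := by
    rintro c Γ ⟨hm, ⟨⟨q, hq, Γ', hΓ0, hΓ⟩, hr⟩, hl⟩
    refine ⟨fun P => ?_, ⟨⟨q, hq, fun j => c • Γ' j, ?_, fun P η t => ?_⟩, fun ϑ hϑ P η => ?_⟩,
      fun P P' η η' h => ?_⟩
    · obtain ⟨μ, hμ⟩ := hm P
      exact ⟨c • μ, fun η => by simp [hμ]⟩
    · change c • Γ' 0 = c • Γ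
      rw [hΓ0]
    · simp only [translationSum, Pi.smul_apply] at hΓ ⊢
      rw [hΓ, Finset.smul_sum]
      refine Finset.sum_congr rfl fun j _ => ?_
      rw [symMul_smul_left, castRank_smul, smul_comm]
    · simp only [Pi.smul_apply, hr ϑ hϑ P η]
      rfl
    · simp only [Pi.smul_apply, hl P P' η η' h]

/-! ### The local tensor valuations -/

/-- `ω_m = 2 π^{m/2} / Γ(m/2)`, the surface area of the unit sphere in `ℝᵐ`. -/
noncomputable def omega (m : ℕ) : ℝ := 2 * Real.pi ^ ((m : ℝ) / 2) / Real.Gamma ((m : ℝ) / 2)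

/-- `C_{n,k}^{r,s} = (r! s! ω_{n-k+s})⁻¹` (used for `k < n`). -/
noncomputable def coeffC (n k r s : ℕ) : ℝ :=
  ((r.factorial : ℝ) * (s.factorial : ℝ) * omega (n - k + s))⁻¹

open Classical in
/-- `∫_F ∫_{ν(P,F)} 1_η(x,u) f(x,u) ℋ^{n-k-1}(du) ℋ^k(dx)`, with Hausdorff measures normalized as
in the classical case (`ℋ^d` agrees with Lebesgue measure on `d`-dimensional spaces). -/
noncomputable def faceIntegral {n a : ℕ} (P : Polytope n) (k : ℕ) (F : Set (E n))
    (η : BorelSig n) (f : E n → E n → Tensor n a) : Tensor n a :=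
  ∫ x in F, (∫ u in normals P F,
    (if (x, u) ∈ η.1 then f x (u : E n) else 0) ∂(μHE[n - k - 1] : Measure (Sph n)))
      ∂(μHE[k] : Measure (E n))

/-- The generalized local Minkowski tensors
`φ_k^{r,s,j}(P,η) = C_{n,k}^{r,s} ∑_{F ∈ 𝓕_k(P)} Q_{L(F)}^j
  ∫_F ∫_{ν(P,F)} 1_η(x,u) x^r u^s ℋ^{n-k-1}(du) ℋ^k(dx)`. -/
noncomputable def phi (n k r s j : ℕ) : TMap n (2 * j + (r + s)) := fun P η =>
  coeffC n k r s • ∑ F ∈ (finite_faces P k).toFinset,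
    symMul (symPow (projTensor (dirSpace F)) j)
      (faceIntegral P k F η (fun x u => symMul (vecPow x r) (vecPow u s)))

/-- Every one-dimensional linear subspace contains a unit vector. -/
theorem exists_unit_vector {n : ℕ} (L : Submodule ℝ (E n)) (h : Module.finrank ℝ L = 1) :
    ∃ v ∈ L, ‖v‖ = 1 := by
  have : Nontrivial L := Module.nontrivial_of_finrank_pos (R := ℝ) (by omega)
  obtain ⟨v, hv⟩ := exists_norm_eq L (zero_le_one' ℝ)
  exact ⟨v, v.2, by simpa using hv⟩

open Classical in
/-- A chosen unit vector `v_L` in a one-dimensional linear subspace `L` (and `0` for other `L`). -/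
noncomputable def unitVec {n : ℕ} (L : Submodule ℝ (E n)) : E n :=
  if h : Module.finrank ℝ L = 1 then (exists_unit_vector L h).choose else 0

/-- The vector product in `ℝ³` with its standard orientation. -/
noncomputable def cross (v u : E 3) : E 3 := WithLp.toLp 2 (crossProduct (v.ofLp) (u.ofLp))

/-- For `u ∈ 𝕊¹`, the vector `ū` such that `(u, ū)` is an orthonormal basis of `ℝ²` that is
positively oriented with respect to the standard orientation. -/
noncomputable def rotQuarter (u : E 2) : E 2 := !₂[-u 1, u 0]

/-- In `ℝ³`:
`φ̃^{r,s,j}(P,η) = ∑_{F ∈ 𝓕_1(P)} Q_{L(F)}^j v_F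
  ∫_F ∫_{ν(P,F)} 1_η(x,u) x^r (v_F × u) u^s ℋ¹(du) ℋ¹(dx)`. -/
noncomputable def phiTildeThree (r s j : ℕ) : TMap 3 (2 * j + 1 + (r + 1 + s)) := fun P η =>
  ∑ F ∈ (finite_faces P 1).toFinset,
    symMul (symMul (symPow (projTensor (dirSpace F)) j) (vecPow (unitVec (dirSpace F)) 1))
      (faceIntegral P 1 F η (fun x u =>
        symMul (symMul (vecPow x r) (vecPow (cross (unitVec (dirSpace F)) u) 1)) (vecPow u s)))

/-- In `ℝ²`:
`φ̃_k^{r,s}(P,η) = ∑_{F ∈ 𝓕_k(P)} ∫_F ∫_{ν(P,F)} 1_η(x,u) x^r ū u^s ℋ^{1-k}(du) ℋ^k(dx)`. -/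
noncomputable def phiTildeTwo (k r s : ℕ) : TMap 2 (r + 1 + s) := fun P η =>
  ∑ F ∈ (finite_faces P k).toFinset,
    faceIntegral P k F η (fun x u =>
      symMul (symMul (vecPow x r) (vecPow (rotQuarter u) 1)) (vecPow u s))

/-- `Q^m Γ`. -/
noncomputable def metricMul {n a : ℕ} (m : ℕ) (Γ : TMap n a) : TMap n (2 * m + a) := fun P η =>
  symMul (symPow (metricTensor n) m) (Γ P η)

/-- Transport of a mapping along an equality of ranks. -/
def castMap {n a b : ℕ} (h : a = b) (Γ : TMap n a) : TMap n b := fun P η => castRank h (Γ P η)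

/-- Indices of the mappings `Q^m φ_k^{r,s,j}` of rank `p`. -/
@[ext]
structure PhiIndex (n p : ℕ) where
  (m r s j : ℕ)
  k : Fin n
  rank_eq : 2 * m + 2 * j + r + s = p
  j_eq_zero : (k : ℕ) = 0 ∨ (k : ℕ) = n - 1 → j = 0

/-- Indices of the mappings `Q^m φ̃^{r,s,j}` of rank `p`. -/
@[ext]
structure TildeThreeIndex (p : ℕ) where
  (m r s j : ℕ)
  rank_eq : 2 * m + 2 * j + r + s + 2 = p

/-- Indices of the mappings `Q^m φ̃_k^{r,s}` of rank `p`. -/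
@[ext]
structure TildeTwoIndex (p : ℕ) where
  (m r s : ℕ)
  k : Fin 2
  rank_eq : 2 * m + r + s + 1 = p

/-- The mappings `Q^m φ_k^{r,s,j}` of rank `p`. -/
noncomputable def phiFamily (n p : ℕ) (i : PhiIndex n p) : TMap n p :=
  castMap (by have := i.rank_eq; omega) (metricMul i.m (phi n i.k i.r i.s i.j))

/-- The mappings `Q^m φ̃^{r,s,j}` of rank `p`. -/
noncomputable def tildeThreeFamily (p : ℕ) (i : TildeThreeIndex p) : TMap 3 p :=
  castMap (by have := i.rank_eq; omega) (metricMul i.m (phiTildeThree i.r i.s i.j))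

/-- The mappings `Q^m φ̃_k^{r,s}` of rank `p`. -/
noncomputable def tildeTwoFamily (p : ℕ) (i : TildeTwoIndex p) : TMap 2 p :=
  castMap (by have := i.rank_eq; omega) (metricMul i.m (phiTildeTwo i.k i.r i.s))

/-- The family `f` is a basis of the vector space `V` of mappings. -/
def IsBasisOf {n p : ℕ} {ι : Type} (f : ι → TMap n p) (V : Submodule ℝ (TMap n p)) : Prop :=
  ∃ b : Module.Basis ι ℝ V, ∀ i, (b i : TMap n p) = f i

end LocalTensor

/-! A symmetric tensor `T` is the same thing as the homogeneous polynomial `y ↦ T(y, …, y)` (`ev`,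
injective by polarisation). Symmetric products become products of polynomials, so every tensor
identity is checked at a single vector `y`.

Each listed mapping is, up to a nonzero factor, a sum over the `k`-faces of integrals of `x^r
τ(L(F), u)`, where `τ` is a tensor field depending `SO(n)` covariantly on a subspace `L` and a
vector `u ⟂ L` (`TField`, `fieldMap`). Give every affine `k`-plane `A` the product of the Hausdorff
measures on `A` and on its unit normals. The bundle of any other plane is null for it, so the sum
over faces is a sum over all planes of integrals over `η ∩ Nor P` (`ev_fieldMap_eq_finsum`). Local
definedness and covariance can be read off from this form.

Spanning. By translation covariance, `Γ(P + t, η + t)` is at each `y` a polynomial in `⟨t, y⟩`. Its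
leading coefficient is a finite difference of values of `Γ`. It is therefore locally defined,
invariant under translations, covariant under rotations, and a measure at each `y ≠ 0`. Such
mappings are classified by `ev_eq_sum_fieldMap`: they are combinations of the integrals with `r =
0`. Multiplying the integrands by `x^q` gives mappings with the same leading coefficient of degree
`q`; subtracting them lowers the degree, and induction finishes
(`mem_span_of_isTranslationPolynomial`).

The classification works on the relative interior of one face at a time. By locality the face may
replace the polytope. The value on a small ball around `(x, u)` is invariant under the rotations
fixing `L(F)` and `u`, hence a combination of the fields at `(L(F), u)`. Rigid motions act
transitively on the triples of a plane, a point in it and a unit normal, so the coefficients depend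
on the radius only. Averaging these values against a test function recovers the measure as the
radius tends to `0` (`TestData.tendsto`). The coefficients need not converge, but a
finite-dimensional span is closed, so the limit is again a combination with universal coefficients
(`exists_coeff_testData`). Compact sets and then Borel sets follow by approximation.

Invariant theory. Split `y` into its parts in `L`, in the line of `u` and in the remaining space `R`
(`restSpace`). If `dim L ≥ 2` or `dim R ≥ 2`, reflections show that an invariant polynomial depends
only on `‖π_L y‖²`, `⟨u, y⟩` and `‖π_R y‖²`, and the last is eliminated through `‖y‖²`. This yields
the fields `Q^m Q_L^j u^s`, and `j = 0` suffices if `L = 0` or `R = 0`. The exceptions are `n = 3, k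
= 1`, where only the half-turn about `u` remains and `v_L (v_L × u)` is a new invariant, and `n =
2`, where no symmetry remains and `ū` appears.

Independence. A vanishing combination has vanishing integrands (`sum_weight_eq_zero`). The
quantities `⟨x, y⟩, ‖y‖², ‖π_L y‖², ⟨u, y⟩` can be prescribed freely in a product of infinite sets,
so a polynomial in them has zero coefficients (`coeff_eq_zero_of_sum_eq_zero`). The additional
fields are separated by a change of sign. -/

namespace LocalTensor

/-! ### The polynomial of a symmetric tensor -/

/-- The homogeneous polynomial function `y ↦ T(y, …, y)` of a symmetric tensor `T`. -/
noncomputable def ev {n p : ℕ} (T : Tensor n p) (y : E n) : ℝ := T.1 fun _ => y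

theorem ev_sub {n p : ℕ} (S T : Tensor n p) (y : E n) : ev (S - T) y = ev S y - ev T y := rfl

theorem ev_smul {n p : ℕ} (c : ℝ) (T : Tensor n p) (y : E n) : ev (c • T) y = c * ev T y := rfl

theorem ev_zero {n p : ℕ} (y : E n) : ev (0 : Tensor n p) y = 0 := rfl

/-- `T ↦ ev T` as a linear map. -/
noncomputable def evLinear (n p : ℕ) : Tensor n p →ₗ[ℝ] (E n → ℝ) where
  toFun := ev
  map_add' _ _ := rfl
  map_smul' _ _ := rfl

theorem evLinear_apply {n p : ℕ} (T : Tensor n p) (y : E n) : evLinear n p T y = ev T y := rfl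

theorem ev_sum {n p : ℕ} {ι : Type*} (s : Finset ι) (T : ι → Tensor n p) (y : E n) :
    ev (∑ i ∈ s, T i) y = ∑ i ∈ s, ev (T i) y := by
  rw [← evLinear_apply, map_sum, Finset.sum_apply]
  rfl

theorem ev_castRank {n a b : ℕ} (h : a = b) (T : Tensor n a) (y : E n) :
    ev (castRank h T) y = ev T y := by
  subst h; rfl

theorem ev_symMul {n a b : ℕ} (S : Tensor n a) (T : Tensor n b) (y : E n) :
    ev (symMul S T) y = ev S y * ev T y := by
  rw [ev, symMul_apply]
  simp only [Finset.sum_const, Finset.card_univ, Fintype.card_perm, Fintype.card_fin, nsmul_eq_mul]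
  rw [← mul_assoc, inv_mul_cancel₀ (by exact_mod_cast (a + b).factorial_ne_zero), one_mul]
  rfl

theorem ev_vecPow {n : ℕ} (x : E n) (r : ℕ) (y : E n) : ev (vecPow x r) y = inner ℝ x y ^ r := by
  simp [ev, vecPow_apply]

theorem ev_symPow {n a : ℕ} (T : Tensor n a) (m : ℕ) (y : E n) :
    ev (symPow T m) y = ev T y ^ m := by
  induction m with
  | zero => simp [symPow, oneTensor, ev_vecPow]
  | succ m ih => rw [symPow, ev_symMul, ih, pow_succ]

theorem ev_projTensor {n : ℕ} (L : Submodule ℝ (E n)) (y : E n) :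
    ev (projTensor L) y = ‖L.starProjection y‖ ^ 2 := by
  change inner ℝ (L.starProjection y) (L.starProjection y) = _
  rw [real_inner_self_eq_norm_sq]

theorem ev_metricTensor {n : ℕ} (y : E n) : ev (metricTensor n) y = ‖y‖ ^ 2 := by
  rw [ev, metricTensor_apply, real_inner_self_eq_norm_sq]

theorem ev_rotTensor {n p : ℕ} (ϑ : E n ≃ₗᵢ[ℝ] E n) (T : Tensor n p) (y : E n) :
    ev (rotTensor ϑ T) y = ev T (ϑ.symm y) := rfl

theorem continuous_ev {n p : ℕ} (T : Tensor n p) : Continuous (ev T) :=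
  T.1.cont.comp (continuous_pi fun _ => continuous_id)

/-- A symmetric multilinear functional is a linear combination of its values on diagonals. -/
theorem ev_sum_smul {n p : ℕ} {ι : Type*} [Fintype ι] (T : Tensor n p) (t : ι → ℝ) (x : ι → E n) :
    ev T (∑ i, t i • x i) = ∑ r : Fin p → ι, (∏ j, t (r j)) * T.1 (fun j => x (r j)) := by
  classical
  have h := T.1.toMultilinearMap.map_sum (fun (_ : Fin p) (i : ι) => t i • x i)
  rw [ev]
  refine h.trans (Finset.sum_congr rfl fun r _ => ?_)
  exact T.1.toMultilinearMap.map_smul_univ (fun j => t (r j)) (fun j => x (r j))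

/-- Polarisation: expand `T` on the diagonal at `∑ tᵢ xᵢ` as a polynomial in `t`. The coefficient of
`t₁ ⋯ t_p` collects the index maps `r` that are permutations, and by symmetry each of these
contributes `T(x)`. So a positive multiple of `T(x)` vanishes. -/
theorem ev_injective {n p : ℕ} : Function.Injective (ev : Tensor n p → E n → ℝ) := by
  classical
  suffices h : ∀ T : Tensor n p, ev T = 0 → T = 0 by
    intro S T hST
    rw [← sub_eq_zero]
    exact h _ (by funext y; rw [ev_sub, hST]; simp)
  intro T hT
  apply Subtype.ext
  ext x
  change T.1 x = 0
  let q : MvPolynomial (Fin p) ℝ := ∑ r : Fin p → Fin p,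
    MvPolynomial.C (T.1 fun j => x (r j)) * ∏ j, MvPolynomial.X (r j)
  have hq : q = 0 := by
    apply MvPolynomial.funext
    intro t
    have h := ev_sum_smul T t x
    rw [hT] at h
    rw [map_zero, map_sum]
    refine Eq.trans (Finset.sum_congr rfl fun r _ => ?_) h.symm
    simp [mul_comm]
  have hc := congrArg (MvPolynomial.coeff (∑ j : Fin p, Finsupp.single j 1)) hq
  have hX : ∀ r : Fin p → Fin p, (∏ j, MvPolynomial.X (r j) : MvPolynomial (Fin p) ℝ) =
      MvPolynomial.monomial (∑ j, Finsupp.single (r j) 1) 1 := fun r => by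
    rw [MvPolynomial.monomial_sum_one]; rfl
  simp only [q, MvPolynomial.coeff_zero, MvPolynomial.coeff_sum, hX, MvPolynomial.coeff_C_mul,
    MvPolynomial.coeff_monomial, mul_ite, mul_one, mul_zero] at hc
  have hterm : ∀ r : Fin p → Fin p,
      (if (∑ j, Finsupp.single (r j) 1 : Fin p →₀ ℕ) = ∑ j, Finsupp.single j 1
        then T.1 (fun j => x (r j)) else 0) =
      (if (∑ j, Finsupp.single (r j) 1 : Fin p →₀ ℕ) = ∑ j, Finsupp.single j 1
        then T.1 x else 0) := by
    intro r
    split_ifs with hr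
    · have hs : Function.Surjective r := by
        intro i
        by_contra hi
        push Not at hi
        have := DFunLike.congr_fun hr i
        simp [Finsupp.single_apply, hi] at this
      exact T.2 (Equiv.ofBijective r (Finite.injective_iff_surjective.2 hs |>.bijective_of_finite)) x
    · rfl
  rw [Finset.sum_congr rfl fun r _ => hterm r, ← Finset.sum_filter, Finset.sum_const,
    nsmul_eq_mul] at hc
  refine (mul_eq_zero.1 hc).resolve_left ?_
  have : (id : Fin p → Fin p) ∈ Finset.univ.filter (fun r : Fin p → Fin p =>
      (∑ j, Finsupp.single (r j) 1 : Fin p →₀ ℕ) = ∑ j, Finsupp.single j 1) := by simp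
  exact_mod_cast (Finset.card_pos.2 ⟨_, this⟩).ne'

/-- Symmetric tensors are determined by the values of their polynomials at nonzero vectors. -/
theorem eq_of_ev_eq_of_ne_zero {n p : ℕ} (hn : 0 < n) {S T : Tensor n p}
    (h : ∀ y : E n, y ≠ 0 → ev S y = ev T y) : S = T := by
  have : Nonempty (Fin n) := ⟨⟨0, hn⟩⟩
  apply ev_injective
  exact (continuous_ev S).ext_on (dense_compl_singleton (0 : E n)) (continuous_ev T)
    fun y hy => h y hy

instance finiteDimensional_tensor (n p : ℕ) : FiniteDimensional ℝ (Tensor n p) := by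
  let f : Tensor n p →ₗ[ℝ] MultilinearMap ℝ (fun _ : Fin p => E n) ℝ :=
    { toFun := fun T => T.1.toMultilinearMap
      map_add' := fun _ _ => rfl
      map_smul' := fun _ _ => rfl }
  refine FiniteDimensional.of_injective f fun S T h => Subtype.ext ?_
  exact ContinuousMultilinearMap.toMultilinearMap_injective h

/-- Injective linear maps out of a finite-dimensional space are closed embeddings. Through this,
infinite sums and continuity in the tensor space are tested at each `y` separately. -/
theorem isClosedEmbedding_ev (n p : ℕ) :
    Topology.IsClosedEmbedding (ev : Tensor n p → E n → ℝ) :=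
  LinearMap.isClosedEmbedding_of_injective (f := evLinear n p)
    (LinearMap.ker_eq_bot.2 ev_injective)

theorem hasSum_iff_ev {n p : ℕ} {ι : Type*} (T : ι → Tensor n p) (S : Tensor n p) :
    HasSum T S ↔ ∀ y, HasSum (fun i => ev (T i) y) (ev S y) := by
  rw [← (isClosedEmbedding_ev n p).isInducing.hasSum_iff (g := evLinear n p), Pi.hasSum]
  rfl

theorem continuous_tensor_iff {n p : ℕ} {X : Type*} [TopologicalSpace X] (T : X → Tensor n p) :
    Continuous T ↔ ∀ y, Continuous fun x => ev (T x) y := by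
  rw [(isClosedEmbedding_ev n p).isInducing.continuous_iff, continuous_pi_iff]
  rfl

/-! ### Hausdorff measure on spheres -/

theorem euclideanHausdorffMeasure_eq_zero_iff {X : Type*} [EMetricSpace X] [MeasurableSpace X]
    [BorelSpace X] (d : ℕ) (s : Set X) :
    (μHE[d] : Measure X) s = 0 ↔ (Measure.hausdorffMeasure d : Measure X) s = 0 := by
  rw [Measure.euclideanHausdorffMeasure_def, Measure.smul_apply]
  simp [Measure.addHaarScalarFactor_volume_hausdorffMeasure_ne_zero, ENNReal.smul_def]

theorem euclideanHausdorffMeasure_lt_top_iff {X : Type*} [EMetricSpace X] [MeasurableSpace X]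
    [BorelSpace X] (d : ℕ) (s : Set X) :
    (μHE[d] : Measure X) s < ⊤ ↔ (Measure.hausdorffMeasure d : Measure X) s < ⊤ := by
  rw [Measure.euclideanHausdorffMeasure_def, Measure.smul_apply, ENNReal.smul_def, smul_eq_mul]
  constructor
  · intro h
    by_contra h'
    rw [not_lt_top_iff.1 h', ENNReal.mul_top (by
      simpa using Measure.addHaarScalarFactor_volume_hausdorffMeasure_ne_zero d)] at h
    exact lt_irrefl _ h
  · exact fun h => ENNReal.mul_lt_top ENNReal.coe_lt_top h

theorem norm_normalize_sub_le {V : Type*} [NormedAddCommGroup V] [NormedSpace ℝ V] {x y : V}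
    (hx : 1 ≤ ‖x‖) (hy : 1 ≤ ‖y‖) : ‖‖x‖⁻¹ • x - ‖y‖⁻¹ • y‖ ≤ 2 * ‖x - y‖ := by
  have hx0 : 0 < ‖x‖ := by linarith
  have hy0 : 0 < ‖y‖ := by linarith
  have h1 : ‖x‖⁻¹ • x - ‖y‖⁻¹ • y = ‖x‖⁻¹ • ((x - y) + ((‖y‖ - ‖x‖) * ‖y‖⁻¹) • y) := by
    rw [smul_add, smul_sub, smul_smul, sub_mul, mul_inv_cancel₀ hy0.ne', mul_sub, sub_smul,
      ← mul_assoc, inv_mul_cancel₀ hx0.ne', one_mul, mul_one]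
    abel
  rw [h1, norm_smul, norm_inv, norm_norm]
  have h2 : ‖(x - y) + ((‖y‖ - ‖x‖) * ‖y‖⁻¹) • y‖ ≤ 2 * ‖x - y‖ := by
    refine (norm_add_le _ _).trans ?_
    rw [norm_smul, norm_mul, norm_inv, norm_norm, mul_assoc, inv_mul_cancel₀ hy0.ne', mul_one,
      Real.norm_eq_abs, abs_sub_comm]
    linarith [abs_norm_sub_norm_le x y]
  calc ‖x‖⁻¹ * ‖(x - y) + ((‖y‖ - ‖x‖) * ‖y‖⁻¹) • y‖ ≤ 1 * (2 * ‖x - y‖) :=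
        mul_le_mul (inv_le_one_of_one_le₀ hx) h2 (norm_nonneg _) zero_le_one
    _ = _ := one_mul _

/-- Radial projection is Lipschitz outside the unit ball, so the sphere is covered by finitely many
Lipschitz images of the facets of a cube. -/
theorem hausdorff_sphere_lt_top (m : ℕ) :
    (μHE[m] : Measure (E (m + 1))) (Metric.sphere 0 1) < ⊤ := by
  let g : Fin (m + 1) → ℝ → (Fin m → ℝ) → E (m + 1) :=
    fun i s x => WithLp.toLp 2 (Fin.insertNth (α := fun _ => ℝ) i s x)
  let f : Fin (m + 1) → ℝ → (Fin m → ℝ) → E (m + 1) := fun i s x => ‖g i s x‖⁻¹ • g i s x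
  have hg1 : ∀ i s x, |s| = 1 → 1 ≤ ‖g i s x‖ := by
    intro i s x hs
    have := PiLp.norm_apply_le (g i s x) i
    simpa [g, hs] using this
  have hg2 : ∀ i s, ∃ C, LipschitzWith C (g i s) := by
    intro i s
    have h1 : LipschitzWith 1 (fun x : Fin m → ℝ => Fin.insertNth (α := fun _ => ℝ) i s x) := by
      refine LipschitzWith.of_dist_le_mul fun x y => ?_
      rw [NNReal.coe_one, one_mul]
      refine (dist_pi_le_iff dist_nonneg).2 fun j => ?_
      refine Fin.succAboveCases i ?_ (fun j => ?_) j
      · simp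
      · simpa using dist_le_pi_dist x y j
    exact ⟨_, (PiLp.lipschitzWith_toLp 2 (fun _ : Fin (m + 1) => ℝ)).comp h1⟩
  have hf : ∀ i s, |s| = 1 → ∃ C, LipschitzWith C (f i s) := by
    intro i s hs
    obtain ⟨C, hC⟩ := hg2 i s
    refine ⟨2 * C, LipschitzWith.of_dist_le_mul fun x y => ?_⟩
    rw [dist_eq_norm]
    refine (norm_normalize_sub_le (hg1 i s x hs) (hg1 i s y hs)).trans ?_
    have := hC.dist_le_mul x y
    rw [dist_eq_norm] at this
    push_cast
    linarith
  have hcov : Metric.sphere (0 : E (m + 1)) 1 ⊆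
      ⋃ i, ⋃ s ∈ ({1, -1} : Finset ℝ), f i s '' Metric.closedBall 0 1 := by
    intro u hu
    obtain ⟨i, -, hi⟩ := Finset.exists_max_image Finset.univ (fun i => |u i|)
      Finset.univ_nonempty
    have hui : 0 < |u i| := by
      by_contra h
      have : u = 0 := by
        ext j
        have := hi j (Finset.mem_univ j)
        have h0 := abs_nonneg (u j)
        exact abs_eq_zero.1 (by linarith)
      simp [this] at hu
    have hsum : |u i| • g i (SignType.sign (u i) : ℝ) (fun j => u (i.succAbove j) / |u i|) = u := by
      ext j
      refine Fin.succAboveCases i ?_ (fun j => ?_) j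
      · simp [g]
      · simp [g, mul_div_cancel₀ _ hui.ne']
    simp only [Set.mem_iUnion]
    -- Since `i` is a coordinate of largest modulus, dividing by `|u i|` moves `u` onto the facet
    -- where coordinate `i` equals its sign.
    refine ⟨i, (SignType.sign (u i) : ℝ), ?_, fun j => u (i.succAbove j) / |u i|, ?_, ?_⟩
    · rcases lt_trichotomy (u i) 0 with h | h | h
      · simp [h]
      · simp [h] at hui
      · simp [h]
    · rw [mem_closedBall_zero_iff, pi_norm_le_iff_of_nonneg zero_le_one]
      intro j
      rw [norm_div, Real.norm_eq_abs, Real.norm_eq_abs, abs_abs, div_le_one hui]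
      exact hi _ (Finset.mem_univ _)
    · have hn : ‖u‖ = 1 := by simpa using hu
      have h2 := congrArg norm hsum
      rw [norm_smul, Real.norm_eq_abs, abs_abs, hn] at h2
      change ‖g i _ _‖⁻¹ • g i _ _ = u
      rw [← eq_inv_of_mul_eq_one_left h2, hsum]
  rw [euclideanHausdorffMeasure_lt_top_iff]
  refine (measure_mono hcov).trans_lt ?_
  refine (measure_iUnion_le _).trans_lt ?_
  rw [tsum_fintype]
  refine ENNReal.sum_lt_top.2 fun i _ => ?_
  refine (measure_biUnion_finset_le _ _).trans_lt ?_
  refine ENNReal.sum_lt_top.2 fun s hs => ?_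
  have hs1 : |s| = 1 := by
    simp only [Finset.mem_insert, Finset.mem_singleton] at hs
    rcases hs with rfl | rfl <;> simp
  obtain ⟨C, hC⟩ := hf i s hs1
  refine (hC.hausdorffMeasure_image_le (Nat.cast_nonneg m) _).trans_lt ?_
  have hv := hausdorffMeasure_pi_real (ι := Fin m)
  rw [Fintype.card_fin] at hv
  rw [hv]
  refine ENNReal.mul_lt_top (ENNReal.rpow_lt_top_of_nonneg (Nat.cast_nonneg m)
    ENNReal.coe_ne_top) ?_
  exact (isCompact_closedBall _ _).measure_lt_top

/-- The orthogonal projection to the hyperplane `u₀ᗮ` is 1-Lipschitz and the image of the cap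
contains a ball, so a null cap would give a null ball. -/
theorem hausdorff_sphere_inter_ball_pos (m : ℕ) (u₀ : E (m + 1)) (hu₀ : ‖u₀‖ = 1) {ε : ℝ}
    (hε : 0 < ε) :
    0 < (μHE[m] : Measure (E (m + 1))) (Metric.sphere 0 1 ∩ Metric.ball u₀ ε) := by
  rw [pos_iff_ne_zero, ne_eq, euclideanHausdorffMeasure_eq_zero_iff]
  intro h0
  let K : Submodule ℝ (E (m + 1)) := (ℝ ∙ u₀)ᗮ
  have hu0 : u₀ ≠ 0 := by intro h; simp [h] at hu₀
  have : Fact (Module.finrank ℝ (E (m + 1)) = m + 1) := ⟨by simp⟩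
  have hK : Module.finrank ℝ K = m := Submodule.finrank_orthogonal_span_singleton hu0
  have hlip : LipschitzWith 1 (K.orthogonalProjectionOnto : E (m + 1) → K) :=
    LipschitzWith.of_dist_le_mul fun x y => by
      rw [dist_eq_norm, dist_eq_norm, ← map_sub]
      simpa using K.norm_orthogonalProjectionOnto_apply_le (x - y)
  have h1 := hlip.hausdorffMeasure_image_le (Nat.cast_nonneg m)
    (Metric.sphere 0 1 ∩ Metric.ball u₀ ε)
  rw [h0, mul_zero, nonpos_iff_eq_zero, ← euclideanHausdorffMeasure_eq_zero_iff] at h1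
  -- Radius `1` makes the lift `c u₀ + w` with `c = √(1 - ‖w‖²)` possible. Radius `ε / 2` keeps it
  -- near `u₀`, because `(1 - c)² ≤ 1 - c² = ‖w‖²`.
  have hsub : Metric.ball (0 : K) (min 1 (ε / 2)) ⊆
      K.orthogonalProjectionOnto '' (Metric.sphere 0 1 ∩ Metric.ball u₀ ε) := by
    intro w hw
    rw [mem_ball_zero_iff, lt_min_iff] at hw
    have hw1 : 0 ≤ 1 - ‖w‖ ^ 2 := by nlinarith [norm_nonneg w]
    set c := Real.sqrt (1 - ‖w‖ ^ 2) with hc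
    have hc2 : c ^ 2 = 1 - ‖w‖ ^ 2 := Real.sq_sqrt hw1
    have hc0 : 0 ≤ c := Real.sqrt_nonneg _
    have hc1 : c ≤ 1 := by nlinarith [norm_nonneg w]
    have horth : inner ℝ u₀ (w : E (m + 1)) = 0 :=
      (Submodule.mem_orthogonal_singleton_iff_inner_right.1 w.2)
    have hwn : ‖(w : E (m + 1))‖ = ‖w‖ := rfl
    have hnorm : ∀ a : ℝ, ‖a • u₀ + (w : E (m + 1))‖ ^ 2 = a ^ 2 + ‖w‖ ^ 2 := by
      intro a
      rw [norm_add_sq_real, inner_smul_left, horth, norm_smul, hu₀, hwn]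
      simp
    refine ⟨c • u₀ + w, ⟨?_, ?_⟩, ?_⟩
    · rw [mem_sphere_zero_iff_norm]
      have := hnorm c
      rw [hc2] at this
      nlinarith [norm_nonneg (c • u₀ + (w : E (m + 1)))]
    · rw [Metric.mem_ball, dist_eq_norm]
      have h2 : c • u₀ + (w : E (m + 1)) - u₀ = (c - 1) • u₀ + w := by
        rw [sub_smul, one_smul]; abel
      rw [h2]
      have h3 := hnorm (c - 1)
      have h4 : ‖(c - 1) • u₀ + (w : E (m + 1))‖ ^ 2 < ε ^ 2 := by
        rw [h3]
        nlinarith [norm_nonneg w]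
      exact lt_of_pow_lt_pow_left₀ 2 hε.le h4
    · rw [map_add, map_smul]
      have h5 : K.orthogonalProjectionOnto u₀ = 0 := by
        rw [Submodule.orthogonalProjectionOnto_eq_zero_iff]
        exact Submodule.le_orthogonal_orthogonal _ (Submodule.mem_span_singleton_self u₀)
      rw [h5, smul_zero, zero_add, Submodule.orthogonalProjectionOnto_mem_subspace_eq_self]
  have hpos : 0 < (μHE[m] : Measure K) (Metric.ball (0 : K) (min 1 (ε / 2))) := by
    have hh : (μHE[m] : Measure K).IsAddHaarMeasure := by
      have := isAddHaarMeasure_euclideanHausdorffMeasure (E := K)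
      rwa [hK] at this
    exact Metric.measure_ball_pos _ _ (by positivity)
  exact hpos.ne' (measure_mono_null hsub h1)

/-! ### Unit vectors orthogonal to a subspace -/

/-- The unit vectors orthogonal to `L`. -/
def perpSphere {n : ℕ} (L : Submodule ℝ (E n)) : Set (Sph n) := {u | (u : E n) ∈ Lᗮ}

theorem isClosed_perpSphere {n : ℕ} (L : Submodule ℝ (E n)) : IsClosed (perpSphere L) :=
  (Submodule.isClosed_orthogonal L).preimage continuous_subtype_val

theorem measurableSet_perpSphere {n : ℕ} (L : Submodule ℝ (E n)) :
    MeasurableSet (perpSphere L) := (isClosed_perpSphere L).measurableSet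

theorem exists_linearIsometry_range_eq {n k : ℕ} (L : Submodule ℝ (E n))
    (h : Module.finrank ℝ L = k) : ∃ j : E k →ₗᵢ[ℝ] E n, LinearMap.range j.toLinearMap = L := by
  let b := (stdOrthonormalBasis ℝ L).reindex (finCongr h)
  refine ⟨L.subtypeₗᵢ.comp b.repr.symm.toLinearIsometry, ?_⟩
  ext x
  constructor
  · rintro ⟨y, rfl⟩
    exact (b.repr.symm y).2
  · intro hx
    exact ⟨b.repr ⟨x, hx⟩, by simp⟩

theorem finrank_orthogonal_eq {n k : ℕ} (L : Submodule ℝ (E n)) (h : Module.finrank ℝ L = k) :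
    Module.finrank ℝ Lᗮ = n - k := by
  have := L.finrank_add_finrank_orthogonal
  simp only [finrank_euclideanSpace, Fintype.card_fin] at this
  omega

theorem finrank_le_dim {n : ℕ} (L : Submodule ℝ (E n)) : Module.finrank ℝ L ≤ n := by
  simpa using L.finrank_le

theorem hausdorff_sph_coe {n : ℕ} (d : ℕ) (s : Set (Sph n)) :
    (μHE[d] : Measure (E n)) ((↑) '' s) = (μHE[d] : Measure (Sph n)) s :=
  isometry_subtype_coe.euclideanHausdorffMeasure_image s

theorem coe_image_perpSphere_inter {n m : ℕ} (L : Submodule ℝ (E n)) (j : E m →ₗᵢ[ℝ] E n)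
    (hj : LinearMap.range j.toLinearMap = Lᗮ) (s : Set (E n)) :
    (((↑) : Sph n → E n) '' (perpSphere L ∩ (↑) ⁻¹' s)) =
      j '' (Metric.sphere 0 1 ∩ j ⁻¹' s) := by
  ext x
  constructor
  · rintro ⟨u, ⟨hu, hus⟩, rfl⟩
    have hu' : (u : E n) ∈ Lᗮ := hu
    rw [← hj] at hu'
    obtain ⟨y, hy⟩ := hu'
    have hy' : j y = u := hy
    refine ⟨y, ⟨?_, ?_⟩, hy'⟩
    · rw [mem_sphere_zero_iff_norm, ← j.norm_map, hy']
      simp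
    · change j y ∈ s
      rw [hy']; exact hus
  · rintro ⟨y, ⟨hy, hys⟩, rfl⟩
    have : j y ∈ Lᗮ := by rw [← hj]; exact ⟨y, rfl⟩
    exact ⟨⟨j y, by simpa using hy⟩, ⟨this, hys⟩, rfl⟩

theorem hausdorff_perpSphere_lt_top {n k : ℕ} (L : Submodule ℝ (E n))
    (h : Module.finrank ℝ L = k) : (μHE[n - k - 1] : Measure (Sph n)) (perpSphere L) < ⊤ := by
  -- For `n - k = 0` truncated subtraction turns the dimension of the measure into `0` instead of
  -- `-1`; this is harmless because there are no unit normals at all.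
  rcases Nat.eq_zero_or_pos (n - k) with h0 | h0
  · have : perpSphere L = ∅ := by
      ext u
      have hL : Lᗮ = ⊥ := Submodule.finrank_eq_zero.1 ((finrank_orthogonal_eq L h).trans h0)
      simp only [perpSphere, hL, Submodule.mem_bot, Set.mem_ofPred_eq, Set.mem_empty_iff_false,
        iff_false]
      intro hu
      simpa [hu] using u.2
    simp [this]
  · obtain ⟨m, hm⟩ : ∃ m, n - k = m + 1 := ⟨n - k - 1, by omega⟩
    obtain ⟨j, hj⟩ := exists_linearIsometry_range_eq Lᗮ ((finrank_orthogonal_eq L h).trans hm)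
    have hc := coe_image_perpSphere_inter L j hj Set.univ
    simp only [Set.preimage_univ, Set.inter_univ] at hc
    rw [← hausdorff_sph_coe, hc, j.isometry.euclideanHausdorffMeasure_image, hm]
    exact hausdorff_sphere_lt_top m

theorem hausdorff_perpSphere_inter_ball_pos {n k : ℕ} (L : Submodule ℝ (E n))
    (h : Module.finrank ℝ L = k) (u : Sph n) (hu : u ∈ perpSphere L) {ε : ℝ} (hε : 0 < ε) :
    0 < (μHE[n - k - 1] : Measure (Sph n)) (perpSphere L ∩ Metric.ball u ε) := by
  have hpos : 0 < n - k := by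
    rw [← finrank_orthogonal_eq L h]
    have : Nontrivial Lᗮ := ⟨⟨⟨u, hu⟩, 0, fun h0 => by
      have : (u : E n) = 0 := congrArg Subtype.val h0
      simpa [this] using u.2⟩⟩
    exact Module.finrank_pos
  obtain ⟨m, hm⟩ : ∃ m, n - k = m + 1 := ⟨n - k - 1, by omega⟩
  obtain ⟨j, hj⟩ := exists_linearIsometry_range_eq Lᗮ ((finrank_orthogonal_eq L h).trans hm)
  obtain ⟨v, hv⟩ : ∃ v, j v = u := by
    have : (u : E n) ∈ LinearMap.range j.toLinearMap := by rw [hj]; exact hu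
    exact this
  have hc := coe_image_perpSphere_inter L j hj (Metric.ball (u : E n) ε)
  have hb : perpSphere L ∩ Metric.ball u ε = perpSphere L ∩ (↑) ⁻¹' Metric.ball (u : E n) ε := rfl
  rw [hb, ← hausdorff_sph_coe, hc, j.isometry.euclideanHausdorffMeasure_image, hm, ← hv,
    j.isometry.preimage_ball]
  refine hausdorff_sphere_inter_ball_pos m v ?_ hε
  rw [← j.norm_map, hv]
  simp

/-- The unit sphere of `L'ᗮ` has finite measure in its own, strictly smaller dimension, hence
measure zero in the larger one; for `L'` the whole space it is empty. -/
theorem hausdorff_perpSphere_eq_zero {n k : ℕ} {L L' : Submodule ℝ (E n)}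
    (h : Module.finrank ℝ L = k) (hL : L < L') :
    (μHE[n - k - 1] : Measure (Sph n)) (perpSphere L') = 0 := by
  have h1 := Submodule.finrank_lt_finrank_of_lt hL
  have h2 := finrank_le_dim L'
  rcases h2.lt_or_eq with h3 | h3
  · refine (Measure.euclideanHausdorffMeasure_zero_or_top
      (d₁ := n - Module.finrank ℝ L' - 1) (by omega) _).resolve_right ?_
    exact (hausdorff_perpSphere_lt_top L' rfl).ne
  · have : perpSphere L' = ∅ := by
      ext u
      have hL : L'ᗮ = ⊥ := Submodule.finrank_eq_zero.1
        ((finrank_orthogonal_eq L' h3).trans (by omega))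
      simp only [perpSphere, hL, Submodule.mem_bot, Set.mem_ofPred_eq, Set.mem_empty_iff_false,
        iff_false]
      intro hu
      simpa [hu] using u.2
    simp [this]

/-! ### Planes and their measures -/

/-- The `k`-dimensional (nonempty) affine subspaces of `ℝⁿ`. -/
abbrev Plane (n k : ℕ) : Type :=
  {A : AffineSubspace ℝ (E n) // (A : Set (E n)).Nonempty ∧ Module.finrank ℝ A.direction = k}

theorem isClosed_affineSubspace {n : ℕ} (A : AffineSubspace ℝ (E n)) :
    IsClosed (A : Set (E n)) := A.closed_of_finiteDimensional

namespace Plane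

variable {n k : ℕ} (A : Plane n k)

/-- The set of pairs of a point of `A` and a unit vector orthogonal to `A`. -/
def bundle : Set (Sig n) := (A.1 : Set (E n)) ×ˢ perpSphere A.1.direction

/-- `k`-dimensional Hausdorff measure on `A`. -/
noncomputable def pointMeasure : Measure (E n) := (μHE[k] : Measure (E n)).restrict (A.1 : Set (E n))

/-- `(n-k-1)`-dimensional Hausdorff measure on the unit vectors orthogonal to `A`. -/
noncomputable def normalMeasure : Measure (Sph n) :=
  (μHE[n - k - 1] : Measure (Sph n)).restrict (perpSphere A.1.direction)

/-- The product of the Hausdorff measures on `A` and on the unit vectors orthogonal to `A`. -/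
noncomputable def meas : Measure (Sig n) := A.pointMeasure.prod A.normalMeasure

theorem exists_param : ∃ ι : E k →ᵃⁱ[ℝ] E n, Set.range ι = A.1 := by
  obtain ⟨x, hx⟩ := A.2.1
  obtain ⟨j, hj⟩ := exists_linearIsometry_range_eq A.1.direction A.2.2
  refine ⟨(AffineIsometryEquiv.vaddConst ℝ x).toAffineIsometry.comp j.toAffineIsometry, ?_⟩
  ext y
  constructor
  · rintro ⟨z, rfl⟩
    change j z +ᵥ x ∈ A.1
    refine A.1.vadd_mem_of_mem_direction ?_ hx
    rw [← hj]
    exact ⟨z, rfl⟩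
  · intro hy
    have h : y -ᵥ x ∈ LinearMap.range j.toLinearMap := by
      rw [hj]; exact AffineSubspace.vsub_mem_direction hy hx
    obtain ⟨z, hz⟩ := h
    have hz' : j z = y -ᵥ x := hz
    refine ⟨z, ?_⟩
    change j z +ᵥ x = y
    rw [hz', vsub_vadd]

theorem pointMeasure_eq_map (ι : E k →ᵃⁱ[ℝ] E n) (hι : Set.range ι = A.1) :
    A.pointMeasure = (volume : Measure (E k)).map ι := by
  rw [pointMeasure, ← hι, ← ι.isometry.map_euclideanHausdorffMeasure,
    EuclideanSpace.euclideanHausdorffMeasure_eq_volume]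

theorem measurableEmbedding_param (ι : E k →ᵃⁱ[ℝ] E n) : MeasurableEmbedding ι :=
  ι.isometry.isClosedEmbedding.measurableEmbedding

theorem pointMeasure_apply (ι : E k →ᵃⁱ[ℝ] E n) (hι : Set.range ι = A.1) (s : Set (E n)) :
    A.pointMeasure s = volume (ι ⁻¹' s) := by
  rw [A.pointMeasure_eq_map ι hι, (measurableEmbedding_param ι).map_apply]

instance : SigmaFinite A.pointMeasure := by
  obtain ⟨ι, hι⟩ := A.exists_param
  rw [A.pointMeasure_eq_map ι hι]
  exact (measurableEmbedding_param ι).sigmaFinite_map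

instance : IsFiniteMeasure A.normalMeasure :=
  ⟨by rw [normalMeasure, Measure.restrict_apply_univ]
      exact hausdorff_perpSphere_lt_top _ A.2.2⟩

instance : SigmaFinite A.meas := inferInstanceAs (SigmaFinite (Measure.prod _ _))

theorem pointMeasure_lt_top {s : Set (E n)} (hs : Bornology.IsBounded s) :
    A.pointMeasure s < ⊤ := by
  obtain ⟨ι, hι⟩ := A.exists_param
  rw [A.pointMeasure_apply ι hι]
  have : Bornology.IsBounded (ι ⁻¹' s) := ι.isometry.antilipschitz.isBounded_preimage hs
  exact this.measure_lt_top

theorem pointMeasure_ball_pos {x : E n} (hx : x ∈ A.1) {ε : ℝ} (hε : 0 < ε) :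
    0 < A.pointMeasure (Metric.ball x ε) := by
  obtain ⟨ι, hι⟩ := A.exists_param
  obtain ⟨z, rfl⟩ : x ∈ Set.range ι := by rw [hι]; exact hx
  rw [A.pointMeasure_apply ι hι, ι.isometry.preimage_ball]
  exact Metric.measure_ball_pos _ _ hε

theorem pointMeasure_affineSubspace {B : AffineSubspace ℝ (E n)} (h : ¬ A.1 ≤ B) :
    A.pointMeasure B = 0 := by
  obtain ⟨ι, hι⟩ := A.exists_param
  rw [A.pointMeasure_apply ι hι]
  refine Measure.addHaar_affineSubspace volume (B.comap ι.toAffineMap) fun h' => h ?_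
  intro x hx
  obtain ⟨z, rfl⟩ : x ∈ Set.range ι := by rw [hι]; exact hx
  have : z ∈ B.comap ι.toAffineMap := by rw [h']; trivial
  exact this

theorem normalMeasure_ball_pos {u : Sph n} (hu : u ∈ perpSphere A.1.direction) {ε : ℝ}
    (hε : 0 < ε) : 0 < A.normalMeasure (Metric.ball u ε) := by
  rw [normalMeasure, Measure.restrict_apply Metric.isOpen_ball.measurableSet, Set.inter_comm]
  exact hausdorff_perpSphere_inter_ball_pos _ A.2.2 u hu hε

theorem measurableSet_bundle : MeasurableSet A.bundle :=
  ((isClosed_affineSubspace A.1).prod (isClosed_perpSphere _)).measurableSet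

theorem meas_bundle_compl : A.meas A.bundleᶜ = 0 := by
  have h : A.meas = A.meas.restrict A.bundle := by
    rw [meas, bundle, ← Measure.prod_restrict, pointMeasure, normalMeasure,
      Measure.restrict_restrict_of_subset le_rfl, Measure.restrict_restrict_of_subset le_rfl]
  rw [h, Measure.restrict_apply A.measurableSet_bundle.compl, Set.compl_inter_self, measure_empty]

/-- One of the two factors is null. If `A` is not contained in `B`, then `B` cuts out a proper
affine part of `A`; if `A` is strictly smaller than `B`, the normals of `B` form a lower-dimensional
sphere. This is what decouples the faces of a polytope. -/
theorem meas_eq_zero_of_ne {B : AffineSubspace ℝ (E n)} (h : A.1 ≠ B) :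
    A.meas ((B : Set (E n)) ×ˢ perpSphere B.direction) = 0 := by
  rw [meas, Measure.prod_prod, mul_eq_zero]
  by_cases hAB : A.1 ≤ B
  · right
    rw [normalMeasure, Measure.restrict_apply (measurableSet_perpSphere _)]
    refine measure_mono_null Set.inter_subset_left (hausdorff_perpSphere_eq_zero A.2.2 ?_)
    exact AffineSubspace.direction_lt_of_nonempty (lt_of_le_of_ne hAB h) A.2.1
  · left
    exact A.pointMeasure_affineSubspace hAB

end Plane

/-! ### Rotations and reflections -/

/-- The determinant of a linear isometry. -/
noncomputable def isoDet {n : ℕ} (ϑ : E n ≃ₗᵢ[ℝ] E n) : ℝ :=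
  LinearMap.det (ϑ.toLinearEquiv : E n →ₗ[ℝ] E n)

theorem isoDet_trans {n : ℕ} (ϑ ρ : E n ≃ₗᵢ[ℝ] E n) :
    isoDet (ϑ.trans ρ) = isoDet ρ * isoDet ϑ := by
  rw [isoDet, isoDet, isoDet, ← LinearMap.det_comp]
  rfl

theorem isoDet_eq_one_or {n : ℕ} (ϑ : E n ≃ₗᵢ[ℝ] E n) : isoDet ϑ = 1 ∨ isoDet ϑ = -1 := by
  have h := ϑ.toLinearIsometry.normDet_eq_one
  rw [LinearMap.normDet_eq_abs_det] at h
  exact eq_or_eq_neg_of_abs_eq h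

/-- The reflection in the hyperplane orthogonal to `z`. -/
noncomputable def refl {n : ℕ} (z : E n) : E n ≃ₗᵢ[ℝ] E n := (ℝ ∙ z)ᗮ.reflection

theorem isoDet_refl {n : ℕ} {z : E n} (hz : z ≠ 0) : isoDet (refl z) = -1 := by
  have h := (ℝ ∙ z)ᗮ.det_reflection
  rw [Submodule.orthogonal_orthogonal, finrank_span_singleton hz, pow_one] at h
  exact h

theorem refl_apply_of_inner_eq_zero {n : ℕ} {z x : E n} (h : inner ℝ z x = 0) :
    refl z x = x :=
  Submodule.reflection_mem_subspace_eq_self (Submodule.mem_orthogonal_singleton_iff_inner_right.2 h)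

theorem refl_sub {n : ℕ} {x y : E n} (h : ‖x‖ = ‖y‖) : refl (x - y) x = y :=
  Submodule.reflection_sub h

theorem refl_self {n : ℕ} (z : E n) : refl z z = -z :=
  Submodule.reflection_orthogonalComplement_singleton_eq_neg z

theorem refl_apply_sub_mem {n : ℕ} (z x : E n) : refl z x - x ∈ ℝ ∙ z := by
  rw [refl, Submodule.reflection_orthogonal_apply, Submodule.reflection_apply]
  have h := (ℝ ∙ z).starProjection_apply_mem x
  have : -((2 : ℕ) • (ℝ ∙ z).starProjection x - x) - x = -((2 : ℕ) • (ℝ ∙ z).starProjection x) := by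
    abel
  rw [this]
  exact neg_mem (nsmul_mem h 2)

theorem map_eq_of_forall_mem {n : ℕ} {L L' : Submodule ℝ (E n)} (ϑ : E n ≃ₗᵢ[ℝ] E n)
    (hd : Module.finrank ℝ L = Module.finrank ℝ L') (h : ∀ x ∈ L, ϑ x ∈ L') :
    L.map (ϑ.toLinearEquiv : E n →ₗ[ℝ] E n) = L' := by
  refine Submodule.eq_of_le_of_finrank_eq ?_ ?_
  · rintro _ ⟨x, hx, rfl⟩
    exact h x hx
  · rw [← hd]
    exact LinearEquiv.finrank_map_eq ϑ.toLinearEquiv L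

theorem map_refl_of_mem {n : ℕ} {L : Submodule ℝ (E n)} {z : E n} (hz : z ∈ L ∨ z ∈ Lᗮ) :
    L.map ((refl z).toLinearEquiv : E n →ₗ[ℝ] E n) = L := by
  refine map_eq_of_forall_mem _ rfl fun x hx => ?_
  rcases hz with hz | hz
  · have h1 : refl z x = (refl z x - x) + x := by abel
    rw [h1]
    exact L.add_mem ((Submodule.span_singleton_le_iff_mem _ _).2 hz (refl_apply_sub_mem z x)) hx
  · rw [refl_apply_of_inner_eq_zero]
    · exact hx
    · rw [real_inner_comm]; exact hz x hx

theorem map_trans_eq {n : ℕ} (L : Submodule ℝ (E n)) (ϑ ρ : E n ≃ₗᵢ[ℝ] E n) :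
    L.map ((ϑ.trans ρ).toLinearEquiv : E n →ₗ[ℝ] E n) =
      (L.map (ϑ.toLinearEquiv : E n →ₗ[ℝ] E n)).map (ρ.toLinearEquiv : E n →ₗ[ℝ] E n) := by
  rw [← Submodule.map_comp]
  rfl

theorem mem_orthogonal_map_iff {n : ℕ} (L : Submodule ℝ (E n)) (ϑ : E n ≃ₗᵢ[ℝ] E n) (x : E n) :
    ϑ x ∈ (L.map (ϑ.toLinearEquiv : E n →ₗ[ℝ] E n))ᗮ ↔ x ∈ Lᗮ := by
  constructor
  · intro h y hy
    rw [← ϑ.inner_map_map]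
    exact h (ϑ y) ⟨y, hy, rfl⟩
  · rintro h _ ⟨y, hy, rfl⟩
    change inner ℝ (ϑ y) (ϑ x) = 0
    rw [ϑ.inner_map_map]
    exact h y hy

/-- If `u` is orthogonal to `L` and `n ≥ 2`, there is a vector `z ≠ 0` orthogonal to `u` whose
reflection preserves `L`. -/
theorem exists_refl_preserving {n : ℕ} (hn : 2 ≤ n) (L : Submodule ℝ (E n)) (u : E n)
    (hu : u ∈ Lᗮ) : ∃ z : E n, z ≠ 0 ∧ inner ℝ z u = 0 ∧ (z ∈ L ∨ z ∈ Lᗮ) := by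
  by_cases hL : L = ⊥
  · have h1 : (ℝ ∙ u)ᗮ ≠ ⊥ := by
      intro h
      have h2 := (ℝ ∙ u).finrank_add_finrank_orthogonal
      rw [h] at h2
      have h3 : Module.finrank ℝ (ℝ ∙ u) ≤ 1 := (finrank_span_le_card _).trans (by simp)
      simp at h2
      omega
    obtain ⟨z, hz, hz0⟩ := Submodule.exists_mem_ne_zero_of_ne_bot h1
    refine ⟨z, hz0, ?_, Or.inr (by simp [hL])⟩
    rw [real_inner_comm]
    exact Submodule.mem_orthogonal_singleton_iff_inner_right.1 hz
  · obtain ⟨z, hz, hz0⟩ := Submodule.exists_mem_ne_zero_of_ne_bot hL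
    exact ⟨z, hz0, hu z hz, Or.inl hz⟩

theorem exists_isometry_map_eq {n : ℕ} {L L' : Submodule ℝ (E n)}
    (hd : Module.finrank ℝ L = Module.finrank ℝ L') :
    ∃ ϑ : E n ≃ₗᵢ[ℝ] E n, L.map (ϑ.toLinearEquiv : E n →ₗ[ℝ] E n) = L' := by
  let b := (stdOrthonormalBasis ℝ L).reindex (finCongr hd)
  let b' := stdOrthonormalBasis ℝ L'
  let f : L →ₗᵢ[ℝ] E n := L'.subtypeₗᵢ.comp (b.repr.trans b'.repr.symm).toLinearIsometry
  refine ⟨f.extend.toLinearIsometryEquiv rfl, map_eq_of_forall_mem _ hd fun x hx => ?_⟩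
  have h : f.extend x = f ⟨x, hx⟩ := f.extend_apply ⟨x, hx⟩
  rw [LinearIsometry.coe_toLinearIsometryEquiv, h]
  exact (b'.repr.symm (b.repr ⟨x, hx⟩)).2

/-- An isometry carrying `L` to `L'` is corrected twice: by a reflection moving the normal vector
into place, and, if the determinant is `-1`, by a reflection that fixes `u'` and preserves `L'`. The
latter exists because `n ≥ 2`. -/
theorem exists_rotation {n : ℕ} (hn : 2 ≤ n) {L L' : Submodule ℝ (E n)}
    (hd : Module.finrank ℝ L = Module.finrank ℝ L') {u u' : E n} (hu : u ∈ Lᗮ) (hu' : u' ∈ L'ᗮ)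
    (hn1 : ‖u‖ = ‖u'‖) :
    ∃ ϑ : E n ≃ₗᵢ[ℝ] E n, isoDet ϑ = 1 ∧ L.map (ϑ.toLinearEquiv : E n →ₗ[ℝ] E n) = L' ∧
      ϑ u = u' := by
  obtain ⟨ϑ₁, h1⟩ := exists_isometry_map_eq hd
  have hmem : ϑ₁ u - u' ∈ L'ᗮ := by
    refine sub_mem ?_ hu'
    rw [← h1, mem_orthogonal_map_iff]
    exact hu
  obtain ⟨ϑ₂, h2, h2u⟩ : ∃ ϑ : E n ≃ₗᵢ[ℝ] E n, L.map (ϑ.toLinearEquiv : E n →ₗ[ℝ] E n) = L' ∧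
      ϑ u = u' := by
    -- Both vectors are orthogonal to `L'` and have the same length, so the reflection in their
    -- difference maps one to the other and fixes `L'` pointwise.
    refine ⟨ϑ₁.trans (refl (ϑ₁ u - u')), ?_, ?_⟩
    · rw [map_trans_eq, h1, map_refl_of_mem (Or.inr hmem)]
    · change refl (ϑ₁ u - u') (ϑ₁ u) = u'
      exact refl_sub ((ϑ₁.norm_map u).trans hn1)
  rcases isoDet_eq_one_or ϑ₂ with h | h
  · exact ⟨ϑ₂, h, h2, h2u⟩
  · obtain ⟨z, hz0, hzu, hz⟩ := exists_refl_preserving hn L' u' hu'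
    refine ⟨ϑ₂.trans (refl z), ?_, ?_, ?_⟩
    · rw [isoDet_trans, isoDet_refl hz0, h]; norm_num
    · rw [map_trans_eq, h2, map_refl_of_mem hz]
    · change refl z (ϑ₂ u) = u'
      rw [h2u, refl_apply_of_inner_eq_zero hzu]

/-! ### The action of affine isometries -/

/-- The action of a linear isometry on the unit sphere. -/
noncomputable def sphMap {n : ℕ} (ϑ : E n ≃ₗᵢ[ℝ] E n) : Sph n ≃ₜ Sph n :=
  ϑ.toHomeomorph.subtype (fun x => by simp)

theorem isometry_sphMap {n : ℕ} (ϑ : E n ≃ₗᵢ[ℝ] E n) : Isometry (sphMap ϑ) :=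
  Isometry.of_dist_eq fun u v => ϑ.dist_map u v

/-- The map `(x, u) ↦ (gx, ϑu)`, where `ϑ` is the linear part of `g`. -/
noncomputable def sigMap {n : ℕ} (g : E n ≃ᵃⁱ[ℝ] E n) : Sig n ≃ₜ Sig n :=
  g.toHomeomorph.prodCongr (sphMap g.linearIsometryEquiv)

/-- The image of a polytope under an affine isometry. -/
noncomputable def Polytope.map {n : ℕ} (g : E n ≃ᵃⁱ[ℝ] E n) (P : Polytope n) : Polytope n :=
  ⟨g '' P.1, P.2.image (g.toAffineEquiv : E n →ᵃ[ℝ] E n)⟩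

/-- The image of a Borel set under an affine isometry. -/
noncomputable def BorelSig.map {n : ℕ} (g : E n ≃ᵃⁱ[ℝ] E n) (η : BorelSig n) : BorelSig n :=
  ⟨sigMap g '' η.1, (sigMap g).toMeasurableEquiv.measurableSet_image.2 η.2⟩

/-- Translation by `t` as an affine isometry. -/
noncomputable def shift {n : ℕ} (t : E n) : E n ≃ᵃⁱ[ℝ] E n := AffineIsometryEquiv.constVAdd ℝ (E n) t

theorem shift_apply {n : ℕ} (t x : E n) : shift t x = t + x := rfl

theorem sigMap_shift {n : ℕ} (t : E n) : ⇑(sigMap (shift t)) = translateSig t := by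
  funext z
  refine Prod.ext ?_ ?_
  · exact add_comm t z.1
  · rfl

theorem Polytope.translate_eq_map {n : ℕ} (P : Polytope n) (t : E n) :
    P.translate t = P.map (shift t) := by
  apply Subtype.ext
  change (fun x => x + t) '' P.1 = shift t '' P.1
  congr 1
  funext x
  exact add_comm x t

theorem BorelSig.translate_eq_map {n : ℕ} (η : BorelSig n) (t : E n) :
    η.translate t = η.map (shift t) := by
  apply Subtype.ext
  change translateSig t '' η.1 = sigMap (shift t) '' η.1
  rw [sigMap_shift]

theorem Polytope.rotate_eq_map {n : ℕ} (P : Polytope n) (ϑ : E n ≃ₗᵢ[ℝ] E n) :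
    P.rotate ϑ = P.map ϑ.toAffineIsometryEquiv := rfl

theorem BorelSig.rotate_eq_map {n : ℕ} (η : BorelSig n) (ϑ : E n ≃ₗᵢ[ℝ] E n) :
    η.rotate ϑ = η.map ϑ.toAffineIsometryEquiv := rfl

theorem affineIsometry_apply_eq {n : ℕ} (g : E n ≃ᵃⁱ[ℝ] E n) (x : E n) :
    g x = g.linearIsometryEquiv x + g 0 := by
  have := g.map_vadd 0 x
  simpa using this

theorem Polytope.map_eq_translate_rotate {n : ℕ} (P : Polytope n) (g : E n ≃ᵃⁱ[ℝ] E n) :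
    P.map g = (P.rotate g.linearIsometryEquiv).translate (g 0) := by
  apply Subtype.ext
  change g '' P.1 = (fun x => x + g 0) '' (g.linearIsometryEquiv '' P.1)
  rw [Set.image_image]
  exact Set.image_congr fun x _ => affineIsometry_apply_eq g x

theorem BorelSig.map_eq_translate_rotate {n : ℕ} (η : BorelSig n) (g : E n ≃ᵃⁱ[ℝ] E n) :
    η.map g = (η.rotate g.linearIsometryEquiv).translate (g 0) := by
  apply Subtype.ext
  change sigMap g '' η.1 = translateSig (g 0) '' (rotateSig g.linearIsometryEquiv '' η.1)
  rw [Set.image_image]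
  refine Set.image_congr fun z _ => Prod.ext (affineIsometry_apply_eq g z.1) rfl

theorem frontier_image_homeomorph {n : ℕ} (g : E n ≃ᵃⁱ[ℝ] E n) (s : Set (E n)) :
    frontier (g '' s) = g '' frontier s := (g.toHomeomorph.image_frontier s).symm

theorem inner_map_le_iff {n : ℕ} (g : E n ≃ᵃⁱ[ℝ] E n) (x y u : E n) :
    inner ℝ (g y) (g.linearIsometryEquiv u) ≤ inner ℝ (g x) (g.linearIsometryEquiv u) ↔
      inner ℝ y u ≤ inner ℝ x u := by
  rw [affineIsometry_apply_eq g x, affineIsometry_apply_eq g y, inner_add_left, inner_add_left,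
    LinearIsometryEquiv.inner_map_map, LinearIsometryEquiv.inner_map_map, add_le_add_iff_right]

theorem nor_map {n : ℕ} (P : Polytope n) (g : E n ≃ᵃⁱ[ℝ] E n) :
    Nor (P.map g) = sigMap g '' Nor P := by
  ext z
  obtain ⟨z, rfl⟩ := (sigMap g).surjective z
  rw [(sigMap g).injective.mem_set_image]
  have h1 : (sigMap g z).1 ∈ frontier (P.map g).1 ↔ z.1 ∈ frontier P.1 := by
    change g z.1 ∈ frontier (g '' P.1) ↔ _
    rw [frontier_image_homeomorph, g.injective.mem_set_image]
  have h2 : (∀ y ∈ (P.map g).1, inner ℝ y ((sigMap g z).2 : E n) ≤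
      inner ℝ (sigMap g z).1 ((sigMap g z).2 : E n)) ↔
      ∀ y ∈ P.1, inner ℝ y (z.2 : E n) ≤ inner ℝ z.1 (z.2 : E n) := by
    constructor
    · intro h y hy
      exact (inner_map_le_iff g z.1 y z.2).1 (h (g y) ⟨y, hy, rfl⟩)
    · rintro h _ ⟨y, hy, rfl⟩
      exact (inner_map_le_iff g z.1 y z.2).2 (h y hy)
  exact and_congr h1 h2

namespace Plane

variable {n k : ℕ} (A : Plane n k)

theorem direction_map_eq (B : AffineSubspace ℝ (E n)) (g : E n ≃ᵃⁱ[ℝ] E n) :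
    (B.map (g.toAffineEquiv : E n →ᵃ[ℝ] E n)).direction =
      B.direction.map (g.linearIsometryEquiv.toLinearEquiv : E n →ₗ[ℝ] E n) := by
  rw [AffineSubspace.map_direction]
  rfl

/-- The image of a plane under an affine isometry. -/
noncomputable def map (g : E n ≃ᵃⁱ[ℝ] E n) : Plane n k :=
  ⟨A.1.map (g.toAffineEquiv : E n →ᵃ[ℝ] E n), A.2.1.image g, by
    rw [direction_map_eq]
    exact (LinearEquiv.finrank_map_eq _ _).trans A.2.2⟩

theorem map_coe (g : E n ≃ᵃⁱ[ℝ] E n) : ((A.map g).1 : Set (E n)) = g '' A.1 := rfl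

theorem map_direction (g : E n ≃ᵃⁱ[ℝ] E n) : (A.map g).1.direction =
    A.1.direction.map (g.linearIsometryEquiv.toLinearEquiv : E n →ₗ[ℝ] E n) :=
  direction_map_eq A.1 g

theorem map_injective (g : E n ≃ᵃⁱ[ℝ] E n) : Function.Injective (fun A : Plane n k => A.map g) := by
  intro A B h
  apply Subtype.ext
  apply SetLike.coe_injective
  exact g.injective.image_injective (congrArg (fun C : Plane n k => (C.1 : Set (E n))) h)

theorem map_surjective (g : E n ≃ᵃⁱ[ℝ] E n) :
    Function.Surjective (fun A : Plane n k => A.map g) := by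
  intro A
  refine ⟨A.map g.symm, ?_⟩
  apply Subtype.ext
  apply SetLike.coe_injective
  change g '' (g.symm '' _) = _
  rw [Set.image_image]
  simp

theorem sphMap_image_perpSphere (ϑ : E n ≃ₗᵢ[ℝ] E n) (L : Submodule ℝ (E n)) :
    sphMap ϑ '' perpSphere L = perpSphere (L.map (ϑ.toLinearEquiv : E n →ₗ[ℝ] E n)) := by
  ext u
  obtain ⟨u, rfl⟩ := (sphMap ϑ).surjective u
  rw [(sphMap ϑ).injective.mem_set_image]
  exact (mem_orthogonal_map_iff L ϑ u).symm

theorem bundle_map (g : E n ≃ᵃⁱ[ℝ] E n) : (A.map g).bundle = sigMap g '' A.bundle := by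
  rw [bundle, bundle, map_coe, map_direction, ← sphMap_image_perpSphere, Set.prod_image_image_eq]
  rfl

theorem map_restrict_homeomorph {X : Type*} [MetricSpace X] [MeasurableSpace X] [BorelSpace X]
    (e : X ≃ₜ X) (he : Isometry e) (d : ℕ) (s : Set X) :
    (μHE[d] : Measure X).restrict (e '' s) = ((μHE[d] : Measure X).restrict s).map e := by
  have h1 := he.map_euclideanHausdorffMeasure (d := d)
  rw [e.surjective.range_eq, Measure.restrict_univ] at h1
  have h2 := e.measurableEmbedding.restrict_map (μHE[d] : Measure X) (e '' s)
  rwa [h1, Set.preimage_image_eq _ e.injective] at h2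

theorem meas_map (g : E n ≃ᵃⁱ[ℝ] E n) : (A.map g).meas = A.meas.map (sigMap g) := by
  have h1 : (A.map g).pointMeasure = A.pointMeasure.map g :=
    map_restrict_homeomorph g.toHomeomorph g.isometry k A.1
  have h2 : (A.map g).normalMeasure = A.normalMeasure.map (sphMap g.linearIsometryEquiv) := by
    rw [normalMeasure, normalMeasure, map_direction, ← sphMap_image_perpSphere]
    exact map_restrict_homeomorph _ (isometry_sphMap _) _ _
  have : SFinite (A.pointMeasure.map g) := by rw [← h1]; infer_instance
  rw [meas, meas, h1, h2, Measure.map_prod_map _ _ g.continuous.measurable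
    (sphMap g.linearIsometryEquiv).continuous.measurable]
  rfl

/-- Transitivity of the proper rigid motions on triples of plane, point and unit normal. It makes
the masses of small balls and the coefficients in the classification independent of the triple. -/
theorem exists_rigid_motion (hn : 2 ≤ n) (A A' : Plane n k) {z z' : Sig n} (hz : z ∈ A.bundle)
    (hz' : z' ∈ A'.bundle) : ∃ g : E n ≃ᵃⁱ[ℝ] E n, isoDet g.linearIsometryEquiv = 1 ∧
      A.map g = A' ∧ sigMap g z = z' := by
  obtain ⟨ϑ, h1, h2, h3⟩ := exists_rotation hn (A.2.2.trans A'.2.2.symm) hz.2 hz'.2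
    (by simp)
  let g : E n ≃ᵃⁱ[ℝ] E n := ϑ.toAffineIsometryEquiv.trans (shift (z'.1 - ϑ z.1))
  have hg : g.linearIsometryEquiv = ϑ := by
    ext x
    rfl
  have hgx : g z.1 = z'.1 := by
    change z'.1 - ϑ z.1 + ϑ z.1 = z'.1
    abel
  refine ⟨g, by rw [hg, h1], ?_, ?_⟩
  · apply Subtype.ext
    refine AffineSubspace.ext_of_direction_eq ?_ ⟨z'.1, ?_, hz'.1⟩
    · rw [map_direction, hg, h2]
    · exact ⟨z.1, hz.1, hgx⟩
  · refine Prod.ext hgx (Subtype.ext ?_)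
    change g.linearIsometryEquiv (z.2 : E n) = _
    rw [hg, h3]

end Plane

/-! ### Faces of polytopes -/

theorem IsPolytope.isCompact {n : ℕ} {P : Set (E n)} (h : IsPolytope P) : IsCompact P := by
  obtain ⟨s, hs, -, rfl⟩ := h
  exact hs.isCompact_convexHull ℝ

theorem IsPolytope.convex {n : ℕ} {P : Set (E n)} (h : IsPolytope P) : Convex ℝ P := by
  obtain ⟨s, hs, -, rfl⟩ := h
  exact convex_convexHull ℝ s

/-- The points of `P` at which `⟨q, ·⟩` attains its maximum over `P`. -/
def expo {n : ℕ} (P : Set (E n)) (q : E n) : Set (E n) :=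
  {x | x ∈ P ∧ ∀ y ∈ P, inner ℝ q y ≤ inner ℝ q x}

theorem isExposed_expo {n : ℕ} (P : Set (E n)) (q : E n) : IsExposed ℝ P (expo P q) :=
  fun _ => ⟨innerSL ℝ q, rfl⟩

theorem exists_eq_expo {n : ℕ} {P F : Set (E n)} (h : IsExposed ℝ P F) (hF : F.Nonempty) :
    ∃ q, F = expo P q := by
  obtain ⟨l, hl⟩ := h hF
  refine ⟨(InnerProductSpace.toDual ℝ (E n)).symm l, ?_⟩
  rw [hl]
  simp only [expo, InnerProductSpace.toDual_symm_apply]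

theorem IsPolytope.of_isExposed {n : ℕ} {P F : Set (E n)} (hP : IsPolytope P)
    (h : IsExposed ℝ P F) (hF : F.Nonempty) : IsPolytope F := by
  have hc := hP.isCompact
  have hcF := h.isCompact hc
  have hvF := h.convex hP.convex
  obtain ⟨s, hs, -, rfl⟩ := hP
  have hsub : F.extremePoints ℝ ⊆ s :=
    (h.isExtreme.extremePoints_subset_extremePoints).trans extremePoints_convexHull_subset
  have hfin := hs.subset hsub
  have heq := closure_convexHull_extremePoints hcF hvF
  rw [(hfin.isClosed_convexHull ℝ).closure_eq] at heq
  refine ⟨F.extremePoints ℝ, hfin, ?_, heq.symm⟩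
  rw [← heq] at hF
  exact convexHull_nonempty_iff.1 hF

/-- An exposed face of an exposed face of a polytope is exposed. -/
theorem IsPolytope.exists_expo_expo {n : ℕ} {P : Set (E n)} (hP : IsPolytope P) (q r : E n)
    (hne : (expo (expo P q) r).Nonempty) : ∃ q', expo (expo P q) r = expo P q' := by
  obtain ⟨x, hx⟩ := hne
  obtain ⟨s, hs, -, rfl⟩ := hP
  have hsP : s ⊆ convexHull ℝ s := subset_convexHull ℝ s
  -- For generators in the first face the functional `r` decides; for the others the strict
  -- inequality for `q` survives a small perturbation. Since there are finitely many generators, one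
  -- `δ` serves all.
  have hev : ∀ᶠ δ : ℝ in nhdsWithin 0 (Set.Ioi 0), ∀ v ∈ s,
      inner ℝ (q + δ • r) v ≤ inner ℝ (q + δ • r) x := by
    rw [Filter.eventually_all_finite hs]
    intro v hv
    simp only [inner_add_left, inner_smul_left, RCLike.conj_to_real]
    by_cases hvF : v ∈ expo (convexHull ℝ s) q
    · filter_upwards [self_mem_nhdsWithin] with δ hδ
      have h1 := hx.2 v hvF
      have h2 := hx.1.2 v hvF.1
      have hδ' : 0 < δ := hδ
      nlinarith
    · have h1 : inner ℝ q v < inner ℝ q x := by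
        by_contra h
        push Not at h
        exact hvF ⟨hsP hv, fun y hy => (hx.1.2 y hy).trans h⟩
      have hc : ∀ w : E n, Filter.Tendsto (fun δ : ℝ => inner ℝ q w + δ * inner ℝ r w)
          (nhdsWithin 0 (Set.Ioi 0)) (nhds (inner ℝ q w)) := by
        intro w
        have : Continuous fun δ : ℝ => inner ℝ q w + δ * inner ℝ r w := by fun_prop
        have h := this.tendsto 0
        simp only [zero_mul, add_zero] at h
        exact h.mono_left nhdsWithin_le_nhds
      filter_upwards [(hc v).eventually_lt (hc x) h1] with δ hδ using hδ.le
  obtain ⟨δ, hδ, hδ0⟩ := (hev.and self_mem_nhdsWithin).exists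
  have hδ0' : 0 < δ := hδ0
  have hall : ∀ y ∈ convexHull ℝ s, inner ℝ (q + δ • r) y ≤ inner ℝ (q + δ • r) x := by
    intro y hy
    have hcv : Convex ℝ {y : E n | inner ℝ (q + δ • r) y ≤ inner ℝ (q + δ • r) x} :=
      convex_halfSpace_le (innerₛₗ ℝ (q + δ • r)).isLinear _
    exact convexHull_min (fun v hv => hδ v hv) hcv hy
  -- This is the midpoint of `q` and `q + δ r`. Both of these attain their maxima over the polytope
  -- at `x`, so a maximiser for the midpoint is a maximiser for both.
  refine ⟨q + (δ / 2) • r, ?_⟩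
  simp only [inner_add_left, inner_smul_left, RCLike.conj_to_real] at hall
  ext y
  simp only [expo, Set.mem_ofPred_eq, inner_add_left, inner_smul_left, RCLike.conj_to_real] at hx ⊢
  constructor
  · rintro ⟨⟨h1, h2⟩, h3⟩
    refine ⟨h1, fun z hz => ?_⟩
    have h4 := hall z hz
    have h5 := hx.1.2 z hz
    have h6 := h2 x hx.1.1
    have h7 := mul_le_mul_of_nonneg_left (h3 x hx.1) (half_pos hδ0').le
    linarith
  · rintro ⟨h1, h2⟩
    have h3 := h2 x hx.1.1
    have h4 := hall y h1
    have h5 := hx.1.2 y h1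
    have h6 : inner ℝ q y = inner ℝ q x := by linarith
    have h7 : inner ℝ r x ≤ inner ℝ r y := by
      have : 0 ≤ δ / 2 * (inner ℝ r y - inner ℝ r x) := by linarith
      have := nonneg_of_mul_nonneg_right this (by positivity)
      linarith
    exact ⟨⟨h1, fun z hz => h6 ▸ hx.1.2 z hz⟩, fun z hz => (hx.2 z hz).trans h7⟩

/-! ### Relative interiors -/

/-- The relative interior of a convex set. -/
def relInt {n : ℕ} (F : Set (E n)) : Set (E n) :=
  {x | x ∈ affineSpan ℝ F ∧ ∃ ε > 0, Metric.ball x ε ∩ affineSpan ℝ F ⊆ F}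

theorem relInt_subset {n : ℕ} (F : Set (E n)) : relInt F ⊆ F := by
  rintro x ⟨hx, ε, hε, h⟩
  exact h ⟨Metric.mem_ball_self hε, hx⟩

theorem exists_isOpen_relInt {n : ℕ} (F : Set (E n)) :
    ∃ U : Set (E n), IsOpen U ∧ relInt F = (affineSpan ℝ F : Set (E n)) ∩ U := by
  refine ⟨{x | ∃ ε > 0, Metric.ball x ε ∩ affineSpan ℝ F ⊆ F}, ?_, rfl⟩
  rw [Metric.isOpen_iff]
  rintro x ⟨ε, hε, h⟩
  refine ⟨ε / 2, by positivity, fun y hy => ⟨ε / 2, by positivity, fun z hz => h ⟨?_, hz.2⟩⟩⟩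
  rw [Metric.mem_ball] at hy ⊢
  have := Metric.mem_ball.1 hz.1
  have := dist_triangle z y x
  linarith

theorem measurableSet_relInt {n : ℕ} (F : Set (E n)) : MeasurableSet (relInt F) := by
  obtain ⟨U, hU, h⟩ := exists_isOpen_relInt F
  rw [h]
  exact (isClosed_affineSubspace _).measurableSet.inter hU.measurableSet

theorem relInt_eq_image {n k : ℕ} {F : Set (E n)} (ι : E k →ᵃⁱ[ℝ] E n)
    (hι : Set.range ι = affineSpan ℝ F) : relInt F = ι '' interior (ι ⁻¹' F) := by
  ext x
  constructor
  · rintro ⟨hx, ε, hε, h⟩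
    obtain ⟨z, rfl⟩ : x ∈ Set.range ι := by rw [hι]; exact hx
    refine ⟨z, ?_, rfl⟩
    rw [mem_interior_iff_mem_nhds, Metric.mem_nhds_iff]
    refine ⟨ε, hε, fun y hy => h ⟨?_, ?_⟩⟩
    · rw [Metric.mem_ball, ι.dist_map]; exact hy
    · rw [← hι]; exact ⟨y, rfl⟩
  · rintro ⟨z, hz, rfl⟩
    rw [mem_interior_iff_mem_nhds, Metric.mem_nhds_iff] at hz
    obtain ⟨ε, hε, h⟩ := hz
    refine ⟨?_, ε, hε, ?_⟩
    · have : ι z ∈ Set.range ι := ⟨z, rfl⟩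
      rw [hι] at this; exact this
    · rintro y ⟨hy, hy'⟩
      rw [← hι] at hy'
      obtain ⟨w, rfl⟩ := hy'
      rw [Metric.mem_ball, ι.dist_map] at hy
      exact h hy

theorem affineSpan_preimage_eq_top {n k : ℕ} {F : Set (E n)} (ι : E k →ᵃⁱ[ℝ] E n)
    (hι : Set.range ι = affineSpan ℝ F) : affineSpan ℝ (ι ⁻¹' F) = ⊤ := by
  have h1 : ι '' (ι ⁻¹' F) = F := by
    rw [Set.image_preimage_eq_inter_range, hι, Set.inter_eq_left]
    exact subset_affineSpan ℝ F
  have h2 := AffineSubspace.map_span ι.toAffineMap (ι ⁻¹' F)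
  rw [AffineIsometry.coe_toAffineMap, h1] at h2
  rw [eq_top_iff]
  intro z _
  have h3 : ι z ∈ Set.range ι := ⟨z, rfl⟩
  rw [hι, ← h2] at h3
  obtain ⟨w, hw, hwz⟩ := h3
  exact ι.injective hwz ▸ hw

theorem convex_preimage_isometry {n k : ℕ} {F : Set (E n)} (hF : Convex ℝ F)
    (ι : E k →ᵃⁱ[ℝ] E n) : Convex ℝ (ι ⁻¹' F) := hF.affine_preimage ι.toAffineMap

/-- The affine hull of a set of dimension `k`. -/
noncomputable def hull {n k : ℕ} (F : Set (E n)) (hF : F.Nonempty)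
    (hk : Module.finrank ℝ (dirSpace F) = k) : Plane n k :=
  ⟨affineSpan ℝ F, hF.mono (subset_affineSpan ℝ F), hk⟩

/-- At a relative boundary point, a convex set has a nontrivial supporting functional. -/
theorem exists_support_of_notMem_relInt {n : ℕ} {F : Set (E n)} (hF : Convex ℝ F) {x : E n}
    (hx : x ∈ F) (hx' : x ∉ relInt F) :
    ∃ q, x ∈ expo F q ∧ ∃ y ∈ F, inner ℝ q y < inner ℝ q x := by
  let A : Plane n _ := hull F ⟨x, hx⟩ rfl
  obtain ⟨ι, hι⟩ := A.exists_param
  change Set.range ι = affineSpan ℝ F at hι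
  obtain ⟨z, rfl⟩ : x ∈ Set.range ι := by rw [hι]; exact subset_affineSpan ℝ F hx
  have hcv := convex_preimage_isometry hF ι
  have hne : (interior (ι ⁻¹' F)).Nonempty :=
    hcv.interior_nonempty_iff_affineSpan_eq_top.2 (affineSpan_preimage_eq_top ι hι)
  have hz : z ∉ interior (ι ⁻¹' F) := by
    intro h
    apply hx'
    rw [relInt_eq_image ι hι]
    exact ⟨z, h, rfl⟩
  -- The separation takes place inside the affine hull, where the set has interior points; on these
  -- the functional is strictly smaller, so it is not constant on `F`.
  obtain ⟨f, hf⟩ := geometric_hahn_banach_open_point hcv.interior isOpen_interior hz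
  let p := (InnerProductSpace.toDual ℝ (E _)).symm f
  have hp : ∀ a b, inner ℝ (ι.linearIsometry p) (ι a) - inner ℝ (ι.linearIsometry p) (ι b) =
      f a - f b := by
    intro a b
    have h1 : ι a - ι b = ι.linearIsometry (a - b) := (ι.map_vsub a b).symm
    rw [← inner_sub_right, h1, LinearIsometry.inner_map_map,
      InnerProductSpace.toDual_symm_apply, map_sub]
  refine ⟨ι.linearIsometry p, ⟨hx, fun y hy => ?_⟩, ?_⟩
  · obtain ⟨w, rfl⟩ : y ∈ Set.range ι := by rw [hι]; exact subset_affineSpan ℝ F hy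
    have hw : w ∈ closure (interior (ι ⁻¹' F)) := by
      rw [hcv.closure_interior_eq_closure_of_nonempty_interior hne]
      exact subset_closure hy
    have : f w ≤ f z :=
      closure_minimal (fun a ha => (hf a ha).le) (isClosed_le f.continuous continuous_const) hw
    linarith [hp w z]
  · obtain ⟨a, ha⟩ := hne
    have haF : a ∈ ι ⁻¹' F := interior_subset ha
    refine ⟨ι a, haF, ?_⟩
    linarith [hp a z, hf a ha]

/-- A functional that attains its maximum over `F` at a relative interior point is constant. -/
theorem inner_eq_of_mem_relInt {n : ℕ} {F : Set (E n)} {x : E n} (hx : x ∈ relInt F) {u : E n}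
    (h : ∀ y ∈ F, inner ℝ y u ≤ inner ℝ x u) {y : E n} (hy : y ∈ F) :
    inner ℝ y u = inner ℝ x u := by
  refine le_antisymm (h y hy) ?_
  obtain ⟨hxA, ε, hε, hb⟩ := hx
  obtain ⟨τ, hτ, hτ'⟩ : ∃ τ : ℝ, 0 < τ ∧ τ * ‖y - x‖ < ε := by
    refine ⟨ε / (‖y - x‖ + 1), by positivity, ?_⟩
    rw [div_mul_eq_mul_div, div_lt_iff₀ (by positivity)]
    nlinarith [norm_nonneg (y - x)]
  -- The segment from `y` to `x` can be prolonged slightly beyond a relative interior point `x`.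
  have hmem : x + τ • (x - y) ∈ F := by
    refine hb ⟨?_, ?_⟩
    · rw [Metric.mem_ball, dist_eq_norm, add_sub_cancel_left, norm_smul, Real.norm_eq_abs,
        abs_of_pos hτ, norm_sub_rev]
      exact hτ'
    · have := AffineSubspace.vadd_mem_of_mem_direction
        (Submodule.smul_mem _ τ (AffineSubspace.vsub_mem_direction hxA (subset_affineSpan ℝ F hy)))
        hxA
      rw [vadd_eq_add, add_comm] at this
      exact this
  have h1 := h _ hmem
  rw [inner_add_left, inner_smul_left, inner_sub_left, RCLike.conj_to_real] at h1
  have h2 : 0 ≤ τ * (inner ℝ y u - inner ℝ x u) := by linarith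
  linarith [nonneg_of_mul_nonneg_right h2 hτ]

theorem mem_orthogonal_dirSpace_iff {n : ℕ} {F : Set (E n)} {x : E n} (hx : x ∈ F) (u : E n) :
    u ∈ (dirSpace F)ᗮ ↔ ∀ y ∈ F, inner ℝ y u = inner ℝ x u := by
  constructor
  · intro h y hy
    have h1 : y -ᵥ x ∈ dirSpace F := AffineSubspace.vsub_mem_direction
      (subset_affineSpan ℝ F hy) (subset_affineSpan ℝ F hx)
    have h2 := h _ h1
    rw [vsub_eq_sub, inner_sub_left] at h2
    linarith
  · intro h
    have h1 : dirSpace F ≤ (ℝ ∙ u)ᗮ := by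
      rw [dirSpace, direction_affineSpan, vectorSpan, Submodule.span_le]
      rintro _ ⟨y, hy, z, hz, rfl⟩
      rw [SetLike.mem_coe, Submodule.mem_orthogonal_singleton_iff_inner_left]
      change inner ℝ (y - z) u = 0
      rw [inner_sub_left, h y hy, h z hz, sub_self]
    intro v hv
    exact Submodule.mem_orthogonal_singleton_iff_inner_left.1 (h1 hv)

/-! ### Normal vectors and the normal bundle. -/

theorem mem_frontier_of_normal {n : ℕ} {P : Set (E n)} {x : E n} (hx : x ∈ P) {u : E n}
    (hu : u ≠ 0) (h : ∀ y ∈ P, inner ℝ y u ≤ inner ℝ x u) : x ∈ frontier P := by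
  refine ⟨subset_closure hx, fun hi => ?_⟩
  rw [mem_interior_iff_mem_nhds] at hi
  have hc : Filter.Tendsto (fun τ : ℝ => x + τ • u) (nhds 0) (nhds x) := by
    have : Continuous fun τ : ℝ => x + τ • u := by fun_prop
    simpa using this.tendsto 0
  have hev : ∀ᶠ τ : ℝ in nhdsWithin 0 (Set.Ioi 0), x + τ • u ∈ P :=
    (hc.eventually hi).filter_mono nhdsWithin_le_nhds
  obtain ⟨τ, hτ, hτ0⟩ := (hev.and self_mem_nhdsWithin).exists
  have hτ0' : 0 < τ := hτ0
  have h1 := h _ hτ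
  rw [inner_add_left, inner_smul_left, RCLike.conj_to_real, real_inner_self_eq_norm_sq] at h1
  have : 0 < τ * ‖u‖ ^ 2 := by positivity
  linarith

theorem sph_ne_zero {n : ℕ} (u : Sph n) : (u : E n) ≠ 0 := by
  intro h
  simpa [h] using u.2

theorem mem_nor_iff {n : ℕ} (P : Polytope n) (z : Sig n) :
    z ∈ Nor P ↔ z.1 ∈ P.1 ∧ ∀ y ∈ P.1, inner ℝ y (z.2 : E n) ≤ inner ℝ z.1 (z.2 : E n) := by
  constructor
  · rintro ⟨h1, h2⟩
    exact ⟨P.2.isCompact.isClosed.frontier_subset h1, h2⟩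
  · rintro ⟨h1, h2⟩
    exact ⟨mem_frontier_of_normal h1 (sph_ne_zero _) h2, h2⟩

theorem prod_normals_subset_nor {n : ℕ} (P : Polytope n) {F : Set (E n)} (hF : F ⊆ P.1) :
    F ×ˢ normals P F ⊆ Nor P := fun z hz => (mem_nor_iff P z).2 ⟨hF hz.1, hz.2 z.1 hz.1⟩

theorem isClosed_nor {n : ℕ} (P : Polytope n) : IsClosed (Nor P) := by
  have : Nor P = {z : Sig n | z.1 ∈ P.1} ∩
      ⋂ y ∈ P.1, {z : Sig n | inner ℝ y (z.2 : E n) ≤ inner ℝ z.1 (z.2 : E n)} := by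
    ext z
    rw [mem_nor_iff]
    simp
  rw [this]
  refine (P.2.isCompact.isClosed.preimage continuous_fst).inter ?_
  exact isClosed_biInter fun y _ => isClosed_le (by fun_prop) (by fun_prop)

theorem isClosed_normals {n : ℕ} (P : Polytope n) (F : Set (E n)) : IsClosed (normals P F) := by
  have : normals P F = ⋂ x ∈ F, ⋂ y ∈ P.1,
      {u : Sph n | inner ℝ y (u : E n) ≤ inner ℝ x (u : E n)} := by
    ext u
    simp [normals]
  rw [this]
  exact isClosed_biInter fun x _ => isClosed_biInter fun y _ => isClosed_le (by fun_prop)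
    (by fun_prop)

theorem normals_subset_perpSphere {n : ℕ} (P : Polytope n) {F : Set (E n)} (hF : F ⊆ P.1)
    (hne : F.Nonempty) : normals P F ⊆ perpSphere (dirSpace F) := by
  intro u hu
  obtain ⟨x, hx⟩ := hne
  exact (mem_orthogonal_dirSpace_iff hx _).2 fun y hy =>
    le_antisymm (hu x hx y (hF hy)) (hu y hy x (hF hx))

/-! ### Decomposition of the normal bundle along the faces. -/

section faces

variable {n k : ℕ} {P : Polytope n} {F : Set (E n)}

theorem face_subset (hF : F ∈ faces P k) : F ⊆ P.1 := hF.2.1.subset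

theorem face_isPolytope (hF : F ∈ faces P k) : IsPolytope F := P.2.of_isExposed hF.2.1 hF.1

/-- The affine hull of a face. -/
noncomputable def facePlane (hF : F ∈ faces P k) : Plane n k := hull F hF.1 hF.2.2

/-- A functional exposing `F` is constant on the affine hull of `F`. Consequently a face is
determined by its affine hull, and faces may be indexed by planes. -/
theorem affineSpan_inter_eq (hF : F ∈ faces P k) : (affineSpan ℝ F : Set (E n)) ∩ P.1 = F := by
  refine Set.Subset.antisymm ?_ (Set.subset_inter (subset_affineSpan ℝ F) (face_subset hF))
  obtain ⟨q, hq⟩ := exists_eq_expo hF.2.1 hF.1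
  obtain ⟨x, hx⟩ := hF.1
  rintro y ⟨hy, hyP⟩
  have hq' : q ∈ (dirSpace F)ᗮ := by
    rw [mem_orthogonal_dirSpace_iff hx]
    intro z hz
    rw [real_inner_comm, real_inner_comm q x]
    rw [hq] at hx hz
    exact le_antisymm (hx.2 z hz.1) (hz.2 x hx.1)
  have h1 : y -ᵥ x ∈ dirSpace F :=
    AffineSubspace.vsub_mem_direction hy (subset_affineSpan ℝ F hx)
  have h2 := hq' _ h1
  rw [vsub_eq_sub, inner_sub_left] at h2
  rw [hq] at hx ⊢
  refine ⟨hyP, fun z hz => (hx.2 z hz).trans ?_⟩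
  rw [real_inner_comm, real_inner_comm y q]
  linarith

theorem face_eq_of_affineSpan_eq {k' : ℕ} {F' : Set (E n)} (hF : F ∈ faces P k)
    (hF' : F' ∈ faces P k') (h : affineSpan ℝ F = affineSpan ℝ F') : F = F' := by
  rw [← affineSpan_inter_eq hF, ← affineSpan_inter_eq hF', h]

/-- The domain of a face integral is cut out of `Nor P` by a set depending on the plane alone. This
is the source of local definedness. -/
theorem nor_inter_bundle (hF : F ∈ faces P k) (A : Plane n k) (hA : A.1 = affineSpan ℝ F) :
    Nor P ∩ A.bundle = F ×ˢ normals P F := by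
  ext z
  rw [Plane.bundle, hA]
  constructor
  · rintro ⟨hz, hzA⟩
    rw [mem_nor_iff] at hz
    have hzF : z.1 ∈ F := by
      rw [← affineSpan_inter_eq hF]
      exact ⟨hzA.1, hz.1⟩
    refine ⟨hzF, fun x hx y hy => ?_⟩
    rw [(mem_orthogonal_dirSpace_iff hzF _).1 hzA.2 x hx]
    exact hz.2 y hy
  · intro hz
    exact ⟨prod_normals_subset_nor P (face_subset hF) hz, subset_affineSpan ℝ F hz.1,
      normals_subset_perpSphere P (face_subset hF) hF.1 hz.2⟩

/-- Take an exposed face through `x` of least dimension. If `x` were a relative boundary point, a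
supporting functional would expose a smaller face of it containing `x`, and that face is again
exposed in `P`. -/
theorem exists_face_mem_relInt {x : E n} (hx : x ∈ P.1) :
    ∃ k, ∃ F ∈ faces P k, x ∈ relInt F := by
  classical
  have hex : ∃ d, ∃ q, x ∈ expo P.1 q ∧ Module.finrank ℝ (dirSpace (expo P.1 q)) = d :=
    ⟨_, 0, ⟨hx, by simp⟩, rfl⟩
  obtain ⟨q, hxq, hd⟩ := Nat.find_spec hex
  refine ⟨_, expo P.1 q, ⟨⟨x, hxq⟩, isExposed_expo _ _, rfl⟩, ?_⟩
  by_contra hxr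
  have hface := P.2.of_isExposed (isExposed_expo _ q) ⟨x, hxq⟩
  obtain ⟨r, hxr', y, hy, hyr⟩ := exists_support_of_notMem_relInt hface.convex hxq hxr
  obtain ⟨q', hq'⟩ := P.2.exists_expo_expo q r ⟨x, hxr'⟩
  refine Nat.find_min hex (m := Module.finrank ℝ (dirSpace (expo P.1 q'))) ?_
    ⟨q', hq' ▸ hxr', rfl⟩
  rw [← hd, ← hq']
  refine Submodule.finrank_lt_finrank_of_lt (lt_of_le_of_ne ?_ fun heq => ?_)
  · exact AffineSubspace.direction_le (affineSpan_mono ℝ fun z hz => hz.1)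
  · have h1 : r ∈ (dirSpace (expo (expo P.1 q) r))ᗮ := by
      rw [mem_orthogonal_dirSpace_iff hxr']
      intro z hz
      rw [real_inner_comm, real_inner_comm r x]
      exact le_antisymm (hxr'.2 z hz.1) (hz.2 x hxr'.1)
    rw [heq, mem_orthogonal_dirSpace_iff hxq] at h1
    have := h1 y hy
    rw [real_inner_comm, real_inner_comm r x] at this
    exact hyr.ne this

/-- A normal vector at a relative interior point of a face is normal along the whole face. Dimension
`n` is excluded because a unit vector cannot be orthogonal to everything. -/
theorem exists_face_of_mem_nor {z : Sig n} (hz : z ∈ Nor P) :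
    ∃ k < n, ∃ F ∈ faces P k, z ∈ relInt F ×ˢ normals P F := by
  rw [mem_nor_iff] at hz
  obtain ⟨k, F, hF, hx⟩ := exists_face_mem_relInt hz.1
  have hu : z.2 ∈ normals P F := by
    intro x hxF y hy
    rw [inner_eq_of_mem_relInt hx (fun y hy => hz.2 y (face_subset hF hy)) hxF]
    exact hz.2 y hy
  refine ⟨k, ?_, F, hF, hx, hu⟩
  have hk : k ≤ n := by
    rw [← hF.2.2]; exact finrank_le_dim _
  refine lt_of_le_of_ne hk fun hkn => ?_
  have h1 := normals_subset_perpSphere P (face_subset hF) hF.1 hu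
  have h2 : (dirSpace F)ᗮ = ⊥ := Submodule.finrank_eq_zero.1
    ((finrank_orthogonal_eq _ hF.2.2).trans (by omega))
  have h3 : (z.2 : E n) ∈ (dirSpace F)ᗮ := h1
  rw [h2, Submodule.mem_bot] at h3
  exact sph_ne_zero _ h3

end faces

/-- Regarded as a polytope in its own right, a face has every orthogonal unit vector as a normal. By
locality it can therefore replace `P`. -/
theorem IsPolytope.prod_perpSphere_subset_nor {n : ℕ} {F : Set (E n)} (hF : IsPolytope F) :
    F ×ˢ perpSphere (dirSpace F) ⊆ Nor ⟨F, hF⟩ := by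
  intro z hz
  exact (mem_nor_iff _ z).2 ⟨hz.1, fun y hy =>
    ((mem_orthogonal_dirSpace_iff hz.1 _).1 hz.2 y hy).le⟩

/-- Through every point of a plane there is a polytope in the plane with this point in the relative
interior. -/
theorem exists_polytope_mem_relInt {n k : ℕ} (A : Plane n k) {x : E n} (hx : x ∈ A.1) :
    ∃ F : Set (E n), IsPolytope F ∧ affineSpan ℝ F = A.1 ∧ x ∈ relInt F := by
  obtain ⟨ι, hι⟩ := A.exists_param
  obtain ⟨z, rfl⟩ : x ∈ Set.range ι := by rw [hι]; exact hx
  obtain ⟨b, hb, -⟩ := exists_mem_interior_convexHull_affineBasis (Filter.univ_mem (f := nhds z))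
  have hspan : affineSpan ℝ (ι '' convexHull ℝ (Set.range b)) = A.1 := by
    have h2 := AffineSubspace.map_span ι.toAffineMap (convexHull ℝ (Set.range b))
    rw [AffineIsometry.coe_toAffineMap, affineSpan_convexHull, b.tot] at h2
    rw [← h2]
    apply SetLike.coe_injective
    rw [AffineSubspace.coe_map, AffineSubspace.top_coe, Set.image_univ]
    exact hι
  refine ⟨ι '' convexHull ℝ (Set.range b), ?_, hspan, ?_⟩
  · exact ⟨ι '' Set.range b, (Set.finite_range b).image _, (Set.range_nonempty b).image _,
      ι.toAffineMap.image_convexHull _⟩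
  · rw [relInt_eq_image ι (by rw [hι, hspan]), Set.preimage_image_eq _ ι.injective]
    exact ⟨z, hb, rfl⟩

theorem ev_integral {n a : ℕ} {X : Type*} [MeasurableSpace X] {μ : Measure X} (f : X → Tensor n a)
    (hf : Integrable f μ) (y : E n) : ev (∫ x, f x ∂μ) y = ∫ x, ev (f x) y ∂μ := by
  let l : Tensor n a →ₗ[ℝ] ℝ := (LinearMap.proj y).comp (evLinear n a)
  have h := ContinuousLinearMap.integral_comp_comm (𝕜 := ℝ)
    (LinearMap.toContinuousLinearMap (𝕜 := ℝ) (E := Tensor n a) l) hf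
  exact h.symm

/-! ### Covariant tensor fields and their integrals over normal bundles -/

/-- A tensor `τ(L, u)` depending, in an `SO(n)` covariant way, on a linear subspace `L` and a
vector `u` orthogonal to it. -/
structure TField (n a : ℕ) where
  /-- the tensor attached to `L` and `u` -/
  toFun : Submodule ℝ (E n) → E n → Tensor n a
  covariant : ∀ (ϑ : E n ≃ₗᵢ[ℝ] E n), isoDet ϑ = 1 → ∀ (L : Submodule ℝ (E n)), ∀ u ∈ Lᗮ, ∀ y : E n,
      ev (toFun (L.map (ϑ.toLinearEquiv : E n →ₗ[ℝ] E n)) (ϑ u)) (ϑ y) = ev (toFun L u) y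
  continuous : ∀ (L : Submodule ℝ (E n)) (y : E n),
    Continuous fun u : Sph n => ev (toFun L u) y

/-- The mapping `∑_{F ∈ 𝓕_k(P)} ∫_F ∫_{ν(P,F)} 1_η(x,u) x^r τ(L(F),u)`. -/
noncomputable def fieldMap {n a : ℕ} (k r : ℕ) (τ : TField n a) : TMap n (r + a) := fun P η =>
  ∑ F ∈ (finite_faces P k).toFinset,
    faceIntegral P k F η (fun x u => symMul (vecPow x r) (τ.toFun (dirSpace F) u))

/-- The integrand of `ev (fieldMap k r τ P η) y`. -/
noncomputable def weight {n k a : ℕ} (r : ℕ) (τ : TField n a) (y : E n) (A : Plane n k)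
    (z : Sig n) : ℝ := inner ℝ z.1 y ^ r * ev (τ.toFun A.1.direction z.2) y

theorem continuous_weight {n k a : ℕ} (r : ℕ) (τ : TField n a) (y : E n) (A : Plane n k) :
    Continuous (weight r τ y A) := by
  have h := (τ.continuous A.1.direction y).comp (continuous_snd (X := E n) (Y := Sph n))
  exact ((continuous_fst.inner continuous_const).pow r).mul h

instance {n k : ℕ} (A : Plane n k) : IsFiniteMeasureOnCompacts A.meas := by
  refine ⟨fun K hK => ?_⟩
  have h1 : K ⊆ (Prod.fst '' K) ×ˢ Set.univ := fun z hz => ⟨⟨z, hz, rfl⟩, trivial⟩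
  refine (measure_mono h1).trans_lt ?_
  rw [Plane.meas, Measure.prod_prod]
  exact ENNReal.mul_lt_top (A.pointMeasure_lt_top (hK.image continuous_fst).isBounded)
    (measure_lt_top _ _)

theorem isCompact_nor {n : ℕ} (P : Polytope n) : IsCompact (Nor P) := by
  have : IsCompact (P.1 ×ˢ (Set.univ : Set (Sph n))) := P.2.isCompact.prod isCompact_univ
  exact this.of_isClosed_subset (isClosed_nor P) fun z hz => ⟨((mem_nor_iff P z).1 hz).1, trivial⟩

theorem integrableOn_nor {n k : ℕ} (A : Plane n k) (P : Polytope n) {f : Sig n → ℝ}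
    (hf : Continuous f) : IntegrableOn f (Nor P) A.meas :=
  hf.continuousOn.integrableOn_compact (isCompact_nor P)

/-! ### Face integrals as integrals over the normal bundle. -/

section

variable {n k : ℕ} {P : Polytope n} {F : Set (E n)}

theorem restrict_prod_normals (hF : F ∈ faces P k) (A : Plane n k)
    (hA : A.1 = affineSpan ℝ F) :
    ((μHE[k] : Measure (E n)).restrict F).prod
      ((μHE[n - k - 1] : Measure (Sph n)).restrict (normals P F)) =
      A.meas.restrict (F ×ˢ normals P F) := by
  have h1 : F ⊆ A.1 := by rw [hA]; exact subset_affineSpan ℝ F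
  have h2 : normals P F ⊆ perpSphere A.1.direction := by
    rw [hA]; exact normals_subset_perpSphere P (face_subset hF) hF.1
  rw [Plane.meas, ← Measure.prod_restrict, Plane.pointMeasure, Plane.normalMeasure,
    Measure.restrict_restrict_of_subset h1, Measure.restrict_restrict_of_subset h2]

/-- Fubini turns the iterated integral into one over `F × ν(P,F)`, which by `nor_inter_bundle`
agrees with `Nor P` up to a null set of the measure of `A`. -/
theorem ev_faceIntegral {a : ℕ} (hF : F ∈ faces P k) (A : Plane n k) (hA : A.1 = affineSpan ℝ F)
    (η : BorelSig n) (f : E n → E n → Tensor n a)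
    (hf : Continuous fun z : Sig n => f z.1 z.2) (y : E n) :
    ev (faceIntegral P k F η f) y = ∫ z in η.1 ∩ Nor P, ev (f z.1 z.2) y ∂A.meas := by
  classical
  have hcpt : IsCompact (F ×ˢ normals P F) :=
    (face_isPolytope hF).isCompact.prod (isClosed_normals P F).isCompact
  have hint : IntegrableOn (fun z : Sig n => f z.1 z.2) (F ×ˢ normals P F) A.meas :=
    hf.continuousOn.integrableOn_compact hcpt
  have hind : Integrable (η.1.indicator fun z : Sig n => f z.1 z.2)
      (A.meas.restrict (F ×ˢ normals P F)) := hint.indicator η.2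
  have hfin : IsFiniteMeasure ((μHE[n - k - 1] : Measure (Sph n)).restrict (normals P F)) := by
    refine ⟨?_⟩
    rw [Measure.restrict_apply_univ]
    exact (measure_mono (normals_subset_perpSphere P (face_subset hF) hF.1)).trans_lt
      (hausdorff_perpSphere_lt_top _ hF.2.2)
  have hsf : SFinite ((μHE[k] : Measure (E n)).restrict F) := by
    have h1 : F ⊆ A.1 := by rw [hA]; exact subset_affineSpan ℝ F
    have : (μHE[k] : Measure (E n)).restrict F = A.pointMeasure.restrict F := by
      rw [Plane.pointMeasure, Measure.restrict_restrict_of_subset h1]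
    rw [this]
    infer_instance
  have h1 : faceIntegral P k F η f =
      ∫ z, η.1.indicator (fun z : Sig n => f z.1 z.2) z ∂(A.meas.restrict (F ×ˢ normals P F)) := by
    rw [← restrict_prod_normals hF A hA] at hind ⊢
    rw [integral_prod _ hind]
    simp only [faceIntegral, Set.indicator_apply]
  rw [h1, ev_integral _ hind]
  have h2 : ∀ z, ev (η.1.indicator (fun z : Sig n => f z.1 z.2) z) y =
      η.1.indicator (fun z : Sig n => ev (f z.1 z.2) y) z := by
    intro z
    by_cases hz : z ∈ η.1 <;> simp [hz, ev_zero]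
  simp only [h2]
  rw [integral_indicator η.2, Measure.restrict_restrict η.2, ← nor_inter_bundle hF A hA,
    ← Set.inter_assoc]
  refine setIntegral_congr_set ?_
  have hb : ∀ᵐ z ∂A.meas, z ∈ A.bundle := A.meas_bundle_compl
  filter_upwards [hb] with z hz
  exact propext ⟨fun h => h.1, fun h => ⟨h, hz⟩⟩

end

open Classical in
/-- The affine hulls of the `k`-faces of `P`. -/
noncomputable def facePlanes {n : ℕ} (P : Polytope n) (k : ℕ) : Finset (Plane n k) :=
  (finite_faces P k).toFinset.attach.image fun F =>
    facePlane ((finite_faces P k).mem_toFinset.1 F.2)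

theorem mem_facePlanes {n k : ℕ} {P : Polytope n} {A : Plane n k} :
    A ∈ facePlanes P k ↔ ∃ F ∈ faces P k, A.1 = affineSpan ℝ F := by
  simp only [facePlanes, Finset.mem_image, Finset.mem_attach, true_and]
  constructor
  · rintro ⟨F, rfl⟩
    exact ⟨F.1, (finite_faces P k).mem_toFinset.1 F.2, rfl⟩
  · rintro ⟨F, hF, h⟩
    exact ⟨⟨F, (finite_faces P k).mem_toFinset.2 hF⟩, Subtype.ext h.symm⟩

theorem sum_facePlanes {n k : ℕ} (P : Polytope n) (h : Plane n k → ℝ) (G : Set (E n) → ℝ)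
    (hG : ∀ F ∈ faces P k, ∀ A : Plane n k, A.1 = affineSpan ℝ F → G F = h A) :
    ∑ F ∈ (finite_faces P k).toFinset, G F = ∑ A ∈ facePlanes P k, h A := by
  classical
  rw [facePlanes, Finset.sum_image, ← Finset.sum_attach]
  · exact Finset.sum_congr rfl fun F _ => hG F.1 ((finite_faces P k).mem_toFinset.1 F.2) _ rfl
  · intro F _ F' _ hFF'
    apply Subtype.ext
    exact face_eq_of_affineSpan_eq ((finite_faces P k).mem_toFinset.1 F.2)
      ((finite_faces P k).mem_toFinset.1 F'.2) (congrArg Subtype.val hFF')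

/-- The normal bundle of `P` has measure zero with respect to planes which are not affine hulls of
faces of `P`. -/
theorem meas_nor_eq_zero {n k : ℕ} {P : Polytope n} {A : Plane n k} (hA : A ∉ facePlanes P k) :
    A.meas (Nor P) = 0 := by
  have h1 : Nor P ⊆ ⋃ k', ⋃ F ∈ faces P k',
      (affineSpan ℝ F : Set (E n)) ×ˢ perpSphere (dirSpace F) := by
    intro z hz
    obtain ⟨k', -, F, hF, hzF⟩ := exists_face_of_mem_nor hz
    simp only [Set.mem_iUnion]
    exact ⟨k', F, hF, hzF.1.1, normals_subset_perpSphere P (face_subset hF) hF.1 hzF.2⟩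
  refine measure_mono_null h1 (measure_iUnion_null fun k' => ?_)
  rw [measure_biUnion_null_iff (finite_faces P k').countable]
  intro F hF'
  refine A.meas_eq_zero_of_ne fun h => hA ?_
  have hkk : k' = k := by
    rw [← hF'.2.2, ← A.2.2, h]; rfl
  subst hkk
  exact mem_facePlanes.2 ⟨F, hF', h⟩

theorem setIntegral_nor_eq_zero {n k : ℕ} {P : Polytope n} {A : Plane n k}
    (hA : A ∉ facePlanes P k) (s : Set (Sig n)) (f : Sig n → ℝ) :
    ∫ z in s ∩ Nor P, f z ∂A.meas = 0 :=
  setIntegral_measure_zero _ (measure_mono_null Set.inter_subset_right (meas_nor_eq_zero hA))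

/-- The action of an affine isometry on planes. -/
noncomputable def Plane.mapEquiv {n k : ℕ} (g : E n ≃ᵃⁱ[ℝ] E n) : Plane n k ≃ Plane n k :=
  Equiv.ofBijective (fun A : Plane n k => A.map g) (And.intro (Plane.map_injective g)
    (Plane.map_surjective g) : Function.Bijective (fun A : Plane n k => A.map g))

theorem Plane.mapEquiv_apply {n k : ℕ} (g : E n ≃ᵃⁱ[ℝ] E n) (A : Plane n k) :
    Plane.mapEquiv g A = A.map g := rfl

section fieldMap

variable {n a : ℕ} (k r : ℕ) (τ : TField n a) (P : Polytope n) (η : BorelSig n) (y : E n)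

theorem ev_fieldMap : ev (fieldMap k r τ P η) y =
    ∑ A ∈ facePlanes P k, ∫ z in η.1 ∩ Nor P, weight r τ y A z ∂A.meas := by
  rw [fieldMap, ev_sum]
  refine sum_facePlanes P _ _ fun F hF A hA => ?_
  rw [ev_faceIntegral hF A hA η _ ?_ y]
  · refine integral_congr_ae (Filter.Eventually.of_forall fun z => ?_)
    simp only [weight, ev_symMul, ev_vecPow]
    rw [hA]; rfl
  · rw [continuous_tensor_iff]
    intro y
    simp only [ev_symMul, ev_vecPow]
    have h := (τ.continuous (dirSpace F) y).comp (continuous_snd (X := E n) (Y := Sph n))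
    exact ((continuous_fst.inner continuous_const).pow r).mul h

/-- Planes that are not affine hulls of `k`-faces contribute zero, so all planes may be admitted.
The index set no longer depends on `P`, and rigid motions simply permute it. -/
theorem ev_fieldMap_eq_finsum : ev (fieldMap k r τ P η) y =
    ∑ᶠ A : Plane n k, ∫ z in η.1 ∩ Nor P, weight r τ y A z ∂A.meas := by
  rw [ev_fieldMap, finsum_eq_sum_of_support_subset]
  intro A hA
  by_contra h
  exact hA (setIntegral_nor_eq_zero h _ _)

theorem fieldMap_isLocallyDefined : IsLocallyDefined (fieldMap k r τ) := by
  intro P P' η η' h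
  apply ev_injective
  funext y
  rw [ev_fieldMap_eq_finsum, ev_fieldMap_eq_finsum, h]

theorem weight_sigMap (g : E n ≃ᵃⁱ[ℝ] E n) (hg : isoDet g.linearIsometryEquiv = 1)
    (A : Plane n k) (z : Sig n) (hz : z ∈ A.bundle) :
    weight r τ (g.linearIsometryEquiv y) (A.map g) (sigMap g z) =
      (inner ℝ z.1 y + inner ℝ (g 0) (g.linearIsometryEquiv y)) ^ r *
        ev (τ.toFun A.1.direction z.2) y := by
  rw [weight, Plane.map_direction]
  congr 1
  · congr 1
    change inner ℝ (g z.1) _ = _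
    rw [affineIsometry_apply_eq, inner_add_left, LinearIsometryEquiv.inner_map_map]
  · exact τ.covariant _ hg _ _ hz.2 y

/-- Change of variables under `g`, with the binomial expansion of `⟨gx, ϑy⟩^r = (⟨x, y⟩ + ⟨g0,
ϑy⟩)^r`. Rotations and translations are the two special cases needed. -/
theorem ev_fieldMap_map (g : E n ≃ᵃⁱ[ℝ] E n) (hg : isoDet g.linearIsometryEquiv = 1) :
    ev (fieldMap k r τ (P.map g) (η.map g)) (g.linearIsometryEquiv y) =
      ∑ l ∈ Finset.range (r + 1), (r.choose l : ℝ) *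
        inner ℝ (g 0) (g.linearIsometryEquiv y) ^ l * ev (fieldMap k (r - l) τ P η) y := by
  set c : ℝ := inner ℝ (g 0) (g.linearIsometryEquiv y) with hc
  have h1 : ∀ A : Plane n k, ∫ z in (η.map g).1 ∩ Nor (P.map g),
      weight r τ (g.linearIsometryEquiv y) (A.map g) z ∂(A.map g).meas =
      ∑ l ∈ Finset.range (r + 1), (r.choose l : ℝ) * c ^ l *
        ∫ z in η.1 ∩ Nor P, weight (r - l) τ y A z ∂A.meas := by
    intro A
    have hset : (η.map g).1 ∩ Nor (P.map g) = sigMap g '' (η.1 ∩ Nor P) := by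
      rw [nor_map, Set.image_inter (sigMap g).injective]; rfl
    rw [hset, A.meas_map, (sigMap g).measurableEmbedding.setIntegral_map,
      Set.preimage_image_eq _ (sigMap g).injective]
    have hae : ∀ᵐ z ∂A.meas.restrict (η.1 ∩ Nor P),
        weight r τ (g.linearIsometryEquiv y) (A.map g) (sigMap g z) =
        ∑ l ∈ Finset.range (r + 1), (r.choose l : ℝ) * c ^ l * weight (r - l) τ y A z := by
      refine ae_restrict_of_ae ?_
      have hb : ∀ᵐ z ∂A.meas, z ∈ A.bundle := A.meas_bundle_compl
      filter_upwards [hb] with z hz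
      rw [weight_sigMap k r τ y g hg A z hz, ← hc, add_comm, add_pow, Finset.sum_mul]
      refine Finset.sum_congr rfl fun l _ => ?_
      rw [weight]
      ring
    rw [integral_congr_ae hae, integral_finsetSum]
    · simp only [integral_const_mul]
    · intro l _
      exact ((integrableOn_nor A P (continuous_weight _ τ y A)).mono_set
        Set.inter_subset_right).const_mul _
  rw [ev_fieldMap_eq_finsum]
  rw [← finsum_comp_equiv (Plane.mapEquiv g)]
  simp only [Plane.mapEquiv_apply, h1]
  rw [finsum_eq_sum_of_support_subset (s := facePlanes P k), Finset.sum_comm]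
  · refine Finset.sum_congr rfl fun l _ => ?_
    rw [← Finset.mul_sum, ev_fieldMap]
  · intro A hA
    by_contra h
    refine hA (Finset.sum_eq_zero fun l _ => ?_)
    rw [setIntegral_nor_eq_zero h, mul_zero]

theorem fieldMap_isSOCovariant : IsSOCovariant (fieldMap k r τ) := by
  intro ϑ hϑ P η
  apply ev_injective
  funext y
  obtain ⟨y, rfl⟩ := ϑ.surjective y
  rw [ev_rotTensor, ϑ.symm_apply_apply, Polytope.rotate_eq_map, BorelSig.rotate_eq_map]
  have h := ev_fieldMap_map k r τ P η y ϑ.toAffineIsometryEquiv hϑ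
  have h0 : ϑ.toAffineIsometryEquiv 0 = (0 : E n) := ϑ.map_zero
  rw [h0, inner_zero_left] at h
  refine h.trans ?_
  rw [Finset.sum_eq_single_of_mem 0 (Finset.mem_range.2 (Nat.succ_pos r))]
  · simp
  · intro l _ hl
    simp [zero_pow hl]

theorem ev_fieldMap_translate (t : E n) :
    ev (fieldMap k r τ (P.translate t) (η.translate t)) y =
      ∑ l ∈ Finset.range (r + 1), (r.choose l : ℝ) * inner ℝ t y ^ l *
        ev (fieldMap k (r - l) τ P η) y := by
  rw [Polytope.translate_eq_map, BorelSig.translate_eq_map]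
  have hid : isoDet (shift t).linearIsometryEquiv = 1 := LinearMap.det_id
  have h := ev_fieldMap_map k r τ P η y (shift t) hid
  have h0 : shift t (0 : E n) = t := by rw [shift_apply, add_zero]
  rw [h0] at h
  exact h

end fieldMap

/-- On a subset of the bundle of a `k`-plane, only `k`-faces contribute. -/
theorem ev_fieldMap_of_subset_bundle {n a k k' : ℕ} (r : ℕ) (τ : TField n a) (P : Polytope n)
    (A : Plane n k) (η : BorelSig n) (hη : η.1 ⊆ A.bundle) (hP : η.1 ⊆ Nor P) (y : E n) :
    ev (fieldMap k' r τ P η) y =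
      if k' = k then ∫ z in η.1, weight r τ y A z ∂A.meas else 0 := by
  rw [ev_fieldMap_eq_finsum, Set.inter_eq_left.2 hP]
  have h0 : ∀ A' : Plane n k', A'.1 ≠ A.1 → ∫ z in η.1, weight r τ y A' z ∂A'.meas = 0 :=
    fun A' h => setIntegral_measure_zero _ (measure_mono_null hη (A'.meas_eq_zero_of_ne h))
  split_ifs with h
  · subst h
    exact finsum_eq_single _ A fun A' hA' => h0 A' fun h => hA' (Subtype.ext h)
  · refine finsum_eq_zero_of_forall_eq_zero fun A' => h0 A' fun hA' => h ?_
    rw [← A'.2.2, hA', A.2.2]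

/-! ### Countable additivity. -/

/-- If the polynomials of the values are countably additive, then so are the tensors. -/
theorem isMeasureValued_of_ev {n p : ℕ} (Γ : TMap n p)
    (h : ∀ P y, ∃ μ : SignedMeasure (Sig n), ∀ η : BorelSig n, μ η.1 = ev (Γ P η) y) :
    IsMeasureValued Γ := by
  classical
  intro P
  refine ⟨⟨fun s => if hs : MeasurableSet s then Γ P ⟨s, hs⟩ else 0, ?_, ?_, ?_⟩, ?_⟩
  · rw [dif_pos MeasurableSet.empty]
    apply ev_injective
    funext y
    obtain ⟨μ, hμ⟩ := h P y
    rw [← hμ]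
    exact μ.empty
  · intro s hs
    rw [dif_neg hs]
  · intro s hs hd
    rw [hasSum_iff_ev]
    intro y
    obtain ⟨μ, hμ⟩ := h P y
    simp only [hs, MeasurableSet.iUnion hs, dif_pos, ← hμ]
    exact μ.m_iUnion hs hd
  · intro η
    exact dif_pos η.2

theorem exists_signedMeasure_integral {n k : ℕ} (P : Polytope n) (s : Finset (Plane n k))
    (f : Plane n k → Sig n → ℝ) (hf : ∀ A, Continuous (f A)) :
    ∃ μ : SignedMeasure (Sig n), ∀ η : BorelSig n,
      μ η.1 = ∑ A ∈ s, ∫ z in η.1 ∩ Nor P, f A z ∂A.meas := by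
  refine ⟨∑ A ∈ s, (A.meas.restrict (Nor P)).withDensityᵥ (f A), fun η => ?_⟩
  rw [FunLike.coe_sum, Finset.sum_apply]
  refine Finset.sum_congr rfl fun A _ => ?_
  rw [withDensityᵥ_apply (integrableOn_nor A P (hf A)) η.2, Measure.restrict_restrict η.2]

theorem fieldMap_isMeasureValued {n a : ℕ} (k r : ℕ) (τ : TField n a) :
    IsMeasureValued (fieldMap k r τ) := by
  refine isMeasureValued_of_ev _ fun P y => ?_
  obtain ⟨μ, hμ⟩ := exists_signedMeasure_integral P (facePlanes P k) (weight r τ y)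
    (continuous_weight r τ y)
  exact ⟨μ, fun η => by rw [hμ, ev_fieldMap]⟩

/-! ### Signed measures vanishing on compact sets -/

/-- The two parts of the Jordan decomposition agree on compact subsets of `Y`, hence on Borel
subsets by inner regularity of finite measures. -/
theorem signedMeasure_eq_zero_of_isCompact {n : ℕ} (s : SignedMeasure (Sig n)) {Y : Set (Sig n)}
    (h : ∀ K ⊆ Y, IsCompact K → s K = 0) {ζ : Set (Sig n)} (hζ : MeasurableSet ζ) (hY : ζ ⊆ Y) :
    s ζ = 0 := by
  have key : ∀ K ⊆ Y, IsCompact K →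
      s.toJordanDecomposition.posPart K = s.toJordanDecomposition.negPart K := by
    intro K hK hc
    have h1 := h K hK hc
    rw [s.apply_eq_posPart_real_sub_negPart_real hc.measurableSet, sub_eq_zero] at h1
    exact (measureReal_eq_measureReal_iff).1 h1
  rw [s.apply_eq_posPart_real_sub_negPart_real hζ, sub_eq_zero]
  refine (measureReal_eq_measureReal_iff).2 ?_
  rw [hζ.measure_eq_iSup_isCompact_of_ne_top (measure_ne_top _ _),
    hζ.measure_eq_iSup_isCompact_of_ne_top (measure_ne_top _ _)]
  exact iSup_congr fun K => iSup_congr fun hK => iSup_congr fun hc => key K (hK.trans hY) hc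

theorem signedMeasure_eq_zero_of_cover {X ι : Type*} [MeasurableSpace X] (s : SignedMeasure X)
    (t : Finset ι) (B : ι → Set X) (hB : ∀ i ∈ t, MeasurableSet (B i))
    (h : ∀ i ∈ t, ∀ ζ ⊆ B i, MeasurableSet ζ → s ζ = 0) {ζ : Set X} (hζ : MeasurableSet ζ)
    (hsub : ζ ⊆ ⋃ i ∈ t, B i) : s ζ = 0 := by
  classical
  induction t using Finset.induction_on generalizing ζ with
  | empty =>
    have : ζ = ∅ := by simpa using hsub
    rw [this, s.empty]
  | insert i t hi ih =>
    have hBi := hB i (Finset.mem_insert_self i t)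
    have h1 : s ζ = s (ζ ∩ B i) + s (ζ \ B i) := by
      rw [← VectorMeasure.of_union (Set.disjoint_sdiff_right.mono_left Set.inter_subset_right)
        (hζ.inter hBi) (hζ.diff hBi), Set.inter_union_sdiff]
    rw [h1, h i (Finset.mem_insert_self i t) _ Set.inter_subset_right (hζ.inter hBi), zero_add]
    refine ih (fun j hj => hB j (Finset.mem_insert_of_mem hj))
      (fun j hj => h j (Finset.mem_insert_of_mem hj)) (hζ.diff hBi) ?_
    intro z hz
    have := hsub hz.1
    simp only [Finset.mem_insert, Set.mem_iUnion] at this ⊢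
    obtain ⟨j, rfl | hj, hzj⟩ := this
    · exact absurd hzj hz.2
    · exact ⟨j, hj, hzj⟩

/-! ### Mollification -/

theorem isometry_sigMap {n : ℕ} (g : E n ≃ᵃⁱ[ℝ] E n) : Isometry (sigMap g) :=
  g.isometry.prodMap (isometry_sphMap g.linearIsometryEquiv)

theorem sigMap_image_ball {n : ℕ} (g : E n ≃ᵃⁱ[ℝ] E n) (z : Sig n) (ε : ℝ) :
    sigMap g '' Metric.ball z ε = Metric.ball (sigMap g z) ε :=
  (IsometryEquiv.mk' (sigMap g) (sigMap g).symm (sigMap g).apply_symm_apply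
    (isometry_sigMap g)).image_ball z ε

namespace Plane

variable {n k : ℕ}

theorem meas_ball_lt_top (A : Plane n k) (z : Sig n) (ε : ℝ) :
    A.meas (Metric.ball z ε) < ⊤ := by
  rw [← ball_prod_same, meas, Measure.prod_prod]
  exact ENNReal.mul_lt_top (A.pointMeasure_lt_top Metric.isBounded_ball) (measure_lt_top _ _)

theorem meas_ball_pos (A : Plane n k) {z : Sig n} (hz : z ∈ A.bundle) {ε : ℝ} (hε : 0 < ε) :
    0 < A.meas (Metric.ball z ε) := by
  rw [← ball_prod_same, meas, Measure.prod_prod]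
  exact ENNReal.mul_pos (A.pointMeasure_ball_pos hz.1 hε).ne' (A.normalMeasure_ball_pos hz.2 hε).ne'

theorem meas_ball_eq (hn : 2 ≤ n) (A A' : Plane n k) {z z' : Sig n} (hz : z ∈ A.bundle)
    (hz' : z' ∈ A'.bundle) (ε : ℝ) : A.meas (Metric.ball z ε) = A'.meas (Metric.ball z' ε) := by
  obtain ⟨g, -, rfl, rfl⟩ := exists_rigid_motion hn A A' hz hz'
  rw [meas_map, (sigMap g).measurableEmbedding.map_apply, ← sigMap_image_ball,
    Set.preimage_image_eq _ (sigMap g).injective]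

theorem exists_meas_ball_eq (hn : 2 ≤ n) (k : ℕ) {ε : ℝ} (hε : 0 < ε) :
    ∃ W : ℝ, 0 < W ∧ ∀ A : Plane n k, ∀ z ∈ A.bundle, A.meas.real (Metric.ball z ε) = W := by
  by_cases h : ∃ A : Plane n k, ∃ z, z ∈ A.bundle
  · obtain ⟨A, z, hz⟩ := h
    refine ⟨A.meas.real (Metric.ball z ε), ?_, fun A' z' hz' => ?_⟩
    · exact ENNReal.toReal_pos (A.meas_ball_pos hz hε).ne' (A.meas_ball_lt_top z ε).ne
    · rw [Measure.real, Measure.real, meas_ball_eq hn A' A hz' hz]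
  · exact ⟨1, one_pos, fun A z hz => absurd ⟨A, z, hz⟩ h⟩

/-- Integrating the masses of small balls approximates the integral with respect to a measure. -/
theorem abs_integral_ball_sub_le (A : Plane n k) (ν : Measure (Sig n)) [IsFiniteMeasure ν]
    (hν : ν A.bundleᶜ = 0) {X : Set (Sig n)} (hX : MeasurableSet X) (hXf : A.meas X < ⊤)
    {g : Sig n → ℝ} (hg : Continuous g) (hg1 : ∀ z, |g z| ≤ 1)
    (hgX : ∀ z ∈ A.bundle, g z ≠ 0 → z ∈ X) {ε W ω : ℝ}
    (hW : ∀ z ∈ A.bundle, A.meas.real (Metric.ball z ε) = W)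
    (hω : ∀ z z', dist z z' < ε → |g z - g z'| ≤ ω) :
    |∫ z in X, g z * ν.real (Metric.ball z ε) ∂A.meas - W * ∫ z, g z ∂ν| ≤
      ω * W * ν.real Set.univ := by
  have : IsFiniteMeasure (A.meas.restrict X) := ⟨by rwa [Measure.restrict_apply_univ]⟩
  have hS : MeasurableSet {q : Sig n × Sig n | dist q.2 q.1 < ε} :=
    (isOpen_lt (by fun_prop) continuous_const).measurableSet
  -- Fubini for the kernel `1[dist z' z < ε] g z`: integrating over `z'` first gives the masses of
  -- balls, integrating over `z` first gives about `W g(z')`.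
  let f : Sig n → Sig n → ℝ := fun z z' => {q : Sig n × Sig n | dist q.2 q.1 < ε}.indicator
    (fun q => g q.1) (z, z')
  have hf : Integrable (Function.uncurry f) ((A.meas.restrict X).prod ν) := by
    refine Integrable.of_bound (C := 1) ?_ (Filter.Eventually.of_forall fun q => ?_)
    · exact ((hg.comp continuous_fst).measurable.indicator hS).aestronglyMeasurable
    · change ‖{q : Sig n × Sig n | dist q.2 q.1 < ε}.indicator (fun q => g q.1) q‖ ≤ 1
      exact (norm_indicator_le_norm_self _ _).trans (hg1 q.1)
  have h1 : ∫ z in X, g z * ν.real (Metric.ball z ε) ∂A.meas =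
      ∫ z', (∫ z in X, f z z' ∂A.meas) ∂ν := by
    rw [← integral_integral_swap hf]
    refine integral_congr_ae (Filter.Eventually.of_forall fun z => ?_)
    have : ∀ z', f z z' = (Metric.ball z ε).indicator (fun _ => g z) z' := fun z' => rfl
    simp only [this]
    rw [integral_indicator Metric.isOpen_ball.measurableSet, setIntegral_const, smul_eq_mul,
      mul_comm]
  have h2 : ∀ z' ∈ A.bundle, |∫ z in X, f z z' ∂A.meas - W * g z'| ≤ ω * W := by
    intro z' hz'
    have hb : MeasurableSet (Metric.ball z' ε) := Metric.isOpen_ball.measurableSet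
    have h3 : ∫ z in X, f z z' ∂A.meas = ∫ z in Metric.ball z' ε, g z ∂A.meas := by
      have : ∀ z, f z z' = (Metric.ball z' ε).indicator g z := by
        intro z
        classical
        simp [f, Set.indicator_apply, dist_comm z' z]
      simp only [this]
      rw [← integral_indicator hX, ← integral_indicator hb]
      refine integral_congr_ae ?_
      have hbu : ∀ᵐ z ∂A.meas, z ∈ A.bundle := A.meas_bundle_compl
      filter_upwards [hbu] with z hz
      by_cases hzX : z ∈ X
      · rw [Set.indicator_of_mem hzX]
      · rw [Set.indicator_of_notMem hzX]
        by_cases hzb : z ∈ Metric.ball z' ε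
        · rw [Set.indicator_of_mem hzb]
          by_contra h0
          exact hzX (hgX z hz (Ne.symm h0))
        · rw [Set.indicator_of_notMem hzb]
    have hfin := A.meas_ball_lt_top z' ε
    have hint : IntegrableOn g (Metric.ball z' ε) A.meas := by
      refine IntegrableOn.of_bound hfin hg.aestronglyMeasurable 1
        (Filter.Eventually.of_forall fun z => hg1 z)
    have h4 : ∫ z in Metric.ball z' ε, g z ∂A.meas - W * g z' =
        ∫ z in Metric.ball z' ε, (g z - g z') ∂A.meas := by
      rw [integral_sub hint (integrableOn_const hfin.ne), setIntegral_const, hW z' hz', smul_eq_mul]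
    rw [h3, h4, ← Real.norm_eq_abs, ← hW z' hz']
    refine norm_setIntegral_le_of_norm_le_const hfin fun z hz => ?_
    exact hω z z' hz
  have hae : ∀ᵐ z' ∂ν, ‖∫ z in X, f z z' ∂A.meas - W * g z'‖ ≤ ω * W := by
    have hbu : ∀ᵐ z ∂ν, z ∈ A.bundle := hν
    filter_upwards [hbu] with z' hz'
    exact h2 z' hz'
  have hgi : Integrable g ν := Integrable.of_bound hg.aestronglyMeasurable 1
    (Filter.Eventually.of_forall hg1)
  have hfi : Integrable (fun z' => ∫ z in X, f z z' ∂A.meas) ν := hf.integral_prod_right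
  rw [h1, ← integral_const_mul, ← integral_sub hfi (hgi.const_mul W)]
  rw [← Real.norm_eq_abs]
  exact norm_integral_le_of_norm_le_const hae

end Plane

/-! ### Translation invariant mappings on relatively open parts of faces -/

/-- The part of the ball with centre `z` that lies in the bundle of `A`. -/
noncomputable def box {n k : ℕ} (A : Plane n k) (z : Sig n) (ε : ℝ) : BorelSig n :=
  ⟨Metric.ball z ε ∩ A.bundle, Metric.isOpen_ball.measurableSet.inter A.measurableSet_bundle⟩

/-- Covariance with respect to all orientation preserving rigid motions. -/
def IsRigidCovariant {n a : ℕ} (Γ : TMap n a) : Prop :=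
  ∀ g : E n ≃ᵃⁱ[ℝ] E n, isoDet g.linearIsometryEquiv = 1 → ∀ P η y,
    ev (Γ (P.map g) (η.map g)) (g.linearIsometryEquiv y) = ev (Γ P η) y

/-- Invariance of a tensor under the rotations that fix `L` and `u`. -/
def IsStabInvariant {n a : ℕ} (L : Submodule ℝ (E n)) (u : E n) (T : Tensor n a) : Prop :=
  ∀ ϑ : E n ≃ₗᵢ[ℝ] E n, isoDet ϑ = 1 → L.map (ϑ.toLinearEquiv : E n →ₗ[ℝ] E n) = L → ϑ u = u →
    ∀ y, ev T (ϑ y) = ev T y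

/-- The fields `τ i`, `i ∈ s`, span the invariant tensors of rank `a`. -/
def SpansInvariants {n : ℕ} (k a : ℕ) {I : Type} (s : Finset I) {b : I → ℕ}
    (τ : ∀ i, TField n (b i)) : Prop :=
  ∀ (L : Submodule ℝ (E n)) (u : E n), Module.finrank ℝ L = k → u ∈ Lᗮ → ‖u‖ = 1 →
    ∀ T : Tensor n a, IsStabInvariant L u T →
      ∃ c : I → ℝ, ∀ y, ev T y = ∑ i ∈ s, c i * ev ((τ i).toFun L u) y

section

variable {n k a : ℕ} {Γ : TMap n a}

theorem prod_perpSphere_eq (F : Polytope n) (A : Plane n k) (hA : A.1 = affineSpan ℝ F.1) :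
    F.1 ×ˢ perpSphere A.1.direction = (F.1 ×ˢ Set.univ) ∩ A.bundle := by
  have h1 : F.1 ⊆ A.1 := by rw [hA]; exact subset_affineSpan ℝ F.1
  ext z
  constructor
  · intro h
    exact ⟨⟨h.1, trivial⟩, h1 h.1, h.2⟩
  · intro h
    exact ⟨h.1.1, h.2.2⟩

theorem prod_perpSphere_subset_nor (F : Polytope n) (A : Plane n k) (hA : A.1 = affineSpan ℝ F.1) :
    F.1 ×ˢ perpSphere A.1.direction ⊆ Nor F := by
  rw [hA]
  exact F.2.prod_perpSphere_subset_nor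

/-- A rigid motion carries box to box. The box lies in the normal bundles of both `F'` and the image
of `F`, so by locality the two polytopes give the same value there. -/
theorem ev_box_transport (hL : IsLocallyDefined Γ) (hG : IsRigidCovariant Γ) {F F' : Polytope n}
    {A A' : Plane n k} (hA : A.1 = affineSpan ℝ F.1) (hA' : A'.1 = affineSpan ℝ F'.1)
    {z z' : Sig n} {ε : ℝ} (h : Metric.ball z ε ∩ A.bundle ⊆ F.1 ×ˢ Set.univ)
    (h' : Metric.ball z' ε ∩ A'.bundle ⊆ F'.1 ×ˢ Set.univ) (g : E n ≃ᵃⁱ[ℝ] E n)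
    (hg : isoDet g.linearIsometryEquiv = 1) (hgA : A.map g = A') (hgz : sigMap g z = z') (y : E n) :
    ev (Γ F' (box A' z' ε)) (g.linearIsometryEquiv y) = ev (Γ F (box A z ε)) y := by
  have hbox : ((box A z ε).map g).1 = (box A' z' ε).1 := by
    change sigMap g '' (Metric.ball z ε ∩ A.bundle) = Metric.ball z' ε ∩ A'.bundle
    rw [Set.image_inter (sigMap g).injective, sigMap_image_ball, ← Plane.bundle_map, hgA, hgz]
  have h1 : (box A' z' ε).1 ⊆ Nor F' := by
    refine Set.Subset.trans ?_ (prod_perpSphere_subset_nor F' A' hA')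
    rw [prod_perpSphere_eq F' A' hA']
    exact fun w hw => ⟨h' hw, hw.2⟩
  have h2 : ((box A z ε).map g).1 ⊆ Nor (F.map g) := by
    rw [nor_map]
    refine Set.image_mono (Set.Subset.trans ?_ (prod_perpSphere_subset_nor F A hA))
    rw [prod_perpSphere_eq F A hA]
    exact fun w hw => ⟨h hw, hw.2⟩
  rw [← hG g hg F (box A z ε) y, hL F' (F.map g) (box A' z' ε) ((box A z ε).map g)]
  rw [Set.inter_eq_left.2 h1, Set.inter_eq_left.2 h2, hbox]

variable {I : Type} {s : Finset I} {b : I → ℕ} {τ : ∀ i, TField n (b i)}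

theorem exists_rigid_motion_fixing (A : Plane n k) {z : Sig n} (hz : z ∈ A.bundle)
    (ϑ : E n ≃ₗᵢ[ℝ] E n)
    (hL : A.1.direction.map (ϑ.toLinearEquiv : E n →ₗ[ℝ] E n) = A.1.direction)
    (hu : ϑ z.2 = z.2) : ∃ g : E n ≃ᵃⁱ[ℝ] E n, g.linearIsometryEquiv = ϑ ∧ A.map g = A ∧
      sigMap g z = z := by
  let g : E n ≃ᵃⁱ[ℝ] E n := ϑ.toAffineIsometryEquiv.trans (shift (z.1 - ϑ z.1))
  have hg : g.linearIsometryEquiv = ϑ := by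
    ext x
    rfl
  have hgx : g z.1 = z.1 := by
    change z.1 - ϑ z.1 + ϑ z.1 = z.1
    abel
  refine ⟨g, hg, ?_, ?_⟩
  · apply Subtype.ext
    refine AffineSubspace.ext_of_direction_eq ?_ ⟨z.1, ⟨z.1, hz.1, hgx⟩, hz.1⟩
    rw [Plane.map_direction, hg, hL]
  · refine Prod.ext hgx (Subtype.ext ?_)
    change g.linearIsometryEquiv (z.2 : E n) = _
    rw [hg, hu]

/-- The values at small balls are universal linear combinations of the fields. -/
theorem exists_coeff_box (hn : 2 ≤ n) (hL : IsLocallyDefined Γ) (hG : IsRigidCovariant Γ)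
    (hs : SpansInvariants k a s τ) (ε : ℝ) : ∃ c : I → ℝ, ∀ (F : Polytope n) (A : Plane n k),
      A.1 = affineSpan ℝ F.1 → ∀ z ∈ A.bundle, Metric.ball z ε ∩ A.bundle ⊆ F.1 ×ˢ Set.univ →
        ∀ y, ev (Γ F (box A z ε)) y = ∑ i ∈ s, c i * ev ((τ i).toFun A.1.direction z.2) y := by
  by_cases hex : ∃ (F : Polytope n) (A : Plane n k), A.1 = affineSpan ℝ F.1 ∧
      ∃ z ∈ A.bundle, Metric.ball z ε ∩ A.bundle ⊆ F.1 ×ˢ Set.univ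
  · obtain ⟨F₀, A₀, hA₀, z₀, hz₀, hF₀⟩ := hex
    obtain ⟨c, hc⟩ := hs A₀.1.direction z₀.2 A₀.2.2 hz₀.2 (by simp) (Γ F₀ (box A₀ z₀ ε)) (by
      intro ϑ hϑ hϑL hϑu y
      obtain ⟨g, rfl, hgA, hgz⟩ := exists_rigid_motion_fixing A₀ hz₀ ϑ hϑL hϑu
      exact ev_box_transport hL hG hA₀ hA₀ hF₀ hF₀ g hϑ hgA hgz y)
    refine ⟨c, fun F A hA z hz hF y => ?_⟩
    obtain ⟨g, hg, hgA, hgz⟩ := Plane.exists_rigid_motion hn A₀ A hz₀ hz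
    obtain ⟨y, rfl⟩ := g.linearIsometryEquiv.surjective y
    rw [ev_box_transport hL hG hA₀ hA hF₀ hF g hg hgA hgz y, hc]
    refine Finset.sum_congr rfl fun i _ => ?_
    rw [← hgA, ← hgz, Plane.map_direction]
    congr 1
    exact ((τ i).covariant _ hg _ _ hz₀.2 y).symm
  · exact ⟨0, fun F A hA z hz hF => absurd ⟨F, A, hA, z, hz, hF⟩ hex⟩

/-- Test functions on the relatively open part of the bundle of a `k`-dimensional polytope, together
with two measures that represent `Γ`. -/
structure TestData (Γ : TMap n a) (k : ℕ) where
  F : Polytope n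
  A : Plane n k
  hA : A.1 = affineSpan ℝ F.1
  y : E n
  ν₁ : Measure (Sig n)
  ν₂ : Measure (Sig n)
  finite₁ : IsFiniteMeasure ν₁
  finite₂ : IsFiniteMeasure ν₂
  null₁ : ν₁ (F.1 ×ˢ perpSphere A.1.direction)ᶜ = 0
  null₂ : ν₂ (F.1 ×ˢ perpSphere A.1.direction)ᶜ = 0
  eq_sub : ∀ η : BorelSig n, η.1 ⊆ F.1 ×ˢ perpSphere A.1.direction →
    ev (Γ F η) y = ν₁.real η.1 - ν₂.real η.1
  g : Sig n → ℝ
  uniform : UniformContinuous g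
  bound : ∀ z, |g z| ≤ 1
  support : ∃ δ > 0, ∀ z ∈ A.bundle, g z ≠ 0 → Metric.ball z δ ∩ A.bundle ⊆ F.1 ×ˢ Set.univ

theorem measurableSet_prod_perpSphere (F : Polytope n) (L : Submodule ℝ (E n)) :
    MeasurableSet (F.1 ×ˢ perpSphere L) :=
  (F.2.isCompact.isClosed.prod (isClosed_perpSphere L)).measurableSet

theorem isCompact_prod_perpSphere (F : Polytope n) (L : Submodule ℝ (E n)) :
    IsCompact (F.1 ×ˢ perpSphere L) :=
  F.2.isCompact.prod (isClosed_perpSphere L).isCompact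

theorem continuous_field (i : I) (L : Submodule ℝ (E n)) (y : E n) :
    Continuous fun z : Sig n => ev ((τ i).toFun L z.2) y :=
  ((τ i).continuous L y).comp (continuous_snd (X := E n) (Y := Sph n))

theorem measureReal_ball_eq_box {A : Plane n k} {ν : Measure (Sig n)} (hν : ν A.bundleᶜ = 0)
    (z : Sig n) (ε : ℝ) : ν.real (Metric.ball z ε) = ν.real (box A z ε).1 := by
  refine measureReal_congr ?_
  have hb : ∀ᵐ z ∂ν, z ∈ A.bundle := hν
  filter_upwards [hb] with w hw
  exact propext ⟨fun h => ⟨h, hw⟩, fun h => h.1⟩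

/-- Averaging `g(z)` times the value of `Γ` on the box around `z`, divided by the mass `W ε`, tends
to the integral of `g` against the measure given by `Γ`. On the other hand the box values are known
combinations of the fields. -/
theorem TestData.tendsto (j : TestData Γ k) {c : ℝ → I → ℝ}
    (hc : ∀ ε, ∀ (F : Polytope n) (A : Plane n k),
      A.1 = affineSpan ℝ F.1 → ∀ z ∈ A.bundle, Metric.ball z ε ∩ A.bundle ⊆ F.1 ×ˢ Set.univ →
        ∀ y, ev (Γ F (box A z ε)) y = ∑ i ∈ s, c ε i * ev ((τ i).toFun A.1.direction z.2) y)
    {W : ℝ → ℝ} (hW0 : ∀ ε > 0, 0 < W ε)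
    (hW : ∀ ε > 0, ∀ A : Plane n k, ∀ z ∈ A.bundle, A.meas.real (Metric.ball z ε) = W ε) :
    Filter.Tendsto (fun N : ℕ => ∑ i ∈ s, c (1 / (N + 1)) i / W (1 / (N + 1)) *
      ∫ z in j.F.1 ×ˢ perpSphere j.A.1.direction,
        j.g z * ev ((τ i).toFun j.A.1.direction z.2) j.y ∂j.A.meas) Filter.atTop
      (nhds (∫ z, j.g z ∂j.ν₁ - ∫ z, j.g z ∂j.ν₂)) := by
  obtain ⟨F, A, hA, y, ν₁, ν₂, fin₁, fin₂, null₁, null₂, eq_sub, g, uniform, bound, δ, hδ, hg⟩ := j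
  simp only
  set X : Set (Sig n) := F.1 ×ˢ perpSphere A.1.direction with hXdef
  have hX : MeasurableSet X := measurableSet_prod_perpSphere F _
  have hXc : IsCompact X := isCompact_prod_perpSphere F _
  have hXf : A.meas X < ⊤ := hXc.measure_lt_top
  have hXb : X ⊆ A.bundle := by rw [hXdef, prod_perpSphere_eq F A hA]; exact Set.inter_subset_right
  have hgX : ∀ z ∈ A.bundle, g z ≠ 0 → z ∈ X := by
    intro z hz hgz
    rw [hXdef, prod_perpSphere_eq F A hA]
    exact ⟨hg z hz hgz ⟨Metric.mem_ball_self hδ, hz⟩, hz⟩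
  have hn₁ : ν₁ A.bundleᶜ = 0 := measure_mono_null (Set.compl_subset_compl.2 hXb) null₁
  have hn₂ : ν₂ A.bundleᶜ = 0 := measure_mono_null (Set.compl_subset_compl.2 hXb) null₂
  have hbmeas : ∀ ε : ℝ, ∀ ν : Measure (Sig n), IsFiniteMeasure ν →
      IntegrableOn (fun z => g z * ν.real (Metric.ball z ε)) X A.meas := by
    intro ε ν hν
    have hS : MeasurableSet {q : Sig n × Sig n | dist q.2 q.1 < ε} :=
      (isOpen_lt (by fun_prop) continuous_const).measurableSet
    have hm : Measurable fun z : Sig n => ν.real (Metric.ball z ε) :=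
      (measurable_measure_prodMk_left (ν := ν) hS).ennreal_toReal
    refine IntegrableOn.of_bound hXf
      (uniform.continuous.measurable.mul hm).aestronglyMeasurable (1 * ν.real Set.univ)
      (Filter.Eventually.of_forall fun z => ?_)
    rw [norm_mul, Real.norm_eq_abs, Real.norm_eq_abs, abs_of_nonneg measureReal_nonneg]
    exact mul_le_mul (bound z) (measureReal_mono (Set.subset_univ _)) measureReal_nonneg zero_le_one
  -- For `ε ≤ δ` the boxes around points where `g ≠ 0` stay inside `F`, so the box formula applies
  -- to all of them.
  have hI : ∀ ε, 0 < ε → ε ≤ δ → ∑ i ∈ s, c ε i / W ε *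
      ∫ z in X, g z * ev ((τ i).toFun A.1.direction z.2) y ∂A.meas =
      (W ε)⁻¹ * ((∫ z in X, g z * ν₁.real (Metric.ball z ε) ∂A.meas) -
        ∫ z in X, g z * ν₂.real (Metric.ball z ε) ∂A.meas) := by
    intro ε hε hεδ
    rw [← integral_sub (hbmeas ε ν₁ fin₁) (hbmeas ε ν₂ fin₂)]
    have h1 : ∫ z in X, (g z * ν₁.real (Metric.ball z ε) - g z * ν₂.real (Metric.ball z ε)) ∂A.meas =
        ∫ z in X, ∑ i ∈ s, c ε i * (g z * ev ((τ i).toFun A.1.direction z.2) y) ∂A.meas := by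
      refine setIntegral_congr_fun hX fun z hz => ?_
      by_cases hgz : g z = 0
      · simp [hgz]
      · have hzb := hXb hz
        have hball : Metric.ball z ε ∩ A.bundle ⊆ F.1 ×ˢ Set.univ :=
          (Set.inter_subset_inter_left _ (Metric.ball_subset_ball hεδ)).trans (hg z hzb hgz)
        have hsub : (box A z ε).1 ⊆ X := by
          rw [hXdef, prod_perpSphere_eq F A hA]
          exact fun w hw => ⟨hball hw, hw.2⟩
        have h2 := hc ε F A hA z hzb hball y
        rw [eq_sub _ hsub] at h2
        rw [measureReal_ball_eq_box hn₁, measureReal_ball_eq_box hn₂, ← mul_sub, h2, Finset.mul_sum]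
        exact Finset.sum_congr rfl fun i _ => by ring
    rw [h1, integral_finsetSum, Finset.mul_sum]
    · refine Finset.sum_congr rfl fun i _ => ?_
      rw [integral_const_mul]
      ring
    · intro i _
      exact ((uniform.continuous.mul (continuous_field i _ y)).continuousOn.integrableOn_compact
        hXc).const_mul _
  rw [Metric.tendsto_atTop]
  intro κ hκ
  set M : ℝ := ν₁.real Set.univ + ν₂.real Set.univ with hM
  have hM0 : 0 ≤ M := add_nonneg measureReal_nonneg measureReal_nonneg
  -- With this tolerance the total error is at most `ω M ≤ κ / 2`; the `+ 1` covers `M = 0`.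
  set ω : ℝ := κ / (M + 1) / 2 with hω
  have hω0 : 0 < ω := by positivity
  obtain ⟨δ', hδ', hg'⟩ := Metric.uniformContinuous_iff.1 uniform ω hω0
  obtain ⟨N₀, hN₀⟩ := exists_nat_one_div_lt (lt_min hδ hδ')
  refine ⟨N₀, fun N hN => ?_⟩
  have hεN : (1 : ℝ) / (N + 1) < min δ δ' := by
    refine lt_of_le_of_lt (one_div_le_one_div_of_le (by positivity) ?_) hN₀
    have : (N₀ : ℝ) ≤ N := by exact_mod_cast hN
    linarith
  set ε : ℝ := 1 / (N + 1) with hεdef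
  have hε : 0 < ε := by positivity
  rw [hI ε hε (hεN.le.trans (min_le_left _ _))]
  have hmod : ∀ z z', dist z z' < ε → |g z - g z'| ≤ ω := fun z z' h =>
    (hg' (h.trans (hεN.trans_le (min_le_right _ _)))).le
  have e1 := A.abs_integral_ball_sub_le ν₁ hn₁ hX hXf uniform.continuous bound hgX
    (hW ε hε A) hmod
  have e2 := A.abs_integral_ball_sub_le ν₂ hn₂ hX hXf uniform.continuous bound hgX
    (hW ε hε A) hmod
  set i1 := ∫ z in X, g z * ν₁.real (Metric.ball z ε) ∂A.meas
  set i2 := ∫ z in X, g z * ν₂.real (Metric.ball z ε) ∂A.meas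
  have hWp := hW0 ε hε
  rw [Real.dist_eq]
  have h3 : (W ε)⁻¹ * (i1 - i2) - (∫ z, g z ∂ν₁ - ∫ z, g z ∂ν₂) =
      (W ε)⁻¹ * ((i1 - W ε * ∫ z, g z ∂ν₁) - (i2 - W ε * ∫ z, g z ∂ν₂)) := by
    field_simp
    ring
  rw [h3, abs_mul, abs_of_pos (inv_pos.2 hWp)]
  have h4 : |(i1 - W ε * ∫ z, g z ∂ν₁) - (i2 - W ε * ∫ z, g z ∂ν₂)| ≤ W ε * (ω * M) := by
    refine (abs_sub _ _).trans ?_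
    rw [hM]
    linarith
  have h5 : (W ε)⁻¹ * |(i1 - W ε * ∫ z, g z ∂ν₁) - (i2 - W ε * ∫ z, g z ∂ν₂)| ≤ ω * M := by
    rw [inv_mul_le_iff₀ hWp]
    exact h4
  have h6 : ω * (M + 1) = κ / 2 := by
    rw [hω]
    field_simp
  nlinarith

/-- The coefficients at radius `ε` may diverge as `ε → 0`. All test data are therefore treated as
one function on `TestData Γ k`: the approximants lie in a fixed finite-dimensional space of such
functions, which is closed under pointwise limits. The limit has coefficients valid for every
polytope, plane, `y` and test function at once. -/
theorem exists_coeff_testData (hn : 2 ≤ n) (hL : IsLocallyDefined Γ) (hG : IsRigidCovariant Γ)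
    (hs : SpansInvariants k a s τ) : ∃ c : I → ℝ, ∀ j : TestData Γ k,
      ∫ z, j.g z ∂j.ν₁ - ∫ z, j.g z ∂j.ν₂ = ∑ i ∈ s, c i *
        ∫ z in j.F.1 ×ˢ perpSphere j.A.1.direction,
          j.g z * ev ((τ i).toFun j.A.1.direction z.2) j.y ∂j.A.meas := by
  classical
  choose c hc using exists_coeff_box hn hL hG hs
  have hex : ∀ ε : ℝ, ∃ W : ℝ, 0 < ε → 0 < W ∧ ∀ A : Plane n k, ∀ z ∈ A.bundle,
      A.meas.real (Metric.ball z ε) = W := by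
    intro ε
    by_cases hε : 0 < ε
    · obtain ⟨W, hW⟩ := Plane.exists_meas_ball_eq hn k hε
      exact ⟨W, fun _ => hW⟩
    · exact ⟨0, fun h => absurd h hε⟩
  choose W hW using hex
  let f : s → TestData Γ k → ℝ := fun i j => ∫ z in j.F.1 ×ˢ perpSphere j.A.1.direction,
          j.g z * ev ((τ i.1).toFun j.A.1.direction z.2) j.y ∂j.A.meas
  have hcl : IsClosed (Submodule.span ℝ (Set.range f) : Set (TestData Γ k → ℝ)) := by
    have : FiniteDimensional ℝ (Submodule.span ℝ (Set.range f)) :=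
      FiniteDimensional.span_of_finite ℝ (Set.finite_range f)
    exact Submodule.closed_of_finiteDimensional _
  have hmem : (fun j : TestData Γ k => ∫ z, j.g z ∂j.ν₁ - ∫ z, j.g z ∂j.ν₂) ∈
      Submodule.span ℝ (Set.range f) := by
    refine hcl.mem_of_tendsto (b := Filter.atTop) (f := fun N : ℕ => fun j => ∑ i ∈ s,
      c (1 / (N + 1)) i / W (1 / (N + 1)) *
      ∫ z in j.F.1 ×ˢ perpSphere j.A.1.direction,
        j.g z * ev ((τ i).toFun j.A.1.direction z.2) j.y ∂j.A.meas) ?_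
      (Filter.Eventually.of_forall fun N => ?_)
    · rw [tendsto_pi_nhds]
      intro j
      exact j.tendsto hc (fun ε hε => (hW ε hε).1) (fun ε hε => (hW ε hε).2)
    · have : (fun j : TestData Γ k => ∑ i ∈ s, c (1 / (N + 1)) i / W (1 / (N + 1)) *
          ∫ z in j.F.1 ×ˢ perpSphere j.A.1.direction,
            j.g z * ev ((τ i).toFun j.A.1.direction z.2) j.y ∂j.A.meas) =
          ∑ i : s, (c (1 / (N + 1)) i / W (1 / (N + 1))) • f i := by
        funext j
        rw [Finset.sum_apply, ← Finset.sum_coe_sort]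
        rfl
      rw [this]
      exact Submodule.sum_mem _ fun i _ => Submodule.smul_mem _ _ (Submodule.subset_span ⟨i, rfl⟩)
  rw [Submodule.mem_span_range_iff_exists_fun] at hmem
  obtain ⟨d, hd⟩ := hmem
  refine ⟨fun i => if h : i ∈ s then d ⟨i, h⟩ else 0, fun j => ?_⟩
  have h := congrFun hd j
  rw [Finset.sum_apply] at h
  rw [← h, ← Finset.sum_coe_sort s]
  refine Finset.sum_congr rfl fun i _ => ?_
  simp only [dif_pos i.2]
  rfl

end

/-! ### From test functions to Borel sets. -/

section

variable {n k a : ℕ} {Γ : TMap n a} {I : Type} {s : Finset I} {b : I → ℕ} {τ : ∀ i, TField n (b i)}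

/-- A compact part of the relative interior keeps a positive distance from the relative boundary.
This supplies the support condition for cut-off functions around `K`. -/
theorem exists_pos_forall_ball_subset {F : Polytope n} {A : Plane n k}
    (hA : A.1 = affineSpan ℝ F.1) {K : Set (Sig n)} (hK : IsCompact K)
    (hKF : K ⊆ relInt F.1 ×ˢ perpSphere A.1.direction) :
    ∃ δ > 0, ∀ z ∈ Metric.thickening δ K, Metric.ball z δ ∩ A.bundle ⊆ F.1 ×ˢ Set.univ := by
  obtain ⟨U, hU, hFU⟩ := exists_isOpen_relInt F.1
  have hKU : K ⊆ U ×ˢ Set.univ := fun z hz => ⟨by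
    have := (hKF hz).1
    rw [hFU] at this
    exact this.2, trivial⟩
  obtain ⟨δ, hδ, hδU⟩ := hK.exists_thickening_subset_open (hU.prod isOpen_univ) hKU
  refine ⟨δ / 2, half_pos hδ, fun z hz w hw => ⟨relInt_subset _ ?_, trivial⟩⟩
  rw [hFU]
  refine ⟨by rw [← hA]; exact hw.2.1, ?_⟩
  refine (hδU (?_ : w ∈ Metric.thickening δ K)).1
  obtain ⟨v, hv, hzv⟩ := Metric.mem_thickening_iff.1 hz
  refine Metric.mem_thickening_iff.2 ⟨v, hv, ?_⟩
  have h1 : dist w z < δ / 2 := hw.1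
  linarith [dist_triangle w z v]

/-- The indicator of `K` is the pointwise limit of Lipschitz cut-offs, each an admissible test
function; dominated convergence passes to the limit on both sides. -/
theorem signedMeasure_isCompact_eq (c : I → ℝ) (hc : ∀ j : TestData Γ k,
      ∫ z, j.g z ∂j.ν₁ - ∫ z, j.g z ∂j.ν₂ = ∑ i ∈ s, c i *
        ∫ z in j.F.1 ×ˢ perpSphere j.A.1.direction,
          j.g z * ev ((τ i).toFun j.A.1.direction z.2) j.y ∂j.A.meas)
    (F : Polytope n) (A : Plane n k) (hA : A.1 = affineSpan ℝ F.1) (y : E n)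
    (μ : SignedMeasure (Sig n)) (hμ : ∀ η : BorelSig n, μ η.1 = ev (Γ F η) y)
    {K : Set (Sig n)} (hK : IsCompact K) (hKF : K ⊆ relInt F.1 ×ˢ perpSphere A.1.direction) :
    μ K = ∑ i ∈ s, c i * ∫ z in K, ev ((τ i).toFun A.1.direction z.2) y ∂A.meas := by
  obtain ⟨δ, hδ, hball⟩ := exists_pos_forall_ball_subset hA hK hKF
  set X : Set (Sig n) := F.1 ×ˢ perpSphere A.1.direction with hXdef
  have hX : MeasurableSet X := measurableSet_prod_perpSphere F _
  have hKX : K ⊆ X := hKF.trans (Set.prod_mono_left (relInt_subset _))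
  have hXc : IsCompact X := isCompact_prod_perpSphere F _
  have hXfin : IsFiniteMeasure (A.meas.restrict X) :=
    ⟨by rw [Measure.restrict_apply_univ]; exact hXc.measure_lt_top⟩
  let d : ℕ → ℝ := fun N => δ / (N + 1)
  have hd : ∀ N, 0 < d N := fun N => by positivity
  have hd' : ∀ N, d N ≤ δ := fun N => div_le_self hδ.le (by
    have : (0 : ℝ) ≤ N := Nat.cast_nonneg N
    linarith)
  have hdlim : Filter.Tendsto d Filter.atTop (nhds 0) :=
    (tendsto_const_div_atTop_nhds_zero_nat δ).comp (Filter.tendsto_add_atTop_nat 1) |>.congr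
      fun N => by simp [d]
  let g : ℕ → Sig n → ℝ := fun N z => (thickenedIndicator (hd N) K z : ℝ)
  have hgc : ∀ N, Continuous (g N) := fun N =>
    NNReal.continuous_coe.comp (thickenedIndicator (hd N) K).continuous
  have hg0 : ∀ N z, 0 ≤ g N z := fun N z => NNReal.coe_nonneg _
  have hg1 : ∀ N z, |g N z| ≤ 1 := fun N z => by
    rw [abs_of_nonneg (hg0 N z)]
    exact_mod_cast thickenedIndicator_le_one (hd N) K z
  have hgs : ∀ N z, g N z ≠ 0 → z ∈ Metric.thickening δ K := by
    intro N z hz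
    by_contra h
    refine hz ?_
    have h0 := thickenedIndicator_zero (hd N) K (x := z)
      (fun h' => h (Metric.thickening_mono (hd' N) K h'))
    change ((thickenedIndicator (hd N) K z : NNReal) : ℝ) = 0
    rw [h0, NNReal.coe_zero]
  have hglim : ∀ z, Filter.Tendsto (fun N => g N z) Filter.atTop
      (nhds (K.indicator (fun _ => (1 : ℝ)) z)) := by
    intro z
    have h1 := thickenedIndicator_tendsto_indicator_closure hd hdlim K
    rw [tendsto_pi_nhds] at h1
    have h2 := (NNReal.continuous_coe.tendsto _).comp (h1 z)
    rw [hK.isClosed.closure_eq] at h2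
    have h3 : ((K.indicator (fun _ => (1 : NNReal)) z : NNReal) : ℝ) =
        K.indicator (fun _ => (1 : ℝ)) z := by
      by_cases hz : z ∈ K <;> simp [hz]
    rw [h3] at h2
    exact h2
  -- Test data require finite measures concentrated on `X`; the restricted Jordan parts still
  -- represent `Γ` on subsets of `X`.
  let ν₁ := μ.toJordanDecomposition.posPart.restrict X
  let ν₂ := μ.toJordanDecomposition.negPart.restrict X
  have hreal : ∀ η ⊆ X, MeasurableSet η → μ η = ν₁.real η - ν₂.real η := by
    intro η hη hm
    rw [μ.apply_eq_posPart_real_sub_negPart_real hm, measureReal_restrict_apply hm,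
      measureReal_restrict_apply hm, Set.inter_eq_left.2 hη]
  have htest : ∀ N, ∫ z, g N z ∂ν₁ - ∫ z, g N z ∂ν₂ = ∑ i ∈ s, c i *
        ∫ z in X, g N z * ev ((τ i).toFun A.1.direction z.2) y ∂A.meas := fun N => hc
    { F := F, A := A, hA := hA, y := y, ν₁ := ν₁, ν₂ := ν₂
      finite₁ := inferInstance, finite₂ := inferInstance
      null₁ := by rw [Measure.restrict_apply hX.compl, Set.compl_inter_self, measure_empty]
      null₂ := by rw [Measure.restrict_apply hX.compl, Set.compl_inter_self, measure_empty]
      eq_sub := fun η hη => by rw [← hμ, hreal η.1 hη η.2]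
      g := g N
      uniform := uniformContinuous_subtype_val.comp
        (lipschitzWith_thickenedIndicator (hd N) K).uniformContinuous
      bound := hg1 N
      support := ⟨δ, hδ, fun z _ hz => hball z (hgs N z hz)⟩ }
  have hlim : ∀ (ν : Measure (Sig n)) (f : Sig n → ℝ), Integrable f ν →
      Filter.Tendsto (fun N => ∫ z, g N z * f z ∂ν) Filter.atTop (nhds (∫ z in K, f z ∂ν)) := by
    intro ν f hf
    rw [← integral_indicator hK.measurableSet]
    refine tendsto_integral_of_dominated_convergence (fun z => |f z|)
      (fun N => ((hgc N).aestronglyMeasurable).mul hf.1) hf.abs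
      (fun N => Filter.Eventually.of_forall fun z => ?_)
      (Filter.Eventually.of_forall fun z => ?_)
    · rw [norm_mul]
      exact mul_le_of_le_one_left (norm_nonneg _) (hg1 N z)
    · have := (hglim z).mul_const (f z)
      convert this using 2
      by_cases hz : z ∈ K <;> simp [hz]
  have hleft : Filter.Tendsto (fun N => ∫ z, g N z ∂ν₁ - ∫ z, g N z ∂ν₂) Filter.atTop
      (nhds (μ K)) := by
    have h1 := (hlim ν₁ (fun _ => 1) (integrable_const _)).sub
      (hlim ν₂ (fun _ => 1) (integrable_const _))
    simpa [← hreal K hKX hK.measurableSet] using h1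
  have hright : Filter.Tendsto (fun N => ∑ i ∈ s, c i *
        ∫ z in X, g N z * ev ((τ i).toFun A.1.direction z.2) y ∂A.meas) Filter.atTop
      (nhds (∑ i ∈ s, c i * ∫ z in K, ev ((τ i).toFun A.1.direction z.2) y ∂A.meas)) := by
    refine tendsto_finsetSum _ fun i _ => Filter.Tendsto.const_mul _ ?_
    have h1 := hlim (A.meas.restrict X) _
      ((continuous_field (τ := τ) i A.1.direction y).continuousOn.integrableOn_compact hXc)
    rwa [Measure.restrict_restrict hK.measurableSet, Set.inter_eq_left.2 hKX] at h1
  simp only [htest] at hleft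
  exact tendsto_nhds_unique hleft hright

theorem signedMeasure_face_eq (c : I → ℝ) (hc : ∀ j : TestData Γ k,
      ∫ z, j.g z ∂j.ν₁ - ∫ z, j.g z ∂j.ν₂ = ∑ i ∈ s, c i *
        ∫ z in j.F.1 ×ˢ perpSphere j.A.1.direction,
          j.g z * ev ((τ i).toFun j.A.1.direction z.2) j.y ∂j.A.meas)
    (F : Polytope n) (A : Plane n k) (hA : A.1 = affineSpan ℝ F.1) (y : E n)
    (μ : SignedMeasure (Sig n)) (hμ : ∀ η : BorelSig n, μ η.1 = ev (Γ F η) y)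
    {ζ : Set (Sig n)} (hζ : MeasurableSet ζ) (hζF : ζ ⊆ relInt F.1 ×ˢ perpSphere A.1.direction) :
    μ ζ = ∑ i ∈ s, c i * ∫ z in ζ, ev ((τ i).toFun A.1.direction z.2) y ∂A.meas := by
  obtain ⟨μ', hμ'⟩ := exists_signedMeasure_integral F {A}
    (fun A z => ∑ i ∈ s, c i * ev ((τ i).toFun A.1.direction z.2) y)
    (fun A => continuous_finsetSum _ fun i _ => (continuous_field i _ y).const_mul _)
  have h1 : ∀ η ⊆ relInt F.1 ×ˢ perpSphere A.1.direction, MeasurableSet η →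
      μ' η = ∑ i ∈ s, c i * ∫ z in η, ev ((τ i).toFun A.1.direction z.2) y ∂A.meas := by
    intro η hη hm
    have hηX := hη.trans (Set.prod_mono_left (relInt_subset _))
    rw [hμ' ⟨η, hm⟩, Finset.sum_singleton,
      Set.inter_eq_left.2 (hηX.trans (prod_perpSphere_subset_nor F A hA)), integral_finsetSum]
    · exact Finset.sum_congr rfl fun i _ => integral_const_mul _ _
    · intro i _
      exact (((continuous_field i _ y).continuousOn.integrableOn_compact
        (isCompact_prod_perpSphere F A.1.direction)).mono_set hηX).const_mul _
  have h2 : (μ - μ') ζ = 0 := by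
    refine signedMeasure_eq_zero_of_isCompact _ (fun K hK hKc => ?_) hζ hζF
    rw [sub_apply, h1 K hK hKc.measurableSet,
      signedMeasure_isCompact_eq c hc F A hA y μ hμ hKc hK, sub_self]
  rw [sub_apply, sub_eq_zero] at h2
  rw [h2, h1 ζ hζF hζ]

end

/-! ### Classification of the translation invariant mappings. -/

/-- Away from the origin, a locally defined, rigid motion covariant mapping whose values are measures is a linear
combination of the integrals of the fields that span the invariant tensors. -/
theorem ev_eq_sum_fieldMap_of_ne_zero {n a : ℕ} (hn : 2 ≤ n) {Γ : TMap n a} (hL : IsLocallyDefined Γ)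
    (hG : IsRigidCovariant Γ)
    (hM : ∀ P y, y ≠ 0 → ∃ μ : SignedMeasure (Sig n), ∀ η : BorelSig n, μ η.1 = ev (Γ P η) y)
    {I : Type} {b : I → ℕ} (τ : ∀ i, TField n (b i)) (κ : I → ℕ) (s : Finset I)
    (hs : ∀ k < n, SpansInvariants k a (s.filter fun i => κ i = k) τ) :
    ∃ c : I → ℝ, ∀ P η y, y ≠ 0 →
      ev (Γ P η) y = ∑ i ∈ s, c i * ev (fieldMap (κ i) 0 (τ i) P η) y := by
  classical
  have hex : ∀ k, ∃ c : I → ℝ, k < n → ∀ j : TestData Γ k,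
      ∫ z, j.g z ∂j.ν₁ - ∫ z, j.g z ∂j.ν₂ = ∑ i ∈ s.filter (fun i => κ i = k), c i *
        ∫ z in j.F.1 ×ˢ perpSphere j.A.1.direction,
          j.g z * ev ((τ i).toFun j.A.1.direction z.2) j.y ∂j.A.meas := by
    intro k
    by_cases hk : k < n
    · obtain ⟨c, hc⟩ := exists_coeff_testData hn hL hG (hs k hk)
      exact ⟨c, fun _ => hc⟩
    · exact ⟨0, fun h => absurd h hk⟩
  choose c hc using hex
  refine ⟨fun i => c (κ i) i, fun P η y hy => ?_⟩
  obtain ⟨μ, hμ⟩ := hM P y hy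
  have hμ₁ : ∃ μ₁ : SignedMeasure (Sig n), ∀ η : BorelSig n,
      μ₁ η.1 = ∑ i ∈ s, c (κ i) i * ev (fieldMap (κ i) 0 (τ i) P η) y := by
    have : ∀ i, ∃ μ₁ : SignedMeasure (Sig n), ∀ η : BorelSig n,
        μ₁ η.1 = ev (fieldMap (κ i) 0 (τ i) P η) y := by
      intro i
      obtain ⟨μ₁, h⟩ := exists_signedMeasure_integral P (facePlanes P (κ i)) (weight 0 (τ i) y)
        (continuous_weight 0 (τ i) y)
      exact ⟨μ₁, fun η => by rw [h, ev_fieldMap]⟩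
    choose μ₁ h₁ using this
    refine ⟨∑ i ∈ s, c (κ i) i • μ₁ i, fun η => ?_⟩
    rw [FunLike.coe_sum, Finset.sum_apply]
    exact Finset.sum_congr rfl fun i _ => by rw [← h₁]; rfl
  obtain ⟨μ₁, hμ₁⟩ := hμ₁
  rw [← hμ, ← hμ₁]
  suffices h : (μ - μ₁) η.1 = 0 by
    rwa [sub_apply, sub_eq_zero] at h
  -- `none` stands for the complement of the normal bundle, `some ⟨k, F⟩` for the part of the bundle
  -- over the relative interior of the face `F`.
  let t : Finset (Option (Σ _ : ℕ, Set (E n))) := insert none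
    (((Finset.range n).sigma fun k => (finite_faces P k).toFinset).image some)
  let B : Option (Σ _ : ℕ, Set (E n)) → Set (Sig n) := fun o =>
    o.elim (Nor P)ᶜ fun q => relInt q.2 ×ˢ normals P q.2
  refine signedMeasure_eq_zero_of_cover _ t B ?_ ?_ η.2 ?_
  · intro o ho
    match o with
    | none => exact (isClosed_nor P).measurableSet.compl
    | some q => exact (measurableSet_relInt q.2).prod (isClosed_normals P q.2).measurableSet
  · intro o ho ζ hζ hm
    rw [sub_apply, sub_eq_zero, hμ ⟨ζ, hm⟩, hμ₁ ⟨ζ, hm⟩]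
    match o with
    | none =>
      have h0 : ∀ {b : ℕ} (Γ : TMap n b), IsLocallyDefined Γ →
          (∃ μ : SignedMeasure (Sig n), ∀ η : BorelSig n, μ η.1 = ev (Γ P η) y) →
          ev (Γ P ⟨ζ, hm⟩) y = 0 := by
        intro b Γ hΓ hμ
        obtain ⟨μ, hμ⟩ := hμ
        rw [hΓ P P ⟨ζ, hm⟩ ⟨∅, MeasurableSet.empty⟩, ← hμ ⟨∅, MeasurableSet.empty⟩]
        · exact μ.empty
        · change ζ ∩ Nor P = ∅ ∩ Nor P
          rw [Set.empty_inter]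
          exact Set.disjoint_iff_inter_eq_empty.1 (Set.subset_compl_iff_disjoint_right.1 hζ)
      rw [h0 Γ hL ⟨μ, hμ⟩]
      refine (Finset.sum_eq_zero fun i _ => ?_).symm
      rw [h0 _ (fieldMap_isLocallyDefined (κ i) 0 (τ i)), mul_zero]
      obtain ⟨μ₁, h⟩ := exists_signedMeasure_integral P (facePlanes P (κ i)) (weight 0 (τ i) y)
        (continuous_weight 0 (τ i) y)
      exact ⟨μ₁, fun η => by rw [h, ev_fieldMap]⟩
    | some q =>
      obtain ⟨k, F⟩ := q
      have hkF : k < n ∧ F ∈ faces P k := by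
        simpa [t] using ho
      obtain ⟨hk, hF⟩ := hkF
      have hζ' : ζ ⊆ relInt F ×ˢ normals P F := hζ
      let A : Plane n k := facePlane hF
      have hA : A.1 = affineSpan ℝ F := rfl
      have hν : normals P F ⊆ perpSphere A.1.direction :=
        normals_subset_perpSphere P (face_subset hF) hF.1
      have hζA : ζ ⊆ relInt F ×ˢ perpSphere A.1.direction := hζ'.trans (Set.prod_mono_right hν)
      have hζN : ζ ⊆ Nor P := (hζ'.trans (Set.prod_mono_left (relInt_subset _))).trans
        (prod_normals_subset_nor P (face_subset hF) )
      have hζF : ζ ⊆ Nor ⟨F, face_isPolytope hF⟩ :=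
        (hζA.trans (Set.prod_mono_left (relInt_subset _))).trans
          (prod_perpSphere_subset_nor ⟨F, face_isPolytope hF⟩ A hA)
      have hζb : ζ ⊆ A.bundle := fun z hz =>
        ⟨by rw [hA]; exact subset_affineSpan ℝ F (relInt_subset _ (hζA hz).1), (hζA hz).2⟩
      -- Passage from `P` to the face as a polytope of its own: `ζ` lies in both normal bundles, so
      -- the values of `Γ` agree.
      obtain ⟨μF, hμF⟩ := hM ⟨F, face_isPolytope hF⟩ y hy
      have h1 := signedMeasure_face_eq (c k) (hc k hk) ⟨F, face_isPolytope hF⟩ A hA y μF hμF hm hζA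
      rw [hμF ⟨ζ, hm⟩, hL ⟨F, face_isPolytope hF⟩ P ⟨ζ, hm⟩ ⟨ζ, hm⟩ (by
        rw [Set.inter_eq_left.2 hζF, Set.inter_eq_left.2 hζN])] at h1
      rw [h1, Finset.sum_filter]
      refine Finset.sum_congr rfl fun i _ => ?_
      rw [ev_fieldMap_of_subset_bundle 0 (τ i) P A ⟨ζ, hm⟩ hζb hζN]
      split_ifs with hik
      · rw [hik]
        congr 1
        refine integral_congr_ae (Filter.Eventually.of_forall fun z => ?_)
        simp [weight]
      · rw [mul_zero]
  · intro z _
    simp only [Set.mem_iUnion]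
    by_cases hz : z ∈ Nor P
    · obtain ⟨k, hk, F, hF, hzF⟩ := exists_face_of_mem_nor hz
      exact ⟨some ⟨k, F⟩, by simp [t, hk, hF], hzF⟩
    · exact ⟨none, by simp [t], hz⟩

/-- A locally defined, rigid motion covariant mapping whose values are measures is a linear
combination of the integrals of the fields that span the invariant tensors. -/
theorem ev_eq_sum_fieldMap {n a : ℕ} (hn : 2 ≤ n) {Γ : TMap n a} (hL : IsLocallyDefined Γ)
    (hG : IsRigidCovariant Γ)
    (hM : ∀ P y, y ≠ 0 → ∃ μ : SignedMeasure (Sig n), ∀ η : BorelSig n, μ η.1 = ev (Γ P η) y)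
    {I : Type} {b : I → ℕ} (τ : ∀ i, TField n (b i)) (κ : I → ℕ) (s : Finset I)
    (hs : ∀ k < n, SpansInvariants k a (s.filter fun i => κ i = k) τ) :
    ∃ c : I → ℝ, ∀ P η y,
      ev (Γ P η) y = ∑ i ∈ s, c i * ev (fieldMap (κ i) 0 (τ i) P η) y := by
  obtain ⟨c, hc⟩ := ev_eq_sum_fieldMap_of_ne_zero hn hL hG hM τ κ s hs
  refine ⟨c, fun P η => congrFun ?_⟩
  have : Nontrivial (Fin n) := Fin.nontrivial_iff_two_le.2 hn
  exact Continuous.ext_on (dense_compl_singleton (0 : E n)) (continuous_ev _)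
    (continuous_finsetSum _ fun i _ => (continuous_ev _).const_mul _) fun y hy => hc P η y hy

/-! ### Polynomial dependence on translations -/

/-- The weights are those of the `q`-th forward difference divided by `q!`; it kills lower powers
and sends `x^q` to `1`. -/
theorem exists_finite_difference (q : ℕ) : ∃ w : ℕ → ℝ, ∀ j ≤ q, ∀ x : ℝ,
    ∑ i ∈ Finset.range (q + 1), w i * (x + i) ^ j = if j = q then 1 else 0 := by
  refine ⟨fun i => (q.factorial : ℝ)⁻¹ * ((-1) ^ (q - i) * q.choose i), fun j hj x => ?_⟩
  have h := fwdDiff_iter_eq_sum_shift (1 : ℝ) (fun r : ℝ => r ^ j) q x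
  have h1 : ∑ i ∈ Finset.range (q + 1), (q.factorial : ℝ)⁻¹ * ((-1) ^ (q - i) * q.choose i) *
      (x + i) ^ j = (q.factorial : ℝ)⁻¹ * ((fwdDiff (1 : ℝ))^[q] (fun r : ℝ => r ^ j)) x := by
    rw [h, Finset.mul_sum]
    refine Finset.sum_congr rfl fun i _ => ?_
    simp [mul_assoc]
  rw [h1]
  split_ifs with hjq
  · subst hjq
    rw [fwdDiff_iter_eq_factorial]
    have : (j.factorial : ℝ) ≠ 0 := by positivity
    simp [this]
  · rw [fwdDiff_iter_pow_eq_zero_of_lt (lt_of_le_of_ne hj hjq)]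
    simp

/-- The values `Γ(P + t, η + t)` depend on `t` as a polynomial of degree less than `q`. -/
def IsTranslationPolynomial {n p : ℕ} (Γ : TMap n p) (q : ℕ) : Prop :=
  ∃ Γ' : (j : ℕ) → TMap n (p - j), ∀ P η (t y : E n),
    ev (Γ (P.translate t) (η.translate t)) y =
      ∑ j ∈ Finset.range q, inner ℝ t y ^ j * ev (Γ' j P η) y

theorem ev_translationSum {n p q : ℕ} (hq : q ≤ p) (Γ' : (j : ℕ) → TMap n (p - j))
    (P : Polytope n) (η : BorelSig n) (t y : E n) : ev (translationSum hq Γ' P η t) y =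
      ∑ j ∈ Finset.range (q + 1), (j.factorial : ℝ)⁻¹ * (ev (Γ' j P η) y * inner ℝ t y ^ j) := by
  rw [translationSum, ev_sum, ← Fin.sum_univ_eq_sum_range (fun j => (j.factorial : ℝ)⁻¹ *
    (ev (Γ' j P η) y * inner ℝ t y ^ j))]
  refine Finset.sum_congr rfl fun j _ => ?_
  rw [ev_smul, ev_castRank, ev_symMul, ev_vecPow]

theorem IsTranslationCovariant.exists_isTranslationPolynomial {n p : ℕ} {Γ : TMap n p}
    (h : IsTranslationCovariant Γ) : ∃ q ≤ p + 1, IsTranslationPolynomial Γ q := by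
  obtain ⟨q, hq, Γ', -, hΓ⟩ := h
  -- `IsTranslationPolynomial` counts coefficients, so degree at most `q` becomes the bound `q + 1`;
  -- the factorials are absorbed into the coefficients.
  refine ⟨q + 1, Nat.succ_le_succ hq, fun j => (j.factorial : ℝ)⁻¹ • Γ' j, fun P η t y => ?_⟩
  rw [hΓ, ev_translationSum]
  refine Finset.sum_congr rfl fun j _ => ?_
  change _ = inner ℝ t y ^ j * ((j.factorial : ℝ)⁻¹ * ev (Γ' j P η) y)
  ring

theorem IsTranslationPolynomial.mono_of_eq_zero {n p q : ℕ} {Γ : TMap n p}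
    {Γ' : (j : ℕ) → TMap n (p - j)}
    (h : ∀ P η (t y : E n), ev (Γ (P.translate t) (η.translate t)) y =
      ∑ j ∈ Finset.range (q + 1), inner ℝ t y ^ j * ev (Γ' j P η) y)
    (h0 : ∀ P η y, ev (Γ' q P η) y = 0) : IsTranslationPolynomial Γ q :=
  ⟨Γ', fun P η t y => by rw [h, Finset.sum_range_succ, h0, mul_zero, add_zero]⟩

section

variable {n : ℕ}

theorem Polytope.translate_zero (P : Polytope n) : P.translate 0 = P := by
  apply Subtype.ext
  simp [Polytope.translate]

theorem BorelSig.translate_zero (η : BorelSig n) : η.translate 0 = η := by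
  apply Subtype.ext
  change translateSig 0 '' η.1 = η.1
  have : (translateSig (0 : E n) : Sig n → Sig n) = id := by
    funext z
    exact Prod.ext (add_zero z.1) rfl
  rw [this, Set.image_id]

theorem Polytope.translate_map (P : Polytope n) (g : E n ≃ᵃⁱ[ℝ] E n) (t : E n) :
    (P.map g).translate t =
      (P.translate (g.linearIsometryEquiv.symm (g 0) +
        g.linearIsometryEquiv.symm t)).rotate g.linearIsometryEquiv := by
  rw [Polytope.map_eq_translate_rotate]
  apply Subtype.ext
  change (fun x => x + t) '' ((fun x => x + g 0) '' (g.linearIsometryEquiv '' P.1)) =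
    g.linearIsometryEquiv '' ((fun x => x + _) '' P.1)
  simp only [Set.image_image]
  refine Set.image_congr fun x _ => ?_
  rw [map_add, map_add, LinearIsometryEquiv.apply_symm_apply, LinearIsometryEquiv.apply_symm_apply,
    add_assoc]

theorem BorelSig.translate_map (η : BorelSig n) (g : E n ≃ᵃⁱ[ℝ] E n) (t : E n) :
    (η.map g).translate t =
      (η.translate (g.linearIsometryEquiv.symm (g 0) +
        g.linearIsometryEquiv.symm t)).rotate g.linearIsometryEquiv := by
  rw [BorelSig.map_eq_translate_rotate]
  apply Subtype.ext
  change translateSig t '' (translateSig (g 0) '' (rotateSig g.linearIsometryEquiv '' η.1)) =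
    rotateSig g.linearIsometryEquiv '' (translateSig _ '' η.1)
  simp only [Set.image_image]
  refine Set.image_congr fun z _ => Prod.ext ?_ rfl
  change g.linearIsometryEquiv z.1 + g 0 + t = g.linearIsometryEquiv (z.1 +
    (g.linearIsometryEquiv.symm (g 0) + g.linearIsometryEquiv.symm t))
  rw [map_add, map_add, LinearIsometryEquiv.apply_symm_apply, LinearIsometryEquiv.apply_symm_apply,
    add_assoc]

theorem translate_inter_nor (P : Polytope n) (η : BorelSig n) (t : E n) :
    (η.translate t).1 ∩ Nor (P.translate t) = sigMap (shift t) '' (η.1 ∩ Nor P) := by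
  rw [Polytope.translate_eq_map, BorelSig.translate_eq_map, nor_map,
    Set.image_inter (sigMap (shift t)).injective]
  rfl

variable {p : ℕ} {Γ : TMap n p}

theorem IsMeasureValued.exists_signedMeasure_translate (h : IsMeasureValued Γ) (P : Polytope n)
    (t y : E n) : ∃ μ : SignedMeasure (Sig n), ∀ η : BorelSig n,
      μ η.1 = ev (Γ (P.translate t) (η.translate t)) y := by
  obtain ⟨μ, hμ⟩ := h (P.translate t)
  let l : Tensor n p →ₗ[ℝ] ℝ := (LinearMap.proj y).comp (evLinear n p)
  have hl : Continuous l.toAddMonoidHom := LinearMap.continuous_of_finiteDimensional l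
  refine ⟨(μ.mapRange l.toAddMonoidHom hl).map (translateSig t).symm, fun η => ?_⟩
  rw [VectorMeasure.map_apply _ (translateSig t).symm.continuous.measurable η.2,
    VectorMeasure.mapRange_apply, ← hμ]
  have : (translateSig t).symm ⁻¹' η.1 = translateSig t '' η.1 :=
    ((translateSig t).toEquiv.image_eq_preimage_symm η.1).symm
  rw [this]
  rfl

section top

variable {q : ℕ} {Γ' : (j : ℕ) → TMap n (p - j)}

/-- The leading coefficient is a finite difference. -/
theorem ev_leading_coeff {w : ℕ → ℝ} (hw : ∀ j ≤ q, ∀ x : ℝ,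
      ∑ i ∈ Finset.range (q + 1), w i * (x + i) ^ j = if j = q then 1 else 0)
    (h : ∀ P η (t y : E n), ev (Γ (P.translate t) (η.translate t)) y =
      ∑ j ∈ Finset.range (q + 1), inner ℝ t y ^ j * ev (Γ' j P η) y)
    (P : Polytope n) (η : BorelSig n) (t : E n) {y : E n} (hy : y ≠ 0) :
    ev (Γ' q P η) y = ∑ i ∈ Finset.range (q + 1), w i *
      ev (Γ (P.translate (t + ((i : ℝ) * (‖y‖ ^ 2)⁻¹) • y))
        (η.translate (t + ((i : ℝ) * (‖y‖ ^ 2)⁻¹) • y))) y := by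
  -- Steps of `y / ‖y‖²` increase `⟨t, y⟩` by exactly `1`; this is why `y ≠ 0` is needed.
  have h1 : ∀ i : ℕ, inner ℝ (t + ((i : ℝ) * (‖y‖ ^ 2)⁻¹) • y) y = inner ℝ t y + i := by
    intro i
    rw [inner_add_left, real_inner_smul_left, real_inner_self_eq_norm_sq]
    have : ‖y‖ ^ 2 ≠ 0 := by positivity
    field_simp
  simp only [h, h1, Finset.mul_sum]
  rw [Finset.sum_comm]
  have h2 : ∀ j ∈ Finset.range (q + 1), ∑ i ∈ Finset.range (q + 1), w i *
      ((inner ℝ t y + (i : ℝ)) ^ j * ev (Γ' j P η) y) = if j = q then ev (Γ' q P η) y else 0 := by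
    intro j hj
    simp only [← mul_assoc]
    rw [← Finset.sum_mul, hw j (Nat.lt_succ_iff.1 (Finset.mem_range.1 hj))]
    split_ifs with hjq
    · subst hjq
      rw [one_mul]
    · rw [zero_mul]
  rw [Finset.sum_congr rfl h2, Finset.sum_ite_eq' , if_pos (Finset.self_mem_range_succ q)]

/-- By `ev_leading_coeff` the coefficient is a combination of values of `Γ` on common translates of
`P` and `η`, and `η ∩ Nor P` determines its translates. At `y = 0` continuity is used. -/
theorem isLocallyDefined_leading_coeff
    (h : ∀ P η (t y : E n), ev (Γ (P.translate t) (η.translate t)) y =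
      ∑ j ∈ Finset.range (q + 1), inner ℝ t y ^ j * ev (Γ' j P η) y)
    (hn : 0 < n) (hL : IsLocallyDefined Γ) :
    IsLocallyDefined (Γ' q) := by
  obtain ⟨w, hw⟩ := exists_finite_difference q
  intro P P' η η' hη
  refine eq_of_ev_eq_of_ne_zero hn fun y hy => ?_
  rw [ev_leading_coeff hw h P η 0 hy, ev_leading_coeff hw h P' η' 0 hy]
  refine Finset.sum_congr rfl fun i _ => ?_
  rw [hL _ (P'.translate _) _ (η'.translate _)]
  rw [translate_inter_nor, translate_inter_nor, hη]

/-- The base point `t` in `ev_leading_coeff` is free. Choosing it as `ϑ⁻¹(g 0)` absorbs the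
translation part of `g`, and rotation covariance of `Γ` does the rest. -/
theorem isRigidCovariant_leading_coeff
    (h : ∀ P η (t y : E n), ev (Γ (P.translate t) (η.translate t)) y =
      ∑ j ∈ Finset.range (q + 1), inner ℝ t y ^ j * ev (Γ' j P η) y)
    (hS : IsSOCovariant Γ) (hn : 2 ≤ n) :
    IsRigidCovariant (Γ' q) := by
  obtain ⟨w, hw⟩ := exists_finite_difference q
  intro g hg P η
  have : Nontrivial (Fin n) := Fin.nontrivial_iff_two_le.2 hn
  refine congrFun (Continuous.ext_on (dense_compl_singleton (0 : E n))
    ((continuous_ev _).comp g.linearIsometryEquiv.continuous) (continuous_ev _) fun y hy => ?_)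
  have hgy : g.linearIsometryEquiv y ≠ 0 := fun h => hy (g.linearIsometryEquiv.map_eq_zero_iff.1 h)
  change ev (Γ' q (P.map g) (η.map g)) (g.linearIsometryEquiv y) = _
  rw [ev_leading_coeff hw h (P.map g) (η.map g) 0 hgy,
    ev_leading_coeff hw h P η (g.linearIsometryEquiv.symm (g 0)) hy]
  refine Finset.sum_congr rfl fun i _ => ?_
  rw [zero_add, Polytope.translate_map, BorelSig.translate_map, hS _ hg, ev_rotTensor,
    map_smul, LinearIsometryEquiv.symm_apply_apply, LinearIsometryEquiv.norm_map]

theorem exists_signedMeasure_leading_coeff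
    (h : ∀ P η (t y : E n), ev (Γ (P.translate t) (η.translate t)) y =
      ∑ j ∈ Finset.range (q + 1), inner ℝ t y ^ j * ev (Γ' j P η) y)
    (hM : IsMeasureValued Γ) (P : Polytope n) (y : E n)
    (hy : y ≠ 0) : ∃ μ : SignedMeasure (Sig n), ∀ η : BorelSig n, μ η.1 = ev (Γ' q P η) y := by
  obtain ⟨w, hw⟩ := exists_finite_difference q
  choose μ hμ using fun i : ℕ => hM.exists_signedMeasure_translate P
    (0 + ((i : ℝ) * (‖y‖ ^ 2)⁻¹) • y) y
  refine ⟨∑ i ∈ Finset.range (q + 1), w i • μ i, fun η => ?_⟩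
  rw [ev_leading_coeff hw h P η 0 hy, FunLike.coe_sum, Finset.sum_apply]
  exact Finset.sum_congr rfl fun i _ => by rw [← hμ]; rfl

end top

end

/-! ### Bases of the space of local tensor mappings -/

theorem ev_castMap {n a b : ℕ} (h : a = b) (Γ : TMap n a) (P : Polytope n) (η : BorelSig n)
    (y : E n) : ev (castMap h Γ P η) y = ev (Γ P η) y := ev_castRank h _ y

theorem ev_sum_smul_apply {n a : ℕ} {I : Type*} (s : Finset I) (c : I → ℝ) (G : I → TMap n a)
    (P : Polytope n) (η : BorelSig n) (y : E n) :
    ev ((∑ i ∈ s, c i • G i) P η) y = ∑ i ∈ s, c i * ev (G i P η) y := by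
  rw [Finset.sum_apply, Finset.sum_apply, ev_sum]
  rfl

theorem fieldMap_translate_eq {n a p k r : ℕ} (hp : r + a = p) (τ : TField n a)
    (P : Polytope n) (η : BorelSig n) (t y : E n) :
    ev (castMap hp (fieldMap k r τ) (P.translate t) (η.translate t)) y =
      ∑ l ∈ Finset.range (r + 1), inner ℝ t y ^ l * ev ((fun l : ℕ =>
        if h : l ≤ r then (r.choose l : ℝ) • castMap (b := p - l) (by omega) (fieldMap k (r - l) τ)
        else (0 : TMap n (p - l))) l P η) y := by
  rw [ev_castMap, ev_fieldMap_translate]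
  refine Finset.sum_congr rfl fun l hl => ?_
  have hlr : l ≤ r := Nat.lt_succ_iff.1 (Finset.mem_range.1 hl)
  simp only [dif_pos hlr]
  change _ = inner ℝ t y ^ l * ((r.choose l : ℝ) * ev (castMap _ (fieldMap k (r - l) τ) P η) y)
  rw [ev_castMap]
  ring

theorem castMap_fieldMap_mem {n a p k r : ℕ} (hp : r + a = p) (τ : TField n a) :
    castMap hp (fieldMap k r τ) ∈ localTensorSpace n p := by
  refine ⟨?_, ⟨⟨r, by omega, fun l => if h : l ≤ r then (l.factorial : ℝ) • ((r.choose l : ℝ) •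
    castMap (b := p - l) (by omega) (fieldMap k (r - l) τ)) else (0 : TMap n (p - l)), ?_, ?_⟩, ?_⟩,
    ?_⟩
  · subst hp
    exact fieldMap_isMeasureValued k r τ
  · subst hp
    simp
  · intro P η t
    apply ev_injective
    funext y
    rw [fieldMap_translate_eq, ev_translationSum]
    refine Finset.sum_congr rfl fun l hl => ?_
    have hlr : l ≤ r := Nat.lt_succ_iff.1 (Finset.mem_range.1 hl)
    simp only [dif_pos hlr]
    change inner ℝ t y ^ l * ((r.choose l : ℝ) * ev (castMap _ (fieldMap k (r - l) τ) P η) y) =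
      (l.factorial : ℝ)⁻¹ * ((l.factorial : ℝ) * ((r.choose l : ℝ) *
        ev (castMap _ (fieldMap k (r - l) τ) P η) y) * inner ℝ t y ^ l)
    have : (l.factorial : ℝ) ≠ 0 := by positivity
    field_simp
  · subst hp
    exact fieldMap_isSOCovariant k r τ
  · subst hp
    exact fieldMap_isLocallyDefined k r τ

section

variable {n p : ℕ} {I : Type} [Fintype I] {b : I → ℕ} {τ : ∀ i, TField n (b i)}
  {κ r : I → ℕ} {hp : ∀ i, r i + b i = p}

/-- The coefficient of degree `q` is a combination of integrals without the factor `x^q`. The same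
combination `Δ` of the mappings with `r = q` has this leading coefficient, so `Γ - Δ` has smaller
degree and induction applies. -/
theorem mem_span_of_isTranslationPolynomial (hn : 2 ≤ n)
    (hs : ∀ q ≤ p, ∀ k < n,
      SpansInvariants k (p - q) ((Finset.univ.filter fun i => r i = q).filter fun i => κ i = k) τ)
    (q : ℕ) (hq : q ≤ p + 1) (Γ : TMap n p) (hΓ : Γ ∈ localTensorSpace n p)
    (hpoly : IsTranslationPolynomial Γ q) :
    Γ ∈ Submodule.span ℝ (Set.range fun i => castMap (hp i) (fieldMap (κ i) (r i) (τ i))) := by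
  induction q generalizing Γ with
  | zero =>
    obtain ⟨Γ', h⟩ := hpoly
    have : Γ = 0 := by
      funext P η
      apply ev_injective
      funext y
      have := h P η 0 y
      rw [P.translate_zero, η.translate_zero] at this
      exact this.trans (by simp [ev_zero])
    rw [this]
    exact Submodule.zero_mem _
  | succ q ih =>
    obtain ⟨Γ', h⟩ := hpoly
    obtain ⟨hM, ⟨hT, hS⟩, hL⟩ := hΓ
    obtain ⟨c, hc⟩ := ev_eq_sum_fieldMap hn
      (isLocallyDefined_leading_coeff h (by omega) hL) (isRigidCovariant_leading_coeff h hS hn)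
      (exists_signedMeasure_leading_coeff h hM) τ κ (Finset.univ.filter fun i => r i = q)
      (hs q (by omega))
    set Δ : TMap n p := ∑ i ∈ Finset.univ.filter (fun i => r i = q),
      c i • castMap (hp i) (fieldMap (κ i) (r i) (τ i)) with hΔ
    have hΔs : Δ ∈ Submodule.span ℝ
        (Set.range fun i => castMap (hp i) (fieldMap (κ i) (r i) (τ i))) :=
      Submodule.sum_mem _ fun i _ => Submodule.smul_mem _ _ (Submodule.subset_span ⟨i, rfl⟩)
    have hΔm : Δ ∈ localTensorSpace n p :=
      Submodule.sum_mem _ fun i _ => Submodule.smul_mem _ _ (castMap_fieldMap_mem (hp i) (τ i))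
    have hevΔ : ∀ P η y, ev (Δ P η) y = ∑ i ∈ Finset.univ.filter (fun i => r i = q),
        c i * ev (castMap (hp i) (fieldMap (κ i) (r i) (τ i)) P η) y := by
      intro P η y
      rw [hΔ, ev_sum_smul_apply]
    have hsub : Γ - Δ ∈ Submodule.span ℝ
        (Set.range fun i => castMap (hp i) (fieldMap (κ i) (r i) (τ i))) := by
      let G : I → (l : ℕ) → TMap n (p - l) := fun i l =>
        if h : l ≤ r i then ((r i).choose l : ℝ) •
          castMap (b := p - l) (by have := hp i; omega) (fieldMap (κ i) (r i - l) (τ i))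
        else (0 : TMap n (p - l))
      refine ih (by omega) (Γ - Δ) (Submodule.sub_mem _ ⟨hM, ⟨hT, hS⟩, hL⟩ hΔm)
        (IsTranslationPolynomial.mono_of_eq_zero (Γ' := fun l => Γ' l -
          ∑ i ∈ Finset.univ.filter (fun i => r i = q), c i • G i l) ?_ ?_)
      · intro P η t y
        have h1 : ∀ l ∈ Finset.range (q + 1), inner ℝ t y ^ l * ev ((Γ' l -
            ∑ i ∈ Finset.univ.filter (fun i => r i = q), c i • G i l) P η) y =
            inner ℝ t y ^ l * ev (Γ' l P η) y - ∑ i ∈ Finset.univ.filter (fun i => r i = q),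
              c i * (inner ℝ t y ^ l * ev (G i l P η) y) := by
          intro l _
          change inner ℝ t y ^ l * (ev (Γ' l P η) y -
            ev ((∑ i ∈ Finset.univ.filter (fun i => r i = q), c i • G i l) P η) y) = _
          rw [ev_sum_smul_apply, mul_sub, Finset.mul_sum]
          exact congrArg _ (Finset.sum_congr rfl fun i _ => by ring)
        change ev (Γ (P.translate t) (η.translate t)) y - ev (Δ (P.translate t) (η.translate t)) y = _
        rw [Finset.sum_congr rfl h1, Finset.sum_sub_distrib, ← h, hevΔ, Finset.sum_comm]
        refine congrArg _ (Finset.sum_congr rfl fun i hi => ?_)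
        have hri := (Finset.mem_filter.1 hi).2
        subst hri
        rw [fieldMap_translate_eq, Finset.mul_sum]
      · intro P η y
        change ev (Γ' q P η) y -
          ev ((∑ i ∈ Finset.univ.filter (fun i => r i = q), c i • G i q) P η) y = 0
        rw [ev_sum_smul_apply, hc, sub_eq_zero]
        refine Finset.sum_congr rfl fun i hi => ?_
        have hri := (Finset.mem_filter.1 hi).2
        subst hri
        simp only [G, dif_pos le_rfl, Nat.choose_self, Nat.cast_one, one_smul, ev_castMap]
        congr 1
        have : r i - r i = 0 := Nat.sub_self _
        rw [this]
    have := Submodule.add_mem _ hsub hΔs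
    rwa [sub_add_cancel] at this

/-- Values of the mappings on small subsets of normal bundles determine the integrands. -/
theorem sum_weight_eq_zero (c : I → ℝ)
    (hc : ∀ P η y, ∑ i, c i * ev (fieldMap (κ i) (r i) (τ i) P η) y = 0) {k : ℕ} (A : Plane n k)
    {z : Sig n} (hz : z ∈ A.bundle) (y : E n) :
    ∑ i ∈ Finset.univ.filter (fun i => κ i = k), c i * weight (r i) (τ i) y A z = 0 := by
  by_contra hne
  obtain ⟨F, hF, hA, hx⟩ := exists_polytope_mem_relInt A hz.1
  obtain ⟨V, hV, hFV⟩ := exists_isOpen_relInt F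
  set h : Sig n → ℝ := fun z =>
    ∑ i ∈ Finset.univ.filter (fun i => κ i = k), c i * weight (r i) (τ i) y A z with hh
  have hcont : Continuous h :=
    continuous_finsetSum _ fun i _ => (continuous_weight (r i) (τ i) y A).const_mul _
  have hU : IsOpen ({w | h w ≠ 0} ∩ V ×ˢ Set.univ) :=
    (isOpen_ne_fun hcont continuous_const).inter (hV.prod isOpen_univ)
  have hzV : z.1 ∈ V := by
    rw [hFV] at hx
    exact hx.2
  obtain ⟨ε, hε, hball⟩ := Metric.isOpen_iff.1 hU z ⟨hne, hzV, trivial⟩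
  have hsub : (box A z ε).1 ⊆ Nor ⟨F, hF⟩ := by
    intro w hw
    refine prod_perpSphere_subset_nor ⟨F, hF⟩ A hA.symm ⟨relInt_subset F ?_, hw.2.2⟩
    rw [hFV]
    exact ⟨by rw [hA]; exact hw.2.1, (hball hw.1).2.1⟩
  have hfin : A.meas (box A z ε).1 < ⊤ :=
    (measure_mono Set.inter_subset_left).trans_lt (A.meas_ball_lt_top z ε)
  have hint : ∀ f : Sig n → ℝ, Continuous f → IntegrableOn f (box A z ε).1 A.meas :=
    fun f hf => (integrableOn_nor A ⟨F, hF⟩ hf).mono_set hsub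
  -- Every Borel subset of the box may be taken for `η`, and there only the plane `A` contributes;
  -- so all integrals of `h` vanish. As `h ≠ 0` on the box, the box would be null, contradicting the
  -- positivity of balls.
  have hae : h =ᵐ[A.meas.restrict (box A z ε).1] 0 := by
    refine Integrable.ae_eq_zero_of_forall_setIntegral_eq_zero (hint h hcont) fun ζ hζ _ => ?_
    have h1 := hc ⟨F, hF⟩ ⟨ζ ∩ (box A z ε).1, hζ.inter (box A z ε).2⟩ y
    rw [Measure.restrict_restrict hζ, integral_finsetSum]
    · rw [Finset.sum_filter]
      refine Eq.trans ?_ h1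
      refine Finset.sum_congr rfl fun i _ => ?_
      rw [ev_fieldMap_of_subset_bundle (r i) (τ i) ⟨F, hF⟩ A
        ⟨ζ ∩ (box A z ε).1, hζ.inter (box A z ε).2⟩
        (Set.inter_subset_right.trans Set.inter_subset_right)
        (Set.inter_subset_right.trans hsub)]
      split_ifs
      · rw [integral_const_mul]
      · rw [mul_zero]
    · intro i _
      exact ((hint _ (continuous_weight (r i) (τ i) y A)).mono_set
        Set.inter_subset_right).const_mul _
  have h0 : A.meas (box A z ε).1 = 0 := by
    have h2 := (ae_restrict_iff' (box A z ε).2).1 hae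
    refine measure_mono_null (fun w hw => ?_) (ae_iff.1 h2)
    exact fun hw' => (hball hw.1).1 (hw' hw)
  have h3 : A.meas (Metric.ball z ε) = A.meas (box A z ε).1 := by
    refine measure_congr ?_
    have hb : ∀ᵐ w ∂A.meas, w ∈ A.bundle := A.meas_bundle_compl
    filter_upwards [hb] with w hw
    exact propext ⟨fun h => ⟨h, hw⟩, fun h => h.1⟩
  exact (A.meas_ball_pos hz hε).ne' (h3.trans h0)

/-- If the fields span the invariant tensors and are linearly independent together with powers of
a free variable, then the mappings belonging to them form a basis. -/
theorem isBasisOf_of_spans (hp : ∀ i, r i + b i = p) (hn : 2 ≤ n)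
    (hs : ∀ q ≤ p, ∀ k < n,
      SpansInvariants k (p - q) ((Finset.univ.filter fun i => r i = q).filter fun i => κ i = k) τ)
    (hi : ∀ (k : ℕ) (c : I → ℝ), (∀ (L : Submodule ℝ (E n)) (u : E n), Module.finrank ℝ L = k →
      u ∈ Lᗮ → ‖u‖ = 1 → ∀ x y : E n, ∑ i ∈ Finset.univ.filter (fun i => κ i = k),
        c i * (inner ℝ x y ^ r i * ev ((τ i).toFun L u) y) = 0) → ∀ i, κ i = k → c i = 0)
    (f : I → TMap n p) (d : I → ℝ) (hd : ∀ i, d i ≠ 0)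
    (hf : ∀ i P η y, ev (f i P η) y = d i * ev (fieldMap (κ i) (r i) (τ i) P η) y) :
    IsBasisOf f (localTensorSpace n p) := by
  have hf' : ∀ i, f i = d i • castMap (hp i) (fieldMap (κ i) (r i) (τ i)) := by
    intro i
    funext P η
    apply ev_injective
    funext y
    rw [hf]
    change _ = d i * ev (castMap (hp i) (fieldMap (κ i) (r i) (τ i)) P η) y
    rw [ev_castMap]
  have hfm : ∀ i, f i ∈ localTensorSpace n p := fun i => by
    rw [hf']
    exact Submodule.smul_mem _ _ (castMap_fieldMap_mem (hp i) (τ i))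
  let v : I → localTensorSpace n p := fun i => ⟨f i, hfm i⟩
  have hli : LinearIndependent ℝ v := by
    rw [Fintype.linearIndependent_iff]
    intro c hc i
    have h0 : ∀ P η y, ∑ i, (c i * d i) * ev (fieldMap (κ i) (r i) (τ i) P η) y = 0 := by
      intro P η y
      have h1 : (∑ i, c i • f i) = 0 := by
        have := congrArg Subtype.val hc
        simpa [v] using this
      have h2 := ev_sum_smul_apply Finset.univ c f P η y
      rw [h1] at h2
      simp only [hf] at h2
      rw [← (h2.symm.trans (ev_zero y))]
      exact Finset.sum_congr rfl fun i _ => by ring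
    have h3 := hi (κ i) (fun i => c i * d i) (fun L u hL hu hu1 x y => ?_) i rfl
    · exact (mul_eq_zero.1 h3).resolve_right (hd i)
    · let A : Plane n (κ i) := ⟨AffineSubspace.mk' x L, ⟨x, AffineSubspace.self_mem_mk' x L⟩, by
        rw [AffineSubspace.direction_mk', hL]⟩
      have hAL : A.1.direction = L := AffineSubspace.direction_mk' x L
      have h4 := sum_weight_eq_zero (fun i => c i * d i) h0 A
        (z := (x, ⟨u, by simpa using hu1⟩)) ⟨AffineSubspace.self_mem_mk' x L, by
          change u ∈ A.1.directionᗮ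
          rw [hAL]; exact hu⟩ y
      simp only [weight, hAL] at h4
      exact h4
  have hspan : ⊤ ≤ Submodule.span ℝ (Set.range v) := by
    rintro ⟨Γ, hΓ⟩ -
    obtain ⟨q, hq, hpoly⟩ := hΓ.2.1.1.exists_isTranslationPolynomial
    have h1 := mem_span_of_isTranslationPolynomial (hp := hp) hn hs q hq Γ hΓ hpoly
    obtain ⟨c, hc⟩ := (Submodule.mem_span_range_iff_exists_fun ℝ).1 h1
    refine (Submodule.mem_span_range_iff_exists_fun ℝ).2 ⟨fun i => c i * (d i)⁻¹, ?_⟩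
    apply Subtype.ext
    refine Eq.trans ?_ hc
    simp only [v, AddSubmonoidClass.coe_finsetSum, Submodule.coe_smul]
    refine Finset.sum_congr rfl fun i _ => ?_
    rw [hf', smul_smul, inv_mul_cancel_right₀ (hd i)]
  exact ⟨Module.Basis.mk hli hspan, fun i => by rw [Module.Basis.mk_apply]⟩

end

/-! ### Spans of products of powers -/

section formSpan

variable {X : Type*}

/-- The span of the functions `h N^m A^j b^s` with `2m + 2j + s + d = p`. -/
def formSpan (h N A b : X → ℝ) (d p : ℕ) : Submodule ℝ (X → ℝ) :=
  Submodule.span ℝ {f | ∃ m j s : ℕ, 2 * m + 2 * j + s + d = p ∧ f = h * (N ^ m * A ^ j * b ^ s)}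

/-- Powers of `C`, the squared length in `restSpace`, are eliminated one at a time by means of the
relation. -/
theorem mem_formSpan {h N A b C : X → ℝ} {d p : ℕ} (hC : C = N - A - b ^ 2) (m i j l : ℕ)
    (hp : 2 * m + 2 * i + j + 2 * l + d = p) :
    h * (N ^ m * A ^ i * b ^ j * C ^ l) ∈ formSpan h N A b d p := by
  induction l generalizing m i j with
  | zero => exact Submodule.subset_span ⟨m, i, j, by omega, by rw [pow_zero, mul_one]⟩
  | succ l ih =>
    have h1 : h * (N ^ m * A ^ i * b ^ j * C ^ (l + 1)) =
        h * (N ^ (m + 1) * A ^ i * b ^ j * C ^ l) - h * (N ^ m * A ^ (i + 1) * b ^ j * C ^ l) -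
          h * (N ^ m * A ^ i * b ^ (j + 2) * C ^ l) := by
      rw [pow_succ C, hC]
      ring
    rw [h1]
    exact Submodule.sub_mem _ (Submodule.sub_mem _ (ih _ _ _ (by omega)) (ih _ _ _ (by omega)))
      (ih _ _ _ (by omega))

/-- The number of indices that are mapped to `i`. -/
def fiberCard {p : ℕ} (r : Fin p → Fin 3) (i : Fin 3) : ℕ := (Finset.univ.filter fun j => r j = i).card

theorem fiberCard_add {p : ℕ} (r : Fin p → Fin 3) :
    fiberCard r 0 + fiberCard r 1 + fiberCard r 2 = p := by
  have h := Finset.card_eq_sum_card_fiberwise (f := r) (s := Finset.univ) (t := Finset.univ)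
    (fun _ _ => Finset.mem_coe.2 (Finset.mem_univ _))
  rw [Finset.card_univ, Fintype.card_fin, Fin.sum_univ_three] at h
  exact h.symm

theorem ev_three {n p : ℕ} (T : Tensor n p) (e : Fin 3 → E n) (a b c : ℝ) :
    ev T (a • e 0 + b • e 1 + c • e 2) = ∑ r : Fin p → Fin 3, T.1 (fun j => e (r j)) *
      (a ^ fiberCard r 0 * b ^ fiberCard r 1 * c ^ fiberCard r 2) := by
  have h := ev_sum_smul T ![a, b, c] e
  rw [Fin.sum_univ_three] at h
  refine h.trans (Finset.sum_congr rfl fun r _ => ?_)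
  rw [mul_comm]
  congr 1
  rw [← Finset.prod_fiberwise' Finset.univ r, Fin.prod_univ_three]
  simp [Finset.prod_const, fiberCard]

variable {n p : ℕ} (T : Tensor n p) (e : Fin 3 → E n) {f N α β γ : X → ℝ}

/-- Averaging over independent signs of `α` and `γ` removes all monomials with an odd exponent of
either; then `γ²` is eliminated. -/
theorem mem_formSpan_of_even (hN : γ ^ 2 = N - α ^ 2 - β ^ 2)
    (hf : ∀ x (s t : ℝ), (s = 1 ∨ s = -1) → (t = 1 ∨ t = -1) →
      f x = ev T ((s * α x) • e 0 + β x • e 1 + (t * γ x) • e 2)) :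
    f ∈ formSpan 1 N (α ^ 2) β 0 p := by
  have h1 : f = ∑ r : Fin p → Fin 3, (T.1 (fun j => e (r j)) *
      ((1 + (-1) ^ fiberCard r 0) / 2) * ((1 + (-1) ^ fiberCard r 2) / 2)) •
      (α ^ fiberCard r 0 * β ^ fiberCard r 1 * γ ^ fiberCard r 2) := by
    funext x
    have h2 : f x = (1 / 4) * (ev T ((1 * α x) • e 0 + β x • e 1 + (1 * γ x) • e 2) +
        ev T ((1 * α x) • e 0 + β x • e 1 + (-1 * γ x) • e 2) +
        ev T ((-1 * α x) • e 0 + β x • e 1 + (1 * γ x) • e 2) +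
        ev T ((-1 * α x) • e 0 + β x • e 1 + (-1 * γ x) • e 2)) := by
      rw [← hf x 1 1 (Or.inl rfl) (Or.inl rfl), ← hf x 1 (-1) (Or.inl rfl) (Or.inr rfl),
        ← hf x (-1) 1 (Or.inr rfl) (Or.inl rfl), ← hf x (-1) (-1) (Or.inr rfl) (Or.inr rfl)]
      ring
    rw [h2]
    simp only [ev_three, Finset.sum_apply, Pi.smul_apply, Pi.mul_apply, Pi.pow_apply, smul_eq_mul,
      ← Finset.sum_add_distrib, Finset.mul_sum]
    refine Finset.sum_congr rfl fun r _ => ?_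
    simp only [mul_pow, one_mul]
    ring
  rw [h1]
  refine Submodule.sum_mem _ fun r _ => ?_
  have hr := fiberCard_add r
  rcases Nat.even_or_odd' (fiberCard r 0) with ⟨i, hi | hi⟩
  · rcases Nat.even_or_odd' (fiberCard r 2) with ⟨l, hl | hl⟩
    · refine Submodule.smul_mem _ _ ?_
      have h3 := mem_formSpan (h := 1) (d := 0) (p := p) hN 0 i (fiberCard r 1) l (by omega)
      rw [hi, hl, pow_mul, pow_mul]
      simpa using h3
    · rw [hl, pow_succ (-1 : ℝ), pow_mul]
      simp
  · rw [hi, pow_succ (-1 : ℝ), pow_mul]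
    simp

/-- Only a simultaneous change of sign is available, so the exponents of `α` and `γ` have equal
parity. If both are odd, one factor `αγ` splits off. -/
theorem mem_formSpan_of_neg (hN : γ ^ 2 = N - α ^ 2 - β ^ 2)
    (hf : ∀ x (s : ℝ), (s = 1 ∨ s = -1) →
      f x = ev T ((s * α x) • e 0 + β x • e 1 + (s * γ x) • e 2)) :
    f ∈ formSpan 1 N (α ^ 2) β 0 p ⊔ formSpan (α * γ) N (α ^ 2) β 2 p := by
  have h1 : f = ∑ r : Fin p → Fin 3, (T.1 (fun j => e (r j)) *
      ((1 + (-1) ^ (fiberCard r 0 + fiberCard r 2)) / 2)) •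
      (α ^ fiberCard r 0 * β ^ fiberCard r 1 * γ ^ fiberCard r 2) := by
    funext x
    have h2 : f x = (1 / 2) * (ev T ((1 * α x) • e 0 + β x • e 1 + (1 * γ x) • e 2) +
        ev T ((-1 * α x) • e 0 + β x • e 1 + (-1 * γ x) • e 2)) := by
      rw [← hf x 1 (Or.inl rfl), ← hf x (-1) (Or.inr rfl)]
      ring
    rw [h2]
    simp only [ev_three, Finset.sum_apply, Pi.smul_apply, Pi.mul_apply, Pi.pow_apply, smul_eq_mul,
      ← Finset.sum_add_distrib, Finset.mul_sum]
    refine Finset.sum_congr rfl fun r _ => ?_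
    simp only [mul_pow, one_mul]
    ring
  rw [h1]
  refine Submodule.sum_mem _ fun r _ => ?_
  have hr := fiberCard_add r
  rcases Nat.even_or_odd' (fiberCard r 0) with ⟨i, hi | hi⟩ <;>
    rcases Nat.even_or_odd' (fiberCard r 2) with ⟨l, hl | hl⟩
  · refine Submodule.smul_mem _ _ (Submodule.mem_sup_left ?_)
    have h3 := mem_formSpan (h := 1) (d := 0) (p := p) hN 0 i (fiberCard r 1) l (by omega)
    rw [hi, hl, pow_mul, pow_mul]
    simpa using h3
  · rw [hi, hl, ← add_assoc, pow_succ (-1 : ℝ), ← mul_add, pow_mul]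
    simp
  · rw [hi, hl, add_right_comm, pow_succ (-1 : ℝ), ← mul_add, pow_mul]
    simp
  · refine Submodule.smul_mem _ _ (Submodule.mem_sup_right ?_)
    have h3 := mem_formSpan (h := α * γ) (d := 2) (p := p) hN 0 i (fiberCard r 1) l (by omega)
    have h4 : α ^ fiberCard r 0 * β ^ fiberCard r 1 * γ ^ fiberCard r 2 =
        α * γ * (N ^ 0 * (α ^ 2) ^ i * β ^ fiberCard r 1 * (γ ^ 2) ^ l) := by
      rw [hi, hl]
      ring
    rwa [h4]

theorem mem_formSpan_of_two (hN : γ ^ 2 = N - β ^ 2)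
    (hf : ∀ x, f x = ev T (β x • e 1 + γ x • e 2)) :
    f ∈ formSpan 1 N 0 β 0 p ⊔ formSpan γ N 0 β 1 p := by
  have hN' : γ ^ 2 = N - 0 - β ^ 2 := by rw [hN, sub_zero]
  -- The three-term expansion is reused with coefficient `0` on `e 0`; only index maps avoiding `0`
  -- survive, by `0 ^ 0 = 1`.
  have h1 : f = ∑ r : Fin p → Fin 3, (T.1 (fun j => e (r j)) * 0 ^ fiberCard r 0) •
      (β ^ fiberCard r 1 * γ ^ fiberCard r 2) := by
    funext x
    have h2 : f x = ev T ((0 : ℝ) • e 0 + β x • e 1 + γ x • e 2) := by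
      rw [hf, zero_smul, zero_add]
    rw [h2]
    simp only [ev_three, Finset.sum_apply, Pi.smul_apply, Pi.mul_apply, Pi.pow_apply, smul_eq_mul]
    exact Finset.sum_congr rfl fun r _ => by ring
  rw [h1]
  refine Submodule.sum_mem _ fun r _ => ?_
  have hr := fiberCard_add r
  rcases Nat.eq_zero_or_pos (fiberCard r 0) with h0 | h0
  · refine Submodule.smul_mem _ _ ?_
    rcases Nat.even_or_odd' (fiberCard r 2) with ⟨l, hl | hl⟩
    · refine Submodule.mem_sup_left ?_
      have h3 := mem_formSpan (h := 1) (d := 0) (p := p) hN' 0 0 (fiberCard r 1) l (by omega)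
      rw [hl, pow_mul]
      simpa using h3
    · refine Submodule.mem_sup_right ?_
      have h3 := mem_formSpan (h := γ) (d := 1) (p := p) hN' 0 0 (fiberCard r 1) l (by omega)
      rw [hl, pow_succ, pow_mul]
      convert h3 using 1
      ring
  · rw [zero_pow h0.ne', mul_zero, zero_smul]
    exact Submodule.zero_mem _

theorem formSpan_le_of_pow_eq_zero {h N A b : X → ℝ} {d p : ℕ} (hA : A = 0) :
    formSpan h N A b d p ≤
      Submodule.span ℝ {f | ∃ m s : ℕ, 2 * m + s + d = p ∧ f = h * (N ^ m * b ^ s)} := by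
  refine Submodule.span_le.2 ?_
  rintro _ ⟨m, j, s, hp, rfl⟩
  rcases Nat.eq_zero_or_pos j with rfl | hj
  · exact Submodule.subset_span ⟨m, s, by omega, by rw [pow_zero, mul_one]⟩
  · rw [hA, zero_pow hj.ne', mul_zero, zero_mul, mul_zero]
    exact Submodule.zero_mem _

/-- The case `k = n - 1`: `L` and `u` span everything, so `‖π_L y‖²` is itself expressed by `N` and
`b`, and `j = 0` suffices. -/
theorem formSpan_le_of_eq_sub {h N A b : X → ℝ} {d p : ℕ} (hA : A = N - b ^ 2) :
    formSpan h N A b d p ≤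
      Submodule.span ℝ {f | ∃ m s : ℕ, 2 * m + s + d = p ∧ f = h * (N ^ m * b ^ s)} := by
  refine (Submodule.span_le.2 ?_ : _ ≤ formSpan h N 0 b d p).trans (formSpan_le_of_pow_eq_zero rfl)
  rintro _ ⟨m, j, s, hp, rfl⟩
  have h3 := mem_formSpan (h := h) (d := d) (p := p) (N := N) (A := 0) (b := b) (C := A)
    (by rw [hA, sub_zero]) m 0 s j (by omega)
  have h4 : h * (N ^ m * A ^ j * b ^ s) = h * (N ^ m * 0 ^ 0 * b ^ s * A ^ j) := by ring
  rw [h4]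
  exact h3

end formSpan

/-! ### Tensors invariant under stabilizers -/

/-- Supplies a normal form `±‖v‖ e` for vectors of `S`. For `S = ⊥` the witness is `0`, which keeps
degenerate dimensions out of later arguments. -/
theorem exists_mem_norm_mul {n : ℕ} (S : Submodule ℝ (E n)) :
    ∃ e ∈ S, ∀ v ∈ S, ∀ s : ℝ, (s = 1 ∨ s = -1) → ‖(s * ‖v‖) • e‖ = ‖v‖ := by
  by_cases hS : S = ⊥
  · refine ⟨0, S.zero_mem, fun v hv s _ => ?_⟩
    rw [hS, Submodule.mem_bot] at hv
    simp [hv]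
  · obtain ⟨z, hz, hz0⟩ := Submodule.exists_mem_ne_zero_of_ne_bot hS
    refine ⟨‖z‖⁻¹ • z, S.smul_mem _ hz, fun v hv s hs => ?_⟩
    have : ‖z‖ ≠ 0 := norm_ne_zero_iff.2 hz0
    rw [norm_smul, norm_smul, norm_inv, norm_norm, inv_mul_cancel₀ this, norm_mul, norm_norm]
    rcases hs with rfl | rfl <;> simp

theorem exists_mem_inner_eq_zero {n : ℕ} {S : Submodule ℝ (E n)} (hS : 2 ≤ Module.finrank ℝ S)
    (e : E n) : ∃ z ∈ S, z ≠ 0 ∧ inner ℝ z e = 0 := by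
  let l : S →ₗ[ℝ] ℝ := (innerSL ℝ e).toLinearMap.comp S.subtype
  have hl : LinearMap.ker l ≠ ⊥ := LinearMap.ker_ne_bot_of_finrank_lt (by
    rw [Module.finrank_self]; omega)
  obtain ⟨z, hz, hz0⟩ := Submodule.exists_mem_ne_zero_of_ne_bot hl
  refine ⟨z, z.2, fun h => hz0 (Subtype.ext h), ?_⟩
  rw [real_inner_comm]
  exact hz

section

variable {n a : ℕ} {L : Submodule ℝ (E n)} {u : E n} {T : Tensor n a}

/-- The orthogonal complement of the span of `L` and `u`. -/
noncomputable def restSpace (L : Submodule ℝ (E n)) (u : E n) : Submodule ℝ (E n) := Lᗮ ⊓ (ℝ ∙ u)ᗮ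

theorem mem_restSpace {x : E n} : x ∈ restSpace L u ↔ (∀ v ∈ L, inner ℝ v x = 0) ∧ inner ℝ u x = 0 := by
  rw [restSpace, Submodule.mem_inf, Submodule.mem_orthogonal,
    Submodule.mem_orthogonal_singleton_iff_inner_right]

/-- Reflections in `v - v'` and `w - w'` move `v` to `v'` and `w` to `w'` and fix `u`. Their product
may have determinant `-1`; the reflection in `z`, which fixes `v'`, `u` and `w'`, then corrects it.
-/
theorem ev_eq_of_norm_eq (hT : IsStabInvariant L u T) (hu : u ∈ Lᗮ)
    {v v' w w' z : E n} (hv : v ∈ L) (hv' : v' ∈ L) (hw : w ∈ restSpace L u)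
    (hw' : w' ∈ restSpace L u) (hvv : ‖v‖ = ‖v'‖) (hww : ‖w‖ = ‖w'‖) (hz : z ≠ 0)
    (hzL : z ∈ L ∨ z ∈ restSpace L u) (hzv : inner ℝ z v' = 0) (hzw : inner ℝ z w' = 0) (b : ℝ) :
    ev T (v + b • u + w) = ev T (v' + b • u + w') := by
  have h1 : v - v' ∈ L := L.sub_mem hv hv'
  have h2 : w - w' ∈ restSpace L u := Submodule.sub_mem _ hw hw'
  have h1' := hu _ h1
  have h2' := mem_restSpace.1 h2
  let ϑ := (refl (v - v')).trans (refl (w - w'))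
  have hϑL : L.map (ϑ.toLinearEquiv : E n →ₗ[ℝ] E n) = L := by
    rw [map_trans_eq, map_refl_of_mem (Or.inl h1), map_refl_of_mem (Or.inr h2.1)]
  have hϑu : ϑ u = u := by
    change refl (w - w') (refl (v - v') u) = u
    rw [refl_apply_of_inner_eq_zero h1', refl_apply_of_inner_eq_zero]
    rw [real_inner_comm]; exact h2'.2
  have hϑv : ϑ v = v' := by
    change refl (w - w') (refl (v - v') v) = v'
    rw [refl_sub hvv, refl_apply_of_inner_eq_zero]
    rw [real_inner_comm]; exact h2'.1 _ hv'
  have hϑw : ϑ w = w' := by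
    change refl (w - w') (refl (v - v') w) = w'
    rw [refl_apply_of_inner_eq_zero ((mem_restSpace.1 hw).1 _ h1), refl_sub hww]
  have hϑy : ϑ (v + b • u + w) = v' + b • u + w' := by
    rw [map_add, map_add, map_smul, hϑv, hϑu, hϑw]
  rcases isoDet_eq_one_or ϑ with hd | hd
  · rw [← hϑy, hT ϑ hd hϑL hϑu]
  · have hzu : inner ℝ z u = 0 := by
      rcases hzL with h | h
      · exact hu _ h
      · rw [real_inner_comm]; exact (mem_restSpace.1 h).2
    have h3 := hT (ϑ.trans (refl z)) (by rw [isoDet_trans, hd, isoDet_refl hz]; norm_num)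
      (by rw [map_trans_eq, hϑL, map_refl_of_mem (hzL.imp_right fun h => h.1)])
      (by
        change refl z (ϑ u) = u
        rw [hϑu, refl_apply_of_inner_eq_zero hzu]) (v + b • u + w)
    rw [← h3]
    change ev T (refl z (ϑ (v + b • u + w))) = _
    rw [hϑy, map_add, map_add, map_smul, refl_apply_of_inner_eq_zero hzv,
      refl_apply_of_inner_eq_zero hzu, refl_apply_of_inner_eq_zero hzw]

theorem sub_sub_mem_restSpace (hu : u ∈ Lᗮ) (hu1 : ‖u‖ = 1) (y : E n) :
    y - L.starProjection y - inner ℝ u y • u ∈ restSpace L u := by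
  rw [mem_restSpace]
  have h1 := L.sub_starProjection_mem_orthogonal y
  have h2 : inner ℝ u (L.starProjection y) = 0 := by
    rw [real_inner_comm]; exact hu _ (L.starProjection_apply_mem y)
  refine ⟨fun v hv => ?_, ?_⟩
  · rw [inner_sub_right, h1 v hv, real_inner_smul_right, hu v hv]
    simp
  · rw [inner_sub_right, inner_sub_right, real_inner_smul_right, real_inner_self_eq_norm_sq, hu1, h2]
    simp

theorem norm_sq_restSpace (hu : u ∈ Lᗮ) (hu1 : ‖u‖ = 1) (y : E n) :
    ‖y - L.starProjection y - inner ℝ u y • u‖ ^ 2 =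
      ‖y‖ ^ 2 - ‖L.starProjection y‖ ^ 2 - inner ℝ u y ^ 2 := by
  set w := y - L.starProjection y - inner ℝ u y • u with hw
  have hwm := mem_restSpace.1 (sub_sub_mem_restSpace hu hu1 y)
  rw [← hw] at hwm
  have hy : y = L.starProjection y + inner ℝ u y • u + w := by rw [hw]; abel
  have h2 := hwm.1 _ (L.starProjection_apply_mem y)
  have h3 := hu _ (L.starProjection_apply_mem y)
  have h4 : ‖L.starProjection y + inner ℝ u y • u + w‖ ^ 2 = ‖L.starProjection y‖ ^ 2 +
      inner ℝ u y ^ 2 + ‖w‖ ^ 2 := by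
    rw [norm_add_sq_real, norm_add_sq_real, inner_add_left, real_inner_smul_left,
      real_inner_smul_right, h2, h3, hwm.2, norm_smul, hu1, mul_pow, Real.norm_eq_abs, sq_abs]
    ring
  rw [← hy] at h4
  linarith

/-- A dimension of at least `2` in `L` or `restSpace L u` leaves room for the correcting vector `z`
orthogonal to both model vectors. Then each component of `y` may be replaced by its normal form with
an arbitrary sign. -/
theorem ev_mem_formSpan (hT : IsStabInvariant L u T) (hu : u ∈ Lᗮ) (hu1 : ‖u‖ = 1)
    (hd : 2 ≤ Module.finrank ℝ L ∨ 2 ≤ Module.finrank ℝ (restSpace L u)) :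
    ev T ∈ formSpan 1 (fun y => ‖y‖ ^ 2) (fun y => ‖L.starProjection y‖ ^ 2)
      (fun y => inner ℝ u y) 0 a := by
  obtain ⟨e, he, hev⟩ := exists_mem_norm_mul L
  obtain ⟨e', he', hew⟩ := exists_mem_norm_mul (restSpace L u)
  obtain ⟨z, hz, hzL, hze, hze'⟩ : ∃ z : E n, z ≠ 0 ∧ (z ∈ L ∨ z ∈ restSpace L u) ∧
      inner ℝ z e = 0 ∧ inner ℝ z e' = 0 := by
    rcases hd with hd | hd
    · obtain ⟨z, hz, hz0, hze⟩ := exists_mem_inner_eq_zero hd e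
      exact ⟨z, hz0, Or.inl hz, hze, (mem_restSpace.1 he').1 z hz⟩
    · obtain ⟨z, hz, hz0, hze⟩ := exists_mem_inner_eq_zero hd e'
      exact ⟨z, hz0, Or.inr hz, by rw [real_inner_comm]; exact (mem_restSpace.1 hz).1 e he, hze⟩
  refine mem_formSpan_of_even T ![e, u, e'] (N := fun y => ‖y‖ ^ 2)
    (α := fun y => ‖L.starProjection y‖) (β := fun y => inner ℝ u y)
    (γ := fun y => ‖y - L.starProjection y - inner ℝ u y • u‖) ?_ ?_
  · funext y
    exact norm_sq_restSpace hu hu1 y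
  · intro y s t hs ht
    have hw := sub_sub_mem_restSpace hu hu1 y
    have hv := L.starProjection_apply_mem y
    have h1 := ev_eq_of_norm_eq hT hu hv (L.smul_mem (s * ‖L.starProjection y‖) he) hw
      (Submodule.smul_mem _ (t * ‖y - L.starProjection y - inner ℝ u y • u‖) he')
      (hev _ hv s hs).symm (hew _ hw t ht).symm hz hzL
      (by rw [real_inner_smul_right, hze, mul_zero])
      (by rw [real_inner_smul_right, hze', mul_zero]) (inner ℝ u y)
    refine Eq.trans (congrArg (ev T) ?_) h1
    abel

end

/-! ### The covariant fields -/

theorem finrank_restSpace {n : ℕ} {L : Submodule ℝ (E n)} {u : E n} (hu : u ∈ Lᗮ) (hu1 : ‖u‖ = 1) :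
    Module.finrank ℝ L + 1 + Module.finrank ℝ (restSpace L u) = n := by
  have h1 : restSpace L u = (L ⊔ ℝ ∙ u)ᗮ := Submodule.inf_orthogonal L (ℝ ∙ u)
  have h2 : L ⊓ (ℝ ∙ u) = ⊥ := by
    rw [Submodule.eq_bot_iff]
    rintro x ⟨hx, hxu⟩
    obtain ⟨c, rfl⟩ := Submodule.mem_span_singleton.1 hxu
    have h3 := hu _ hx
    rw [real_inner_smul_left, real_inner_self_eq_norm_sq, hu1] at h3
    have : c = 0 := by simpa using h3
    rw [this, zero_smul]
  have h3 := Submodule.finrank_sup_add_finrank_inf_eq L (ℝ ∙ u)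
  have hu0 : u ≠ 0 := fun h => by simp [h] at hu1
  rw [h2, finrank_bot, finrank_span_singleton hu0, add_zero] at h3
  have h4 := (L ⊔ ℝ ∙ u).finrank_add_finrank_orthogonal
  rw [← h1, h3] at h4
  simpa using h4

theorem starProjection_map {n : ℕ} (L : Submodule ℝ (E n)) (ϑ : E n ≃ₗᵢ[ℝ] E n) (y : E n) :
    (L.map (ϑ.toLinearEquiv : E n →ₗ[ℝ] E n)).starProjection (ϑ y) = ϑ (L.starProjection y) := by
  refine Submodule.eq_starProjection_of_mem_orthogonal ⟨_, L.starProjection_apply_mem y, rfl⟩ ?_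
  rw [← map_sub, mem_orthogonal_map_iff]
  exact L.sub_starProjection_mem_orthogonal y

/-- The field `Q^m Q_L^j u^s`. -/
noncomputable def phiField (n m j s : ℕ) : TField n (2 * m + (2 * j + s)) where
  toFun L u := symMul (symPow (metricTensor n) m) (symMul (symPow (projTensor L) j) (vecPow u s))
  covariant ϑ hϑ L u hu y := by
    simp only [ev_symMul, ev_symPow, ev_metricTensor, ev_projTensor, ev_vecPow, starProjection_map,
      LinearIsometryEquiv.norm_map, LinearIsometryEquiv.inner_map_map]
  continuous L y := by
    simp only [ev_symMul, ev_symPow, ev_metricTensor, ev_projTensor, ev_vecPow]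
    fun_prop

theorem ev_phiField {n : ℕ} (m j s : ℕ) (L : Submodule ℝ (E n)) (u y : E n) :
    ev ((phiField n m j s).toFun L u) y =
      (‖y‖ ^ 2) ^ m * ((‖L.starProjection y‖ ^ 2) ^ j * inner ℝ u y ^ s) := by
  change ev (symMul (symPow (metricTensor n) m)
    (symMul (symPow (projTensor L) j) (vecPow u s))) y = _
  simp only [ev_symMul, ev_symPow, ev_metricTensor, ev_projTensor, ev_vecPow]

/-- Covariance of `ū` and of the vector product is reduced to this: their inner products with `y`
are determinants. -/
theorem det_basisFun_map {n : ℕ} (ϑ : E n ≃ₗᵢ[ℝ] E n) (v : Fin n → E n) :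
    (EuclideanSpace.basisFun (Fin n) ℝ).toBasis.det (fun i => ϑ (v i)) =
      isoDet ϑ * (EuclideanSpace.basisFun (Fin n) ℝ).toBasis.det v :=
  Module.Basis.det_comp _ (ϑ.toLinearEquiv : E n →ₗ[ℝ] E n) v

theorem inner_rotQuarter (u y : E 2) :
    inner ℝ (rotQuarter u) y = (EuclideanSpace.basisFun (Fin 2) ℝ).toBasis.det ![u, y] := by
  rw [Module.Basis.det_apply, Matrix.det_fin_two]
  simp [Module.Basis.toMatrix_apply, rotQuarter, PiLp.inner_apply, Fin.sum_univ_two]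
  ring

theorem inner_cross (v u y : E 3) :
    inner ℝ (cross v u) y = (EuclideanSpace.basisFun (Fin 3) ℝ).toBasis.det ![v, u, y] := by
  rw [Module.Basis.det_apply, Matrix.det_fin_three]
  simp [Module.Basis.toMatrix_apply, cross, crossProduct, PiLp.inner_apply, Fin.sum_univ_three]
  ring

theorem inner_rotQuarter_map (ϑ : E 2 ≃ₗᵢ[ℝ] E 2) (hϑ : isoDet ϑ = 1) (u y : E 2) :
    inner ℝ (rotQuarter (ϑ u)) (ϑ y) = inner ℝ (rotQuarter u) y := by
  have h := det_basisFun_map ϑ ![u, y]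
  rw [hϑ, one_mul] at h
  rw [inner_rotQuarter, inner_rotQuarter, ← h]
  congr 1
  funext i
  fin_cases i <;> rfl

theorem inner_cross_map (ϑ : E 3 ≃ₗᵢ[ℝ] E 3) (hϑ : isoDet ϑ = 1) (v u y : E 3) :
    inner ℝ (cross (ϑ v) (ϑ u)) (ϑ y) = inner ℝ (cross v u) y := by
  have h := det_basisFun_map ϑ ![v, u, y]
  rw [hϑ, one_mul] at h
  rw [inner_cross, inner_cross, ← h]
  congr 1
  funext i
  fin_cases i <;> rfl

theorem cross_neg_left (v u : E 3) : cross (-v) u = -cross v u := by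
  ext i
  fin_cases i <;> simp [cross, crossProduct]

theorem continuous_cross (v : E 3) : Continuous fun u : E 3 => cross v u := by
  unfold cross
  refine (PiLp.continuous_toLp 2 _).comp (continuous_pi fun i => ?_)
  fin_cases i <;> simp [crossProduct] <;> fun_prop

theorem continuous_rotQuarter : Continuous rotQuarter := by
  unfold rotQuarter
  refine (PiLp.continuous_toLp 2 _).comp (continuous_pi fun i => ?_)
  fin_cases i <;> simp <;> fun_prop

theorem unitVec_spec {n : ℕ} {L : Submodule ℝ (E n)} (h : Module.finrank ℝ L = 1) :
    unitVec L ∈ L ∧ ‖unitVec L‖ = 1 := by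
  rw [unitVec, dif_pos h]
  exact (exists_unit_vector L h).choose_spec

theorem unitVec_of_ne {n : ℕ} {L : Submodule ℝ (E n)} (h : Module.finrank ℝ L ≠ 1) :
    unitVec L = 0 := by
  rw [unitVec, dif_neg h]

theorem mem_iff_of_finrank_eq_one {n : ℕ} {L : Submodule ℝ (E n)} (h : Module.finrank ℝ L = 1)
    {x : E n} : x ∈ L ↔ ∃ c : ℝ, c • unitVec L = x := by
  have h1 : (ℝ ∙ unitVec L) = L := by
    refine Submodule.eq_of_le_of_finrank_eq
      ((Submodule.span_singleton_le_iff_mem _ _).2 (unitVec_spec h).1) ?_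
    rw [h, finrank_span_singleton]
    intro h0
    simpa [h0] using (unitVec_spec h).2
  rw [← Submodule.mem_span_singleton, h1]

/-- The chosen unit vector is equivariant only up to sign. This is enough, since `v_L` enters
`tildeThreeField` twice. -/
theorem unitVec_map {n : ℕ} (L : Submodule ℝ (E n)) (ϑ : E n ≃ₗᵢ[ℝ] E n) :
    unitVec (L.map (ϑ.toLinearEquiv : E n →ₗ[ℝ] E n)) = ϑ (unitVec L) ∨
      unitVec (L.map (ϑ.toLinearEquiv : E n →ₗ[ℝ] E n)) = ϑ (-unitVec L) := by
  have hf : Module.finrank ℝ (L.map (ϑ.toLinearEquiv : E n →ₗ[ℝ] E n)) = Module.finrank ℝ L :=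
    LinearEquiv.finrank_map_eq ϑ.toLinearEquiv L
  by_cases h : Module.finrank ℝ L = 1
  · obtain ⟨x, hx, hxe⟩ := (unitVec_spec (hf.trans h)).1
    obtain ⟨c, rfl⟩ := (mem_iff_of_finrank_eq_one h).1 hx
    have hn := (unitVec_spec (hf.trans h)).2
    have hxe' : ϑ (c • unitVec L) = unitVec (L.map (ϑ.toLinearEquiv : E n →ₗ[ℝ] E n)) := hxe
    rw [← hxe', ϑ.norm_map, norm_smul, (unitVec_spec h).2, mul_one, Real.norm_eq_abs] at hn
    rcases eq_or_eq_neg_of_abs_eq hn with rfl | rfl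
    · exact Or.inl (by rw [← hxe', one_smul])
    · exact Or.inr (by rw [← hxe', neg_smul, one_smul])
  · rw [unitVec_of_ne h, unitVec_of_ne (by rwa [hf])]
    exact Or.inl (map_zero ϑ).symm

/-- The field `Q^m Q_L^j v_L (v_L × u) u^s`. -/
noncomputable def tildeThreeField (m j s : ℕ) : TField 3 (2 * m + (2 * j + 1 + (1 + s))) where
  toFun L u := symMul (symPow (metricTensor 3) m)
    (symMul (symMul (symPow (projTensor L) j) (vecPow (unitVec L) 1))
      (symMul (vecPow (cross (unitVec L) u) 1) (vecPow u s)))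
  covariant ϑ hϑ L u hu y := by
    simp only [ev_symMul, ev_symPow, ev_metricTensor, ev_projTensor, ev_vecPow, starProjection_map,
      LinearIsometryEquiv.norm_map, LinearIsometryEquiv.inner_map_map]
    rcases unitVec_map L ϑ with h | h
    · rw [h, inner_cross_map ϑ hϑ, LinearIsometryEquiv.inner_map_map]
    · rw [h, inner_cross_map ϑ hϑ, LinearIsometryEquiv.inner_map_map, cross_neg_left,
        inner_neg_left, inner_neg_left]
      ring
  continuous L y := by
    simp only [ev_symMul, ev_symPow, ev_metricTensor, ev_projTensor, ev_vecPow]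
    have h := (continuous_cross (unitVec L)).comp (continuous_subtype_val (p := fun u : E 3 =>
      u ∈ Metric.sphere (0 : E 3) 1))
    have h' : Continuous fun u : Sph 3 => inner ℝ (cross (unitVec L) (u : E 3)) y :=
      h.inner continuous_const
    fun_prop

theorem ev_tildeThreeField (m j s : ℕ) (L : Submodule ℝ (E 3)) (u y : E 3) :
    ev ((tildeThreeField m j s).toFun L u) y =
      (‖y‖ ^ 2) ^ m * ((‖L.starProjection y‖ ^ 2) ^ j * inner ℝ (unitVec L) y *
        (inner ℝ (cross (unitVec L) u) y * inner ℝ u y ^ s)) := by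
  change ev (symMul (symPow (metricTensor 3) m)
    (symMul (symMul (symPow (projTensor L) j) (vecPow (unitVec L) 1))
      (symMul (vecPow (cross (unitVec L) u) 1) (vecPow u s)))) y = _
  simp only [ev_symMul, ev_symPow, ev_metricTensor, ev_projTensor, ev_vecPow, pow_one]

/-- The field `Q^m ū u^s`. -/
noncomputable def tildeTwoField (m s : ℕ) : TField 2 (2 * m + (1 + s)) where
  toFun _ u := symMul (symPow (metricTensor 2) m) (symMul (vecPow (rotQuarter u) 1) (vecPow u s))
  covariant ϑ hϑ L u hu y := by
    simp only [ev_symMul, ev_symPow, ev_metricTensor, ev_vecPow, LinearIsometryEquiv.norm_map,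
      LinearIsometryEquiv.inner_map_map, inner_rotQuarter_map ϑ hϑ]
  continuous L y := by
    simp only [ev_symMul, ev_symPow, ev_metricTensor, ev_vecPow]
    have h := continuous_rotQuarter.comp (continuous_subtype_val (p := fun u : E 2 =>
      u ∈ Metric.sphere (0 : E 2) 1))
    have h' : Continuous fun u : Sph 2 => inner ℝ (rotQuarter (u : E 2)) y :=
      h.inner continuous_const
    fun_prop

theorem ev_tildeTwoField (m s : ℕ) (L : Submodule ℝ (E 2)) (u y : E 2) :
    ev ((tildeTwoField m s).toFun L u) y =
      (‖y‖ ^ 2) ^ m * (inner ℝ (rotQuarter u) y * inner ℝ u y ^ s) := by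
  change ev (symMul (symPow (metricTensor 2) m)
    (symMul (vecPow (rotQuarter u) 1) (vecPow u s))) y = _
  simp only [ev_symMul, ev_symPow, ev_metricTensor, ev_vecPow, pow_one]

/-! ### Adapted orthonormal frames -/

theorem exists_orthonormalBasis_coe_eq {n : ℕ} {v : Fin n → E n} (hv : Orthonormal ℝ v) :
    ∃ b : OrthonormalBasis (Fin n) ℝ (E n), ⇑b = v := by
  obtain ⟨b, hb⟩ := Orthonormal.exists_orthonormalBasis_extension_of_card_eq (𝕜 := ℝ)
    (E := E n) (ι := Fin n) (by simp) (v := v) (s := Set.univ)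
    (hv.comp _ Subtype.val_injective)
  exact ⟨b, funext fun i => hb i trivial⟩

theorem norm_eq_one_of_sum_sq {n : ℕ} {u : E n} (h : ∑ i, u i ^ 2 = 1) : ‖u‖ = 1 := by
  rw [EuclideanSpace.norm_eq]
  simp [h]

theorem sum_sq_eq_one_of_norm {n : ℕ} {u : E n} (h : ‖u‖ = 1) : ∑ i, u i ^ 2 = 1 := by
  rw [EuclideanSpace.norm_eq] at h
  simpa using h

theorem orthonormal_rotQuarter {u : E 2} (hu : ‖u‖ = 1) : Orthonormal ℝ ![u, rotQuarter u] := by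
  have hr : ‖rotQuarter u‖ = 1 := by
    refine norm_eq_one_of_sum_sq ?_
    have h := sum_sq_eq_one_of_norm hu
    simp only [Fin.sum_univ_two] at h ⊢
    simp [rotQuarter]
    linarith
  have h0 : inner ℝ u (rotQuarter u) = 0 := by
    simp [rotQuarter, PiLp.inner_apply, Fin.sum_univ_two]
    ring
  refine ⟨fun i => by fin_cases i <;> simp [hu, hr], fun i j hij => ?_⟩
  fin_cases i <;> fin_cases j <;> first | exact absurd rfl hij | exact h0 | skip
  rw [real_inner_comm]
  exact h0

theorem orthonormal_cross {v u : E 3} (hv : ‖v‖ = 1) (hu : ‖u‖ = 1) (hvu : inner ℝ v u = 0) :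
    Orthonormal ℝ ![v, u, cross v u] := by
  have hc : ‖cross v u‖ = 1 := by
    refine norm_eq_one_of_sum_sq ?_
    have hu' := sum_sq_eq_one_of_norm hu
    have hv' := sum_sq_eq_one_of_norm hv
    rw [PiLp.inner_apply, Fin.sum_univ_three] at hvu
    simp only [Fin.sum_univ_three] at hu' hv' ⊢
    simp [cross, crossProduct] at hvu ⊢
    -- Lagrange's identity `‖v × u‖² = ‖v‖² ‖u‖² - ⟨v, u⟩²`.
    linear_combination (u 0 ^ 2 + u 1 ^ 2 + u 2 ^ 2) * hv' + hu' -
      (u 0 * v 0 + u 1 * v 1 + u 2 * v 2) * hvu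
  have hvc : inner ℝ v (cross v u) = 0 := by
    simp [cross, crossProduct, PiLp.inner_apply, Fin.sum_univ_three]
    ring
  have huc : inner ℝ u (cross v u) = 0 := by
    simp [cross, crossProduct, PiLp.inner_apply, Fin.sum_univ_three]
    ring
  refine ⟨fun i => by fin_cases i <;> simp [hu, hv, hc], fun i j hij => ?_⟩
  fin_cases i <;> fin_cases j <;>
    first | exact absurd rfl hij | exact hvu | exact hvc | exact huc | skip
  · exact (real_inner_comm _ _).trans hvu
  · exact (real_inner_comm _ _).trans hvc
  · exact (real_inner_comm _ _).trans huc

/-! ### Spanning -/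

section

variable {L : Submodule ℝ (E 3)} {u : E 3}

theorem cross_mem_restSpace (hL : Module.finrank ℝ L = 1) (hu : u ∈ Lᗮ) (hu1 : ‖u‖ = 1) :
    cross (unitVec L) u ∈ restSpace L u ∧ ‖cross (unitVec L) u‖ = 1 := by
  obtain ⟨hv, hv1⟩ := unitVec_spec hL
  have ho := orthonormal_cross hv1 hu1 (hu _ hv)
  have h02 : inner ℝ (unitVec L) (cross (unitVec L) u) = 0 :=
    ho.2 (show (0 : Fin 3) ≠ 2 by decide)
  have h12 : inner ℝ u (cross (unitVec L) u) = 0 := ho.2 (show (1 : Fin 3) ≠ 2 by decide)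
  refine ⟨mem_restSpace.2 ⟨fun v hv' => ?_, h12⟩, ho.1 2⟩
  obtain ⟨c, rfl⟩ := (mem_iff_of_finrank_eq_one hL).1 hv'
  rw [real_inner_smul_left, h02, mul_zero]

theorem starProjection_eq_unitVec {n : ℕ} {L : Submodule ℝ (E n)} (hL : Module.finrank ℝ L = 1)
    (y : E n) : L.starProjection y = inner ℝ (unitVec L) y • unitVec L := by
  obtain ⟨hv, hv1⟩ := unitVec_spec hL
  refine Submodule.eq_starProjection_of_mem_orthogonal (L.smul_mem _ hv) fun x hx => ?_
  obtain ⟨c, rfl⟩ := (mem_iff_of_finrank_eq_one hL).1 hx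
  rw [inner_sub_right, real_inner_smul_right, real_inner_smul_left, real_inner_smul_left,
    real_inner_self_eq_norm_sq, hv1]
  ring

theorem norm_starProjection_eq_unitVec {n : ℕ} {L : Submodule ℝ (E n)}
    (hL : Module.finrank ℝ L = 1) (y : E n) :
    ‖L.starProjection y‖ ^ 2 = inner ℝ (unitVec L) y ^ 2 := by
  rw [starProjection_eq_unitVec hL, norm_smul, (unitVec_spec hL).2, mul_one, Real.norm_eq_abs,
    sq_abs]

/-- Here `L` and `restSpace L u` are lines, and the available symmetry is the half-turn about `u`,
which negates the coordinates along `v_L` and `v_L × u` simultaneously. -/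
theorem ev_mem_formSpan_three {a : ℕ} {T : Tensor 3 a} (hT : IsStabInvariant L u T)
    (hL : Module.finrank ℝ L = 1) (hu : u ∈ Lᗮ) (hu1 : ‖u‖ = 1) :
    ev T ∈ formSpan 1 (fun y => ‖y‖ ^ 2) (fun y => ‖L.starProjection y‖ ^ 2)
        (fun y => inner ℝ u y) 0 a ⊔
      formSpan (fun y => inner ℝ (unitVec L) y * inner ℝ (cross (unitVec L) u) y)
        (fun y => ‖y‖ ^ 2) (fun y => ‖L.starProjection y‖ ^ 2) (fun y => inner ℝ u y) 2 a := by
  obtain ⟨hv, hv1⟩ := unitVec_spec hL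
  obtain ⟨hw, hw1⟩ := cross_mem_restSpace hL hu hu1
  set v := unitVec L with hvdef
  set w := cross v u with hwdef
  have hvu : inner ℝ v u = 0 := hu _ hv
  have hvw : inner ℝ v w = 0 := (mem_restSpace.1 hw).1 v hv
  have huw : inner ℝ u w = 0 := (mem_restSpace.1 hw).2
  obtain ⟨b, hb⟩ := exists_orthonormalBasis_coe_eq (orthonormal_cross hv1 hu1 hvu)
  have hy : ∀ y, inner ℝ v y • v + inner ℝ u y • u + inner ℝ w y • w = y := by
    intro y
    have h := b.sum_repr' y
    rw [Fin.sum_univ_three, hb] at h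
    exact h
  have hN : ∀ y, inner ℝ v y ^ 2 + inner ℝ u y ^ 2 + inner ℝ w y ^ 2 = ‖y‖ ^ 2 := by
    intro y
    have h := b.sum_sq_norm_inner_right y
    rw [Fin.sum_univ_three, hb] at h
    simpa using h
  have hA : (fun y => ‖L.starProjection y‖ ^ 2) = (fun y => inner ℝ v y : E 3 → ℝ) ^ 2 :=
    funext fun y => norm_starProjection_eq_unitVec hL y
  rw [hA]
  refine mem_formSpan_of_neg T ![v, u, w] (N := fun y => ‖y‖ ^ 2) (α := fun y => inner ℝ v y)
    (β := fun y => inner ℝ u y) (γ := fun y => inner ℝ w y) ?_ ?_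
  · funext y
    have h := hN y
    simp only [Pi.pow_apply, Pi.sub_apply]
    linarith
  · rintro y s (rfl | rfl)
    · refine congrArg (ev T) ((hy y).symm.trans ?_)
      simp
    · have hne : ∀ x : E 3, ‖x‖ = 1 → x ≠ 0 := fun x hx h => by simp [h] at hx
      have h := hT ((refl v).trans (refl w))
        (by rw [isoDet_trans, isoDet_refl (hne v hv1), isoDet_refl (hne w hw1)]; norm_num)
        (by rw [map_trans_eq, map_refl_of_mem (Or.inl hv), map_refl_of_mem (Or.inr hw.1)])
        (by
          change refl w (refl v u) = u
          rw [refl_apply_of_inner_eq_zero hvu, refl_apply_of_inner_eq_zero]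
          rw [real_inner_comm]; exact huw) y
      rw [← h]
      refine congrArg (ev T) ?_
      change refl w (refl v y) = _
      conv_lhs => rw [← hy y]
      simp only [map_add, map_smul, refl_self, map_neg]
      rw [refl_apply_of_inner_eq_zero hvu, refl_apply_of_inner_eq_zero hvw, refl_self,
        refl_apply_of_inner_eq_zero (by rw [real_inner_comm]; exact hvw),
        refl_apply_of_inner_eq_zero (by rw [real_inner_comm]; exact huw)]
      simp

end

/-- No rotation of the plane but the identity fixes `u`, so every tensor counts; one writes it in
the frame `(u, ū)` and eliminates the square of the second coordinate. -/
theorem ev_mem_formSpan_two {u : E 2} (hu1 : ‖u‖ = 1) {a : ℕ} (T : Tensor 2 a) :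
    ev T ∈ formSpan 1 (fun y => ‖y‖ ^ 2) 0 (fun y => inner ℝ u y) 0 a ⊔
      formSpan (fun y => inner ℝ (rotQuarter u) y) (fun y => ‖y‖ ^ 2) 0
        (fun y => inner ℝ u y) 1 a := by
  obtain ⟨b, hb⟩ := exists_orthonormalBasis_coe_eq (orthonormal_rotQuarter hu1)
  refine mem_formSpan_of_two T ![0, u, rotQuarter u] ?_ ?_
  · funext y
    have h := b.sum_sq_norm_inner_right y
    rw [Fin.sum_univ_two, hb] at h
    simp at h
    simp only [Pi.pow_apply, Pi.sub_apply]
    linarith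
  · intro y
    have h := b.sum_repr' y
    rw [Fin.sum_univ_two, hb] at h
    exact congrArg (ev T) h.symm

theorem spansInvariants_of_mem_span {n k a : ℕ} {I : Type} {s : Finset I} {b : I → ℕ}
    {τ : ∀ i, TField n (b i)}
    (h : ∀ (L : Submodule ℝ (E n)) (u : E n), Module.finrank ℝ L = k → u ∈ Lᗮ → ‖u‖ = 1 →
      ∀ T : Tensor n a, IsStabInvariant L u T →
        ev T ∈ Submodule.span ℝ ((fun i => ev ((τ i).toFun L u)) '' (s : Set I))) :
    SpansInvariants k a s τ := by
  intro L u hL hu hu1 T hT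
  obtain ⟨c, hc⟩ := Submodule.mem_span_image_finset_iff_exists_fun' ℝ |>.1 (h L u hL hu hu1 T hT)
  refine ⟨c, fun y => ?_⟩
  have h1 := congrFun hc y
  rw [Finset.sum_apply] at h1
  exact h1.symm

/-- The polynomials of the fields `Q^m Q_L^j u^s` that appear with `x^q`. -/
def phiGenerators {n : ℕ} (p q k : ℕ) (L : Submodule ℝ (E n)) (u : E n) : Set (E n → ℝ) :=
  (fun i : PhiIndex n p => ev ((phiField n i.m i.j i.s).toFun L u)) ''
    {i | i.r = q ∧ (i.k : ℕ) = k}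

section

variable {n p q k : ℕ} {L : Submodule ℝ (E n)} {u : E n}

theorem formSpan_le_phi (hq : q ≤ p) (hk : k < n) (hk0 : k ≠ 0) (hkn : k ≠ n - 1) :
    formSpan 1 (fun y => ‖y‖ ^ 2) (fun y => ‖L.starProjection y‖ ^ 2) (fun y => inner ℝ u y) 0
      (p - q) ≤ Submodule.span ℝ (phiGenerators p q k L u) := by
  refine Submodule.span_mono ?_
  rintro _ ⟨m, j, s, h, rfl⟩
  refine ⟨⟨m, q, s, j, ⟨k, hk⟩, by omega, fun h => ?_⟩, ⟨rfl, rfl⟩, ?_⟩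
  · rcases h with h | h
    · exact absurd h hk0
    · exact absurd h hkn
  · funext y
    refine (ev_phiField m j s L u y).trans ?_
    simp [mul_assoc]

theorem span_le_phi (hq : q ≤ p) (hk : k < n) :
    Submodule.span ℝ {f : E n → ℝ | ∃ m s : ℕ, 2 * m + s + 0 = p - q ∧
      f = 1 * ((fun y => ‖y‖ ^ 2) ^ m * (fun y => inner ℝ u y) ^ s)} ≤
      Submodule.span ℝ (phiGenerators p q k L u) := by
  refine Submodule.span_mono ?_
  rintro _ ⟨m, s, h, rfl⟩
  refine ⟨⟨m, q, s, 0, ⟨k, hk⟩, by omega, fun _ => rfl⟩, ⟨rfl, rfl⟩, ?_⟩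
  funext y
  refine (ev_phiField m 0 s L u y).trans ?_
  simp

/-- The condition on `k` says that `L` or `restSpace L u`, of dimension `n - k - 1`, has dimension
at least `2`. For `k = 0` and `k = n - 1` the powers of `Q_L` are redundant. -/
theorem ev_mem_span_phi (hq : q ≤ p) (hL : Module.finrank ℝ L = k) (hu : u ∈ Lᗮ) (hu1 : ‖u‖ = 1)
    {T : Tensor n (p - q)} (hT : IsStabInvariant L u T) (hk : 2 ≤ k ∨ k + 3 ≤ n) :
    ev T ∈ Submodule.span ℝ (phiGenerators p q k L u) := by
  have hd := finrank_restSpace hu hu1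
  rw [hL] at hd
  have hkn : k < n := by omega
  have h1 := ev_mem_formSpan hT hu hu1 (by omega)
  by_cases hk0 : k = 0
  · have hL0 : L = ⊥ := Submodule.finrank_eq_zero.1 (hL.trans hk0)
    refine span_le_phi hq hkn (formSpan_le_of_pow_eq_zero ?_ h1)
    funext y
    simp [hL0]
  by_cases hkn1 : k = n - 1
  · have hr : restSpace L u = ⊥ := Submodule.finrank_eq_zero.1 (by omega)
    refine span_le_phi hq hkn (formSpan_le_of_eq_sub ?_ h1)
    funext y
    have h2 := norm_sq_restSpace hu hu1 y
    have h3 := sub_sub_mem_restSpace hu hu1 y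
    rw [hr, Submodule.mem_bot] at h3
    rw [h3] at h2
    simp only [Pi.sub_apply, Pi.pow_apply]
    simp at h2
    linarith
  · exact formSpan_le_phi hq hkn hk0 hkn1 h1

end

/-! ### Independence -/

/-- A polynomial in four variables that vanishes on a product of infinite sets is zero. The
intervals are chosen so that `N - A - b² ≥ 2`, which leaves room for a component in `restSpace`. -/
theorem coeff_eq_zero_of_sum_eq_zero {I : Type*} (s : Finset I) (R M J S : I → ℕ)
    (hinj : ∀ i ∈ s, ∀ i' ∈ s, R i = R i' → M i = M i' → J i = J i' → S i = S i' → i = i')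
    (c : I → ℝ) (h : ∀ t N A b : ℝ, N ∈ Set.Icc (5 : ℝ) 6 → A ∈ Set.Icc (1 : ℝ) 2 →
      b ∈ Set.Icc (0 : ℝ) 1 → ∑ i ∈ s, c i * (t ^ R i * N ^ M i * A ^ J i * b ^ S i) = 0) :
    ∀ i ∈ s, c i = 0 := by
  classical
  let e : I → Fin 4 →₀ ℕ := fun i => Finsupp.equivFunOnFinite.symm ![R i, M i, J i, S i]
  have he : ∀ i ∈ s, ∀ i' ∈ s, e i = e i' → i = i' := by
    intro i hi i' hi' hii
    have h1 : ∀ l, e i l = e i' l := fun l => by rw [hii]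
    exact hinj i hi i' hi' (h1 0) (h1 1) (h1 2) (h1 3)
  let P : MvPolynomial (Fin 4) ℝ := ∑ i ∈ s, MvPolynomial.monomial (e i) (c i)
  have hP : P = 0 := by
    refine MvPolynomial.funext_set
      (![Set.univ, Set.Icc 5 6, Set.Icc 1 2, Set.Icc 0 1] : Fin 4 → Set ℝ) ?_ fun x hx => ?_
    · intro i
      fin_cases i
      · exact Set.infinite_univ
      · exact Set.Icc_infinite (by norm_num)
      · exact Set.Icc_infinite (by norm_num)
      · exact Set.Icc_infinite (by norm_num)
    · rw [map_sum, map_zero, ← h (x 0) (x 1) (x 2) (x 3) (hx 1 trivial) (hx 2 trivial)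
        (hx 3 trivial)]
      refine Finset.sum_congr rfl fun i _ => ?_
      rw [MvPolynomial.eval_monomial, Finsupp.prod_fintype _ _ (fun _ => pow_zero _),
        Fin.prod_univ_four]
      rfl
  intro i hi
  have h1 := congrArg (MvPolynomial.coeff (e i)) hP
  rw [MvPolynomial.coeff_sum, MvPolynomial.coeff_zero, Finset.sum_eq_single_of_mem i hi] at h1
  · simpa using h1
  · intro i' hi' hne
    rw [MvPolynomial.coeff_monomial, if_neg fun h => hne (he i' hi' i hi h)]

theorem frame_apply {n : ℕ} {L : Submodule ℝ (E n)} {u e e' : E n} (hu : u ∈ Lᗮ) (hu1 : ‖u‖ = 1)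
    (he : e ∈ L) (he1 : ‖e‖ = 1) (he' : e' ∈ restSpace L u) (he1' : ‖e'‖ = 1) (a b c : ℝ) :
    L.starProjection (a • e + b • u + c • e') = a • e ∧
      inner ℝ u (a • e + b • u + c • e') = b ∧
      ‖a • e + b • u + c • e'‖ ^ 2 = a ^ 2 + b ^ 2 + c ^ 2 := by
  have h1 : L.starProjection (a • e + b • u + c • e') = a • e := by
    refine Submodule.eq_starProjection_of_mem_orthogonal (L.smul_mem _ he) ?_
    have : a • e + b • u + c • e' - a • e = b • u + c • e' := by abel
    rw [this]
    exact Submodule.add_mem _ (Submodule.smul_mem _ _ hu) (Submodule.smul_mem _ _ he'.1)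
  have h2 : inner ℝ u (a • e + b • u + c • e') = b := by
    rw [inner_add_right, inner_add_right, real_inner_smul_right, real_inner_smul_right,
      real_inner_smul_right, real_inner_self_eq_norm_sq, hu1, (mem_restSpace.1 he').2,
      real_inner_comm, hu e he]
    ring
  refine ⟨h1, h2, ?_⟩
  have h3 := norm_sq_restSpace hu hu1 (a • e + b • u + c • e')
  rw [h1, h2] at h3
  have : a • e + b • u + c • e' - a • e - b • u = c • e' := by abel
  rw [this, norm_smul, norm_smul, he1, he1', mul_one, mul_one, Real.norm_eq_abs, Real.norm_eq_abs,
    sq_abs, sq_abs] at h3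
  linarith

theorem exists_inner_eq {n : ℕ} {y : E n} {N : ℝ} (hN : 0 < N) (hy : ‖y‖ ^ 2 = N) (t : ℝ) :
    ∃ x : E n, inner ℝ x y = t := by
  refine ⟨(t / N) • y, ?_⟩
  rw [real_inner_smul_left, real_inner_self_eq_norm_sq, hy]
  field_simp

theorem exists_unit_mem {n : ℕ} {S : Submodule ℝ (E n)} (hS : 0 < Module.finrank ℝ S) :
    ∃ e ∈ S, ‖e‖ = 1 := by
  have : Nontrivial S := Module.nontrivial_of_finrank_pos hS
  obtain ⟨v, hv⟩ := exists_norm_eq S (zero_le_one' ℝ)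
  exact ⟨v, v.2, by simpa using hv⟩

theorem exists_submodule_unit {n k : ℕ} (hk : k < n) : ∃ (L : Submodule ℝ (E n)) (u : E n),
    Module.finrank ℝ L = k ∧ u ∈ Lᗮ ∧ ‖u‖ = 1 := by
  let v : Fin k → E n := fun i => EuclideanSpace.basisFun (Fin n) ℝ (Fin.castLE hk.le i)
  have hv : LinearIndependent ℝ v :=
    ((EuclideanSpace.basisFun (Fin n) ℝ).orthonormal.comp _
      (Fin.castLE_injective hk.le)).linearIndependent
  have hL : Module.finrank ℝ (Submodule.span ℝ (Set.range v)) = k := by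
    rw [finrank_span_eq_card hv, Fintype.card_fin]
  obtain ⟨u, hu, hu1⟩ := exists_unit_mem (S := (Submodule.span ℝ (Set.range v))ᗮ) (by
    rw [finrank_orthogonal_eq _ hL]; omega)
  exact ⟨_, u, hL, hu, hu1⟩

/-! ### The families of local tensor mappings -/

/-- Here `g F` collects the factors constant on a face, such as `Q^m`, `Q_L^j` and `v_F`, which
stand outside the integral in the listed mappings but belong to the field `τ`. -/
theorem sum_ev_faceIntegral {n a b k r : ℕ} (τ : TField n b) (f : Set (E n) → E n → E n → Tensor n a)
    (hf : ∀ F, Continuous fun z : Sig n => f F z.1 z.2) (g : Set (E n) → ℝ) (y : E n)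
    (h : ∀ F x u, g F * ev (f F x u) y = inner ℝ x y ^ r * ev (τ.toFun (dirSpace F) u) y)
    (P : Polytope n) (η : BorelSig n) :
    ∑ F ∈ (finite_faces P k).toFinset, g F * ev (faceIntegral P k F η (f F)) y =
      ev (fieldMap k r τ P η) y := by
  rw [fieldMap, ev_sum]
  refine Finset.sum_congr rfl fun F hF => ?_
  have hF' := (finite_faces P k).mem_toFinset.1 hF
  have hc : Continuous fun z : Sig n => symMul (vecPow z.1 r) (τ.toFun (dirSpace F) z.2) := by
    rw [continuous_tensor_iff]
    intro y
    simp only [ev_symMul, ev_vecPow]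
    have h := (τ.continuous (dirSpace F) y).comp (continuous_snd (X := E n) (Y := Sph n))
    exact ((continuous_fst.inner continuous_const).pow r).mul h
  rw [ev_faceIntegral hF' (facePlane hF') rfl η (f F) (hf F) y,
    ev_faceIntegral hF' (facePlane hF') rfl η _ hc y, ← integral_const_mul]
  refine integral_congr_ae (Filter.Eventually.of_forall fun z => ?_)
  simp only [h, ev_symMul, ev_vecPow]

theorem omega_pos {m : ℕ} (hm : 0 < m) : 0 < omega m := by
  have h : (0 : ℝ) < (m : ℝ) / 2 := by positivity
  have h1 := Real.Gamma_pos_of_pos h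
  have h2 := Real.pi_pos
  unfold omega
  positivity

theorem coeffC_ne_zero {n k : ℕ} (hk : k < n) (r s : ℕ) : coeffC n k r s ≠ 0 := by
  have h := omega_pos (m := n - k + s) (by omega)
  unfold coeffC
  positivity

theorem ev_phiFamily {n p : ℕ} (i : PhiIndex n p) (P : Polytope n) (η : BorelSig n) (y : E n) :
    ev (phiFamily n p i P η) y = coeffC n i.k i.r i.s *
      ev (fieldMap i.k i.r (phiField n i.m i.j i.s) P η) y := by
  have h := sum_ev_faceIntegral (k := i.k) (r := i.r) (phiField n i.m i.j i.s)
    (fun _ x u => symMul (vecPow x i.r) (vecPow u i.s)) (fun _ => by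
      rw [continuous_tensor_iff]
      intro y
      simp only [ev_symMul, ev_vecPow]
      fun_prop) (fun F => (‖y‖ ^ 2) ^ i.m * (‖(dirSpace F).starProjection y‖ ^ 2) ^ i.j) y
    (fun F x u => by
      rw [ev_phiField, ev_symMul, ev_vecPow, ev_vecPow]
      ring) P η
  rw [← h, phiFamily, ev_castMap, metricMul, ev_symMul, ev_symPow, ev_metricTensor, phi, ev_smul,
    ev_sum, mul_left_comm, Finset.mul_sum]
  refine congrArg _ (Finset.sum_congr rfl fun F _ => ?_)
  rw [ev_symMul, ev_symPow, ev_projTensor]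
  ring

theorem ev_tildeThreeFamily {p : ℕ} (i : TildeThreeIndex p) (P : Polytope 3) (η : BorelSig 3)
    (y : E 3) : ev (tildeThreeFamily p i P η) y =
      ev (fieldMap 1 i.r (tildeThreeField i.m i.j i.s) P η) y := by
  have h := sum_ev_faceIntegral (k := 1) (r := i.r) (tildeThreeField i.m i.j i.s)
    (fun F x u => symMul (symMul (vecPow x i.r) (vecPow (cross (unitVec (dirSpace F)) u) 1))
      (vecPow u i.s)) (fun F => by
      rw [continuous_tensor_iff]
      intro y
      simp only [ev_symMul, ev_vecPow]
      have h := (continuous_cross (unitVec (dirSpace F))).comp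
        ((continuous_subtype_val (p := fun u : E 3 => u ∈ Metric.sphere (0 : E 3) 1)).comp
          (continuous_snd (X := E 3) (Y := Sph 3)))
      have h' : Continuous fun z : Sig 3 => inner ℝ (cross (unitVec (dirSpace F)) (z.2 : E 3)) y :=
        h.inner continuous_const
      fun_prop) (fun F => (‖y‖ ^ 2) ^ i.m * ((‖(dirSpace F).starProjection y‖ ^ 2) ^ i.j *
        inner ℝ (unitVec (dirSpace F)) y)) y
    (fun F x u => by
      simp only [ev_tildeThreeField, ev_symMul, ev_vecPow]
      ring) P η
  rw [← h, tildeThreeFamily, ev_castMap, metricMul, ev_symMul, ev_symPow, ev_metricTensor,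
    phiTildeThree, ev_sum, Finset.mul_sum]
  refine Finset.sum_congr rfl fun F _ => ?_
  simp only [ev_symMul, ev_symPow, ev_projTensor, ev_vecPow]
  ring

theorem ev_tildeTwoFamily {p : ℕ} (i : TildeTwoIndex p) (P : Polytope 2) (η : BorelSig 2)
    (y : E 2) : ev (tildeTwoFamily p i P η) y =
      ev (fieldMap i.k i.r (tildeTwoField i.m i.s) P η) y := by
  have h := sum_ev_faceIntegral (k := i.k) (r := i.r) (tildeTwoField i.m i.s)
    (fun _ x u => symMul (symMul (vecPow x i.r) (vecPow (rotQuarter u) 1)) (vecPow u i.s))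
    (fun _ => by
      rw [continuous_tensor_iff]
      intro y
      simp only [ev_symMul, ev_vecPow]
      have h := continuous_rotQuarter.comp
        ((continuous_subtype_val (p := fun u : E 2 => u ∈ Metric.sphere (0 : E 2) 1)).comp
          (continuous_snd (X := E 2) (Y := Sph 2)))
      have h' : Continuous fun z : Sig 2 => inner ℝ (rotQuarter (z.2 : E 2)) y :=
        h.inner continuous_const
      fun_prop) (fun _ => (‖y‖ ^ 2) ^ i.m) y
    (fun F x u => by
      simp only [ev_tildeTwoField, ev_symMul, ev_vecPow]
      ring) P η
  rw [← h, tildeTwoFamily, ev_castMap, metricMul, ev_symMul, ev_symPow, ev_metricTensor,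
    phiTildeTwo, ev_sum, Finset.mul_sum]

noncomputable instance instFintypePhiIndex (n p : ℕ) : Fintype (PhiIndex n p) :=
  Fintype.ofInjective (β := Fin (p + 1) × Fin (p + 1) × Fin (p + 1) × Fin (p + 1) × Fin n)
    (fun i => (⟨i.m, by have := i.rank_eq; omega⟩, ⟨i.r, by have := i.rank_eq; omega⟩,
      ⟨i.s, by have := i.rank_eq; omega⟩, ⟨i.j, by have := i.rank_eq; omega⟩, i.k))
    (fun i i' h => by
      simp only [Prod.mk.injEq, Fin.mk.injEq] at h
      obtain ⟨h1, h2, h3, h4, h5⟩ := h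
      exact PhiIndex.ext h1 h2 h3 h4 h5)

noncomputable instance instFintypeTildeThreeIndex (p : ℕ) : Fintype (TildeThreeIndex p) :=
  Fintype.ofInjective (β := Fin (p + 1) × Fin (p + 1) × Fin (p + 1) × Fin (p + 1))
    (fun i => (⟨i.m, by have := i.rank_eq; omega⟩, ⟨i.r, by have := i.rank_eq; omega⟩,
      ⟨i.s, by have := i.rank_eq; omega⟩, ⟨i.j, by have := i.rank_eq; omega⟩))
    (fun i i' h => by
      simp only [Prod.mk.injEq, Fin.mk.injEq] at h
      obtain ⟨h1, h2, h3, h4⟩ := h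
      exact TildeThreeIndex.ext h1 h2 h3 h4)

noncomputable instance instFintypeTildeTwoIndex (p : ℕ) : Fintype (TildeTwoIndex p) :=
  Fintype.ofInjective (β := Fin (p + 1) × Fin (p + 1) × Fin (p + 1) × Fin 2)
    (fun i => (⟨i.m, by have := i.rank_eq; omega⟩, ⟨i.r, by have := i.rank_eq; omega⟩,
      ⟨i.s, by have := i.rank_eq; omega⟩, i.k))
    (fun i i' h => by
      simp only [Prod.mk.injEq, Fin.mk.injEq] at h
      obtain ⟨h1, h2, h3, h4⟩ := h
      exact TildeTwoIndex.ext h1 h2 h3 h4)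

theorem phi_coeff_eq_zero {n p k : ℕ} (c : PhiIndex n p → ℝ)
    (h : ∀ t N A b : ℝ, N ∈ Set.Icc (5 : ℝ) 6 → A ∈ Set.Icc (1 : ℝ) 2 → b ∈ Set.Icc (0 : ℝ) 1 →
      ∑ i ∈ Finset.univ.filter (fun i : PhiIndex n p => (i.k : ℕ) = k),
        c i * (t ^ i.r * N ^ i.m * A ^ i.j * b ^ i.s) = 0) :
    ∀ i : PhiIndex n p, (i.k : ℕ) = k → c i = 0 := fun i hi =>
  coeff_eq_zero_of_sum_eq_zero (Finset.univ.filter fun i : PhiIndex n p => (i.k : ℕ) = k)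
    (fun i => i.r) (fun i => i.m) (fun i => i.j) (fun i => i.s)
    (fun _ hi _ hi' h1 h2 h3 h4 => PhiIndex.ext h2 h1 h4 h3
      (Fin.ext ((Finset.mem_filter.1 hi).2.trans (Finset.mem_filter.1 hi').2.symm)))
    c h i (Finset.mem_filter.2 ⟨Finset.mem_univ i, hi⟩)

/-- Every admissible choice of the basic invariants is attained. -/
theorem exists_invariants_eq {n k : ℕ} (hn : 2 ≤ n) {L : Submodule ℝ (E n)} {u : E n}
    (hL : Module.finrank ℝ L = k) (hu : u ∈ Lᗮ) (hu1 : ‖u‖ = 1) {N A b : ℝ}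
    (hN : N ∈ Set.Icc (5 : ℝ) 6) (hA : A ∈ Set.Icc (1 : ℝ) 2) (hb : b ∈ Set.Icc (0 : ℝ) 1)
    (t : ℝ) : ∃ x y : E n, inner ℝ x y = t ∧ ‖y‖ ^ 2 = N ∧ inner ℝ u y = b ∧
      (k ≠ 0 → k ≠ n - 1 → ‖L.starProjection y‖ ^ 2 = A) := by
  have hb2 : b ^ 2 ≤ 1 := by
    have := hb.1; have := hb.2; nlinarith
  suffices h : ∃ y : E n, ‖y‖ ^ 2 = N ∧ inner ℝ u y = b ∧
      (k ≠ 0 → k ≠ n - 1 → ‖L.starProjection y‖ ^ 2 = A) by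
    obtain ⟨y, h1, h2, h3⟩ := h
    obtain ⟨x, hx⟩ := exists_inner_eq (by linarith [hN.1]) h1 t
    exact ⟨x, y, hx, h1, h2, h3⟩
  have hd := finrank_restSpace hu hu1
  -- In these dimensions `A` is not prescribed, so it is enough to work in the span of `u` and one
  -- unit vector orthogonal to it; `⊥` takes the role of `L`.
  by_cases hk : k = 0 ∨ k = n - 1
  · have hu' : u ∈ (⊥ : Submodule ℝ (E n))ᗮ := by simp
    have hd' := finrank_restSpace hu' hu1
    rw [finrank_bot] at hd'
    obtain ⟨f, hf, hf1⟩ := exists_unit_mem (S := restSpace ⊥ u) (by omega)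
    refine ⟨b • u + √(N - b ^ 2) • f, ?_, ?_, fun h1 h2 => by tauto⟩
    · have h3 := norm_sq_restSpace hu' hu1 (b • u + √(N - b ^ 2) • f)
      have h4 : inner ℝ u (b • u + √(N - b ^ 2) • f) = b := by
        rw [inner_add_right, real_inner_smul_right, real_inner_smul_right, (mem_restSpace.1 hf).2,
          real_inner_self_eq_norm_sq, hu1]
        ring
      rw [h4] at h3
      simp only [Submodule.starProjection_bot, zero_apply, sub_zero, add_sub_cancel_left,
        norm_smul, hf1, norm_zero] at h3
      rw [mul_one, Real.norm_eq_abs, sq_abs, Real.sq_sqrt (by linarith [hN.1])] at h3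
      linarith
    · rw [inner_add_right, real_inner_smul_right, real_inner_smul_right, (mem_restSpace.1 hf).2,
        real_inner_self_eq_norm_sq, hu1]
      ring
  · push Not at hk
    obtain ⟨e, he, he1⟩ := exists_unit_mem (S := L) (by omega)
    obtain ⟨f, hf, hf1⟩ := exists_unit_mem (S := restSpace L u) (by
      have := finrank_le_dim L
      omega)
    obtain ⟨h1, h2, h3⟩ := frame_apply hu hu1 he he1 hf hf1 (√A) b (√(N - A - b ^ 2))
    refine ⟨_, ?_, h2, fun _ _ => ?_⟩
    · rw [h3, Real.sq_sqrt (by linarith [hA.1]), Real.sq_sqrt (by linarith [hN.1, hA.2])]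
      ring
    · rw [h1, norm_smul, he1, mul_one, Real.norm_eq_abs, sq_abs, Real.sq_sqrt (by linarith [hA.1])]

/-- Independence of the fields `Q^m Q_L^j u^s` together with powers of `x`. -/
theorem phi_independent {n p k : ℕ} (hn : 2 ≤ n) (c : PhiIndex n p → ℝ) {L : Submodule ℝ (E n)}
    {u : E n} (hL : Module.finrank ℝ L = k) (hu : u ∈ Lᗮ) (hu1 : ‖u‖ = 1)
    (h : ∀ x y : E n, ∑ i ∈ Finset.univ.filter (fun i : PhiIndex n p => (i.k : ℕ) = k),
      c i * (inner ℝ x y ^ i.r * ev ((phiField n i.m i.j i.s).toFun L u) y) = 0) :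
    ∀ i : PhiIndex n p, (i.k : ℕ) = k → c i = 0 := by
  refine phi_coeff_eq_zero c fun t N A b hN hA hb => ?_
  obtain ⟨x, y, hx, hy, hyu, hyL⟩ := exists_invariants_eq hn hL hu hu1 hN hA hb t
  rw [← h x y]
  refine Finset.sum_congr rfl fun i hi => ?_
  rw [ev_phiField, hx, hy, hyu]
  have hAj : (‖L.starProjection y‖ ^ 2) ^ i.j = A ^ i.j := by
    have hk := (Finset.mem_filter.1 hi).2
    have hj := i.j_eq_zero
    rw [hk] at hj
    by_cases h0 : k = 0 ∨ k = n - 1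
    · rw [hj h0, pow_zero, pow_zero]
    · push Not at h0
      rw [hyL h0.1 h0.2]
  rw [hAj]
  ring

theorem isBasisOf_phiFamily {n : ℕ} (hn : 4 ≤ n) (p : ℕ) :
    IsBasisOf (phiFamily n p) (localTensorSpace n p) := by
  refine isBasisOf_of_spans (b := fun i : PhiIndex n p => 2 * i.m + (2 * i.j + i.s))
    (τ := fun i => phiField n i.m i.j i.s) (κ := fun i => (i.k : ℕ)) (r := fun i => i.r)
    (fun i => by have := i.rank_eq; omega) (by omega) (fun q hq k hk => ?_) (fun k c h i hi => ?_)
    (phiFamily n p) (fun i => coeffC n i.k i.r i.s) (fun i => coeffC_ne_zero i.k.2 _ _)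
    ev_phiFamily
  · refine spansInvariants_of_mem_span fun L u hL hu hu1 T hT => ?_
    -- For `n ≥ 4` every `k` satisfies `2 ≤ k` or `k + 3 ≤ n`, so no exceptional invariants arise.
    have h := ev_mem_span_phi hq hL hu hu1 hT (by omega)
    simpa [phiGenerators, Finset.filter_filter] using h
  · obtain ⟨L, u, hL, hu, hu1⟩ := exists_submodule_unit (n := n) (k := k) (by rw [← hi]; exact i.k.2)
    exact phi_independent (by omega) c hL hu hu1 (h L u hL hu hu1) i hi

theorem sum_filter_sumElim {α β : Type*} [Fintype α] [Fintype β] (f : α → ℕ) (g : β → ℕ) (k : ℕ)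
    (F : α ⊕ β → ℝ) : ∑ i ∈ Finset.univ.filter (fun i => Sum.elim f g i = k), F i =
      ∑ i ∈ Finset.univ.filter (fun i => f i = k), F (Sum.inl i) +
        ∑ i ∈ Finset.univ.filter (fun i => g i = k), F (Sum.inr i) := by
  simp only [Finset.sum_filter, Fintype.sum_sum_type, Sum.elim_inl, Sum.elim_inr]
  rfl

/-! ### Dimension three -/

/-- The ranks of the fields in dimension three. -/
def threeRank (p : ℕ) : PhiIndex 3 p ⊕ TildeThreeIndex p → ℕ :=
  Sum.elim (fun i => 2 * i.m + (2 * i.j + i.s)) fun i => 2 * i.m + (2 * i.j + 1 + (1 + i.s))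

/-- The fields in dimension three. -/
noncomputable def threeField (p : ℕ) :
    ∀ i : PhiIndex 3 p ⊕ TildeThreeIndex p, TField 3 (threeRank p i)
  | Sum.inl i => phiField 3 i.m i.j i.s
  | Sum.inr i => tildeThreeField i.m i.j i.s

section

variable {p q k : ℕ} {L : Submodule ℝ (E 3)} {u : E 3}

theorem ev_mem_span_threeField (hq : q ≤ p) (hk : k < 3) (hL : Module.finrank ℝ L = k) (hu : u ∈ Lᗮ)
    (hu1 : ‖u‖ = 1) {T : Tensor 3 (p - q)} (hT : IsStabInvariant L u T) :
    ev T ∈ Submodule.span ℝ ((fun i => ev ((threeField p i).toFun L u)) ''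
      {i | Sum.elim (fun i : PhiIndex 3 p => i.r) (fun i : TildeThreeIndex p => i.r) i = q ∧
        Sum.elim (fun i : PhiIndex 3 p => (i.k : ℕ)) (fun _ : TildeThreeIndex p => 1) i = k}) := by
  have hphi : Submodule.span ℝ (phiGenerators p q k L u) ≤
      Submodule.span ℝ ((fun i => ev ((threeField p i).toFun L u)) ''
      {i | Sum.elim (fun i : PhiIndex 3 p => i.r) (fun i : TildeThreeIndex p => i.r) i = q ∧
        Sum.elim (fun i : PhiIndex 3 p => (i.k : ℕ)) (fun _ : TildeThreeIndex p => 1) i = k}) := by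
    refine Submodule.span_mono ?_
    rintro _ ⟨i, hi, rfl⟩
    exact ⟨Sum.inl i, hi, rfl⟩
  by_cases hk1 : k = 1
  · subst hk1
    have h := ev_mem_formSpan_three hT hL hu hu1
    refine (sup_le ((formSpan_le_phi hq hk one_ne_zero (by norm_num)).trans hphi) ?_) h
    refine Submodule.span_mono ?_
    rintro _ ⟨m, j, s, h, rfl⟩
    refine ⟨Sum.inr ⟨m, q, s, j, by omega⟩, ⟨rfl, rfl⟩, ?_⟩
    funext y
    refine (ev_tildeThreeField m j s L u y).trans ?_
    simp only [Pi.mul_apply, Pi.pow_apply]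
    ring
  · exact hphi (ev_mem_span_phi hq hL hu hu1 hT (by omega))

/-- Changing the sign `σ` of the coordinate along `v_L × u` leaves `N`, `A`, `b` unchanged and
negates exactly the additional fields, so the two sums vanish separately. -/
theorem threeField_independent (hL : Module.finrank ℝ L = 1) (hu : u ∈ Lᗮ) (hu1 : ‖u‖ = 1)
    (c : PhiIndex 3 p ⊕ TildeThreeIndex p → ℝ)
    (h : ∀ x y : E 3, ∑ i ∈ Finset.univ.filter (fun i : PhiIndex 3 p => (i.k : ℕ) = 1),
        c (Sum.inl i) * (inner ℝ x y ^ i.r * ev ((phiField 3 i.m i.j i.s).toFun L u) y) +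
      ∑ i : TildeThreeIndex p,
        c (Sum.inr i) * (inner ℝ x y ^ i.r * ev ((tildeThreeField i.m i.j i.s).toFun L u) y) = 0) :
    (∀ i : PhiIndex 3 p, (i.k : ℕ) = 1 → c (Sum.inl i) = 0) ∧ ∀ i, c (Sum.inr i) = 0 := by
  have key : ∀ t N A b : ℝ, N ∈ Set.Icc (5 : ℝ) 6 → A ∈ Set.Icc (1 : ℝ) 2 → b ∈ Set.Icc (0 : ℝ) 1 →
      ∑ i ∈ Finset.univ.filter (fun i : PhiIndex 3 p => (i.k : ℕ) = 1),
        c (Sum.inl i) * (t ^ i.r * N ^ i.m * A ^ i.j * b ^ i.s) = 0 ∧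
      ∑ i : TildeThreeIndex p, c (Sum.inr i) * (t ^ i.r * N ^ i.m * A ^ i.j * b ^ i.s) = 0 := by
    intro t N A b hN hA hb
    obtain ⟨hv, hv1⟩ := unitVec_spec hL
    obtain ⟨hw, hw1⟩ := cross_mem_restSpace hL hu hu1
    have hb2 : b ^ 2 ≤ 1 := by
      have := hb.1; have := hb.2; nlinarith
    have hγ : 0 < N - A - b ^ 2 := by linarith [hN.1, hA.2]
    have hA0 : 0 < A := by linarith [hA.1]
    have hs : ∀ σ : ℝ, σ ^ 2 = 1 → ∑ i ∈ Finset.univ.filter (fun i : PhiIndex 3 p => (i.k : ℕ) = 1),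
        c (Sum.inl i) * (t ^ i.r * N ^ i.m * A ^ i.j * b ^ i.s) +
        (√A * (σ * √(N - A - b ^ 2))) * ∑ i : TildeThreeIndex p,
          c (Sum.inr i) * (t ^ i.r * N ^ i.m * A ^ i.j * b ^ i.s) = 0 := by
      intro σ hσ
      obtain ⟨h1, h2, h3⟩ := frame_apply hu hu1 hv hv1 hw hw1 (√A) b (σ * √(N - A - b ^ 2))
      set y := √A • unitVec L + b • u + (σ * √(N - A - b ^ 2)) • cross (unitVec L) u with hy
      have hyN : ‖y‖ ^ 2 = N := by
        rw [h3, mul_pow, hσ, Real.sq_sqrt hA0.le, Real.sq_sqrt hγ.le]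
        ring
      have hyA : ‖L.starProjection y‖ ^ 2 = A := by
        rw [h1, norm_smul, hv1, mul_one, Real.norm_eq_abs, sq_abs, Real.sq_sqrt hA0.le]
      have hvw := (mem_restSpace.1 hw).1 _ hv
      have huw := (mem_restSpace.1 hw).2
      have hyv : inner ℝ (unitVec L) y = √A := by
        rw [hy, inner_add_right, inner_add_right, real_inner_smul_right, real_inner_smul_right,
          real_inner_smul_right, real_inner_self_eq_norm_sq, hv1, hu _ hv, hvw]
        ring
      have hyw : inner ℝ (cross (unitVec L) u) y = σ * √(N - A - b ^ 2) := by
        rw [hy, inner_add_right, inner_add_right, real_inner_smul_right, real_inner_smul_right,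
          real_inner_smul_right, real_inner_self_eq_norm_sq, hw1,
          real_inner_comm, hvw, real_inner_comm, huw]
        ring
      obtain ⟨x, hx⟩ := exists_inner_eq (by linarith [hN.1]) hyN t
      have h4 := h x y
      simp only [ev_phiField, ev_tildeThreeField, hx, hyN, hyA, hyv, hyw, h2] at h4
      rw [← h4, Finset.mul_sum]
      congr 1
      · exact Finset.sum_congr rfl fun i _ => by ring
      · exact Finset.sum_congr rfl fun i _ => by ring
    have h1 := hs 1 (by norm_num)
    have h2 := hs (-1) (by norm_num)
    have h3 : √A * √(N - A - b ^ 2) ≠ 0 :=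
      mul_ne_zero (Real.sqrt_pos.2 hA0).ne' (Real.sqrt_pos.2 hγ).ne'
    refine ⟨by linarith, (mul_eq_zero.1 (?_ : √A * √(N - A - b ^ 2) * _ = 0)).resolve_left h3⟩
    linarith
  refine ⟨phi_coeff_eq_zero (fun i => c (Sum.inl i)) fun t N A b hN hA hb =>
    (key t N A b hN hA hb).1, fun i => ?_⟩
  exact coeff_eq_zero_of_sum_eq_zero Finset.univ
    (fun i : TildeThreeIndex p => i.r) (fun i => i.m) (fun i => i.j) (fun i => i.s)
    (fun _ _ _ _ h1 h2 h3 h4 => TildeThreeIndex.ext h2 h1 h4 h3)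
    (fun i => c (Sum.inr i)) (fun t N A b hN hA hb => (key t N A b hN hA hb).2) i
    (Finset.mem_univ i)

end

theorem isBasisOf_three (p : ℕ) :
    IsBasisOf (Sum.elim (phiFamily 3 p) (tildeThreeFamily p)) (localTensorSpace 3 p) := by
  refine isBasisOf_of_spans (b := threeRank p) (τ := threeField p)
    (κ := Sum.elim (fun i => (i.k : ℕ)) fun _ => 1) (r := Sum.elim (fun i => i.r) fun i => i.r)
    ?_ (by norm_num) (fun q hq k hk => ?_) (fun k c h i hi => ?_)
    _ (Sum.elim (fun i => coeffC 3 i.k i.r i.s) fun _ => 1) ?_ ?_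
  · rintro (i | i)
    · have := i.rank_eq
      simp only [threeRank, Sum.elim_inl]
      omega
    · have := i.rank_eq
      simp only [threeRank, Sum.elim_inr]
      omega
  · refine spansInvariants_of_mem_span fun L u hL hu hu1 T hT => ?_
    have h := ev_mem_span_threeField hq hk hL hu hu1 hT
    simpa only [Finset.filter_filter, Finset.coe_filter, Finset.mem_univ, true_and] using h
  · have hk : k < 3 := by
      rcases i with i | i
      · rw [← hi]; exact i.k.2
      · rw [← hi]; norm_num
    obtain ⟨L, u, hL, hu, hu1⟩ := exists_submodule_unit (n := 3) (k := k) hk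
    have h1 := h L u hL hu hu1
    simp only [sum_filter_sumElim, Sum.elim_inl, Sum.elim_inr, threeField] at h1
    by_cases hk1 : k = 1
    · subst hk1
      simp only [Finset.filter_true] at h1
      obtain ⟨h2, h3⟩ := threeField_independent hL hu hu1 c h1
      rcases i with i | i
      · exact h2 i hi
      · exact h3 i
    · rcases i with i | i
      · have hf : (Finset.univ.filter fun _ : TildeThreeIndex p => 1 = k) = ∅ :=
          Finset.filter_false_of_mem fun _ _ h => hk1 h.symm
        simp only [hf, Finset.sum_empty, add_zero] at h1
        exact phi_independent (by norm_num) (fun i => c (Sum.inl i)) hL hu hu1 h1 i hi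
      · exact absurd hi.symm hk1
  · rintro (i | i)
    · exact coeffC_ne_zero i.k.2 _ _
    · exact one_ne_zero
  · rintro (i | i) P η y
    · exact ev_phiFamily i P η y
    · exact (ev_tildeThreeFamily i P η y).trans (one_mul _).symm

/-! ### Dimension two -/

/-- The ranks of the fields in dimension two. -/
def twoRank (p : ℕ) : PhiIndex 2 p ⊕ TildeTwoIndex p → ℕ :=
  Sum.elim (fun i => 2 * i.m + (2 * i.j + i.s)) fun i => 2 * i.m + (1 + i.s)

/-- The fields in dimension two. -/
noncomputable def twoField (p : ℕ) : ∀ i : PhiIndex 2 p ⊕ TildeTwoIndex p, TField 2 (twoRank p i)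
  | Sum.inl i => phiField 2 i.m i.j i.s
  | Sum.inr i => tildeTwoField i.m i.s

section

variable {p q k : ℕ} {L : Submodule ℝ (E 2)} {u : E 2}

theorem ev_mem_span_twoField (hq : q ≤ p) (hk : k < 2) (hu1 : ‖u‖ = 1) (T : Tensor 2 (p - q)) :
    ev T ∈ Submodule.span ℝ ((fun i => ev ((twoField p i).toFun L u)) ''
      {i | Sum.elim (fun i : PhiIndex 2 p => i.r) (fun i : TildeTwoIndex p => i.r) i = q ∧
        Sum.elim (fun i : PhiIndex 2 p => (i.k : ℕ)) (fun i : TildeTwoIndex p => (i.k : ℕ)) i =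
          k}) := by
  refine (sup_le (((formSpan_le_of_pow_eq_zero rfl).trans (span_le_phi (L := L) hq hk)).trans
    (Submodule.span_mono ?_)) ((formSpan_le_of_pow_eq_zero rfl).trans (Submodule.span_mono ?_)))
    (ev_mem_formSpan_two hu1 T)
  · rintro _ ⟨i, hi, rfl⟩
    exact ⟨Sum.inl i, hi, rfl⟩
  · rintro _ ⟨m, s, h, rfl⟩
    refine ⟨Sum.inr ⟨m, q, s, ⟨k, hk⟩, by omega⟩, ⟨rfl, rfl⟩, ?_⟩
    funext y
    refine (ev_tildeTwoField m s L u y).trans ?_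
    simp only [Pi.mul_apply, Pi.pow_apply]
    ring

theorem twoField_independent (hu1 : ‖u‖ = 1) (c : PhiIndex 2 p ⊕ TildeTwoIndex p → ℝ)
    (h : ∀ x y : E 2, ∑ i ∈ Finset.univ.filter (fun i : PhiIndex 2 p => (i.k : ℕ) = k),
        c (Sum.inl i) * (inner ℝ x y ^ i.r * ev ((phiField 2 i.m i.j i.s).toFun L u) y) +
      ∑ i ∈ Finset.univ.filter (fun i : TildeTwoIndex p => (i.k : ℕ) = k),
        c (Sum.inr i) * (inner ℝ x y ^ i.r * ev ((tildeTwoField i.m i.s).toFun L u) y) = 0) :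
    (∀ i : PhiIndex 2 p, (i.k : ℕ) = k → c (Sum.inl i) = 0) ∧
      ∀ i : TildeTwoIndex p, (i.k : ℕ) = k → c (Sum.inr i) = 0 := by
  -- In the plane both values of `k` are extreme, so `A` never occurs; it is carried along, also as
  -- `A ^ 0`, to fit the four-variable lemma.
  have hj : ∀ i : PhiIndex 2 p, i.j = 0 := fun i => i.j_eq_zero (by omega)
  have key : ∀ t N A b : ℝ, N ∈ Set.Icc (5 : ℝ) 6 → A ∈ Set.Icc (1 : ℝ) 2 → b ∈ Set.Icc (0 : ℝ) 1 →
      ∑ i ∈ Finset.univ.filter (fun i : PhiIndex 2 p => (i.k : ℕ) = k),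
        c (Sum.inl i) * (t ^ i.r * N ^ i.m * A ^ i.j * b ^ i.s) = 0 ∧
      ∑ i ∈ Finset.univ.filter (fun i : TildeTwoIndex p => (i.k : ℕ) = k),
        c (Sum.inr i) * (t ^ i.r * N ^ i.m * A ^ 0 * b ^ i.s) = 0 := by
    intro t N A b hN hA hb
    have ho := orthonormal_rotQuarter hu1
    have hur : inner ℝ u (rotQuarter u) = 0 := ho.2 (show (0 : Fin 2) ≠ 1 by decide)
    have hr1 : ‖rotQuarter u‖ = 1 := ho.1 1
    have hb2 : b ^ 2 ≤ 1 := by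
      have := hb.1; have := hb.2; nlinarith
    have hγ : 0 < N - b ^ 2 := by linarith [hN.1]
    have hs : ∀ σ : ℝ, σ ^ 2 = 1 → ∑ i ∈ Finset.univ.filter (fun i : PhiIndex 2 p => (i.k : ℕ) = k),
        c (Sum.inl i) * (t ^ i.r * N ^ i.m * A ^ i.j * b ^ i.s) +
        (σ * √(N - b ^ 2)) * ∑ i ∈ Finset.univ.filter (fun i : TildeTwoIndex p => (i.k : ℕ) = k),
          c (Sum.inr i) * (t ^ i.r * N ^ i.m * A ^ 0 * b ^ i.s) = 0 := by
      intro σ hσ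
      set y := b • u + (σ * √(N - b ^ 2)) • rotQuarter u with hy
      have hyu : inner ℝ u y = b := by
        rw [hy, inner_add_right, real_inner_smul_right, real_inner_smul_right,
          real_inner_self_eq_norm_sq, hu1, hur]
        ring
      have hyr : inner ℝ (rotQuarter u) y = σ * √(N - b ^ 2) := by
        rw [hy, inner_add_right, real_inner_smul_right, real_inner_smul_right,
          real_inner_self_eq_norm_sq, hr1, real_inner_comm, hur]
        ring
      have hyN : ‖y‖ ^ 2 = N := by
        obtain ⟨B, hB⟩ := exists_orthonormalBasis_coe_eq ho
        have h1 := B.sum_sq_inner_right y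
        rw [Fin.sum_univ_two, hB] at h1
        have h2 : inner ℝ u y ^ 2 + inner ℝ (rotQuarter u) y ^ 2 = ‖y‖ ^ 2 := h1
        rw [← h2, hyu, hyr, mul_pow, hσ, Real.sq_sqrt hγ.le]
        ring
      obtain ⟨x, hx⟩ := exists_inner_eq (by linarith [hN.1]) hyN t
      have h4 := h x y
      simp only [ev_phiField, ev_tildeTwoField, hx, hyN, hyr, hyu, hj, pow_zero] at h4
      rw [← h4, Finset.mul_sum]
      congr 1
      · exact Finset.sum_congr rfl fun i _ => by rw [hj]; ring
      · exact Finset.sum_congr rfl fun i _ => by ring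
    have h1 := hs 1 (by norm_num)
    have h2 := hs (-1) (by norm_num)
    have h3 : √(N - b ^ 2) ≠ 0 := (Real.sqrt_pos.2 hγ).ne'
    refine ⟨by linarith, (mul_eq_zero.1 (?_ : √(N - b ^ 2) * _ = 0)).resolve_left h3⟩
    linarith
  refine ⟨phi_coeff_eq_zero (fun i => c (Sum.inl i)) fun t N A b hN hA hb =>
    (key t N A b hN hA hb).1, fun i hi => ?_⟩
  exact coeff_eq_zero_of_sum_eq_zero
    (Finset.univ.filter fun i : TildeTwoIndex p => (i.k : ℕ) = k)
    (fun i => i.r) (fun i => i.m) (fun _ => 0) (fun i => i.s)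
    (fun _ hi _ hi' h1 h2 _ h4 => TildeTwoIndex.ext h2 h1 h4
      (Fin.ext ((Finset.mem_filter.1 hi).2.trans (Finset.mem_filter.1 hi').2.symm)))
    (fun i => c (Sum.inr i)) (fun t N A b hN hA hb => (key t N A b hN hA hb).2) i
    (Finset.mem_filter.2 ⟨Finset.mem_univ i, hi⟩)

end

theorem isBasisOf_two (p : ℕ) :
    IsBasisOf (Sum.elim (phiFamily 2 p) (tildeTwoFamily p)) (localTensorSpace 2 p) := by
  refine isBasisOf_of_spans (b := twoRank p) (τ := twoField p)
    (κ := Sum.elim (fun i => (i.k : ℕ)) fun i => (i.k : ℕ))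
    (r := Sum.elim (fun i => i.r) fun i => i.r)
    ?_ le_rfl (fun q hq k hk => ?_) (fun k c h i hi => ?_)
    _ (Sum.elim (fun i => coeffC 2 i.k i.r i.s) fun _ => 1) ?_ ?_
  · rintro (i | i)
    · have := i.rank_eq
      simp only [twoRank, Sum.elim_inl]
      omega
    · have := i.rank_eq
      simp only [twoRank, Sum.elim_inr]
      omega
  · refine spansInvariants_of_mem_span fun L u _ _ hu1 T _ => ?_
    have h := ev_mem_span_twoField (L := L) hq hk hu1 T
    simpa only [Finset.filter_filter, Finset.coe_filter, Finset.mem_univ, true_and] using h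
  · have hk : k < 2 := by
      rcases i with i | i
      · rw [← hi]; exact i.k.2
      · rw [← hi]; exact i.k.2
    obtain ⟨L, u, hL, hu, hu1⟩ := exists_submodule_unit (n := 2) (k := k) hk
    have h1 := h L u hL hu hu1
    simp only [sum_filter_sumElim, Sum.elim_inl, Sum.elim_inr, twoField] at h1
    obtain ⟨h2, h3⟩ := twoField_independent hu1 c h1
    rcases i with i | i
    · exact h2 i hi
    · exact h3 i hi
  · rintro (i | i)
    · exact coeffC_ne_zero i.k.2 _ _
    · exact one_ne_zero
  · rintro (i | i) P η y
    · exact ev_phiFamily i P η y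
    · exact (ev_tildeTwoFamily i P η y).trans (one_mul _).symm

end LocalTensor

theorem theorem2 (p : ℕ) :
    (∀ n : ℕ, 4 ≤ n →
      LocalTensor.IsBasisOf (LocalTensor.phiFamily n p) (LocalTensor.localTensorSpace n p)) ∧
    LocalTensor.IsBasisOf
      (Sum.elim (LocalTensor.phiFamily 3 p) (LocalTensor.tildeThreeFamily p))
      (LocalTensor.localTensorSpace 3 p) ∧
    LocalTensor.IsBasisOf
      (Sum.elim (LocalTensor.phiFamily 2 p) (LocalTensor.tildeTwoFamily p))
      (LocalTensor.localTensorSpace 2 p) :=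
  ⟨fun _ hn => LocalTensor.isBasisOf_phiFamily hn p, LocalTensor.isBasisOf_three p,
    LocalTensor.isBasisOf_two p⟩
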